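/- **Setting.** Let $\nu$ be a valuation of rank one of a field $K$, written additively with values in $\mathbb R\cup\{\infty\}$, let $L=K[x]$ be a finite separable extension of degree $n$, and let $f$ be the minimal polynomial of $x$ over $K$. Assume that all coefficients of $f$ other than the leading one have positive value. For a monic polynomial $Q$ of positive degree write $h=\sum_j d_jQ^j$ with $\deg d_j<\deg Q$ (the $Q$-expansion of $h$). **Vertices.** We consider branches of key polynomials, starting with $Q_1=X$, $\alpha_1=1$, $\theta_1=n$. At a vertex $Q_l$ of a branch the values $\nu'(c)$ of all polynomials $c$ with $\deg c<\deg Q_l$ are already determined (by $\nu$ if $l=1$). Let $f=\sum_j a_jQ_l^j$ be the $Q_l$-expansion of $f$. For $\beta\in\mathbb R$ put $\nu_{l}(\sum d_jQ_l^j)=\min_j(\nu'(d_j)+j\beta)$, let $S_\beta$ be the set of all $j$ with $\nu'(a_j)+j\beta=\nu_l(f)$, $\delta=\max S_\beta$, and let $\mathrm{in}_lf=\sum_{j\in S_\beta}\mathrm{in}(a_j)\bar Q^j$, where $\mathrm{in}$ denotes initial forms in the graded algebra of the valuation $\nu_l$ of $K[X]$. The number $\beta\ge 0$ is a *possible value*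 of $Q_l$ if $\#S_\beta\ge2$ ($\beta$ determines a side of the $l$-th Newton polygon of $f$) and (*) $\beta>\alpha_l\beta_{l-1}$ if $l>1$ has an immediate predecessor and $\beta_{l-1}$ is the value chosen for $Q_{l-1}$; $\beta\ge\alpha_l\bar\beta_l$ if $l=l_0+\omega$, where $\bar\beta_l=\sup_t\beta_{l_0+t}$. Let $T$ (for given $\beta$) be the set of all $Q'=Q_l+z_0+\dots+z_i$ with $\deg z_j<\deg Q_l$ such that for each partial sum $Q'_j=Q_l+z_0+\dots+z_{j-1}$, $j\le i$, the initial form of $f$ along the side with upper endpoint at height $\delta$ of the Newton polygon of $f$ with respect to $Q'_j$ is $\mathrm{in}(a)(\bar Q+\mathrm{in}\,z_j)^\delta$, $a$ being the coefficient of $Q_j'^{\,\delta}$, and such that the Newton polygon of $f$ with respect to each partial sum, including $Q'$ itself, has a side with upper endpoint at height $\delta$. Let $\beta(Q')$ be the number which determines this side for $Q'$. Order $T$ by extension of sums. *Case (a)*: $\operatorname{char}K=p>0$, $Q_l$ has a unique possible value $\beta$, the set $T$ has no maximal element, and $\{\beta(Q')\mid Q'\in T\}$ is bounded. *Case (b)*: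 otherwise. **The tree.** Let $U$ be a tree whose least vertex is $Q_1=X$ and in which the vertices immediately following a vertex $Q_l$ are the following. In Case (b): for each possible value $\beta$ of $Q_l$ and each monic irreducible factor $g\neq\bar Q$ of $\mathrm{in}_lf$ in $G_\nu[\mathrm{in}\,Q_i,\,i<l][\bar Q]$, one vertex $Q_{l+1}=Q_l^{\alpha}+\sum_{j<\alpha}c_jQ_l^j$ with $\alpha=\deg g$, $\deg c_j<\deg Q_l$, which lifts $g$, that is, $g=\bar Q^\alpha+\sum_{j<\alpha}\mathrm{in}(c_j)\bar Q^j$ (any lifting may be chosen). The new values are $\nu'=\nu_l$ on polynomials of degree $<\deg Q_{l+1}$. Put $\alpha_{l+1}=\alpha$ and, with $f=\sum d_jQ_{l+1}^j$ the $Q_{l+1}$-expansion, $\theta_{l+1}=\min\{j\mid\nu_l(d_jQ_{l+1}^j)=\nu_l(f)\}$. In Case (a): exactly one vertex $Q_{l+\omega}$, obtained by choosing a sequence $Q_{l},Q_{l+1},Q_{l+2},\dots$ in $T$, each term an immediate successor of the preceding one, with values $\beta_{l+t}=\beta(Q_{l+t})$ such that $\lim_t\beta_{l+t}=\sup_{Q'\in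 T}\beta(Q')=:\bar\beta$. Let $p^e$ be the highest power of $p$ dividing $\delta$. Then $Q_{l+\omega}$ is monic of degree $p^{e_0}\deg Q_l$ with $1\le e_0\le e$; for some $i=l+t$ its $Q_i$-expansion involves only $Q_i^0$ and the powers $Q_i^{p^k}$; its value is at least $p^{e_0}\bar\beta$, that is, for each $t$ its value under the valuation attached to some $(Q_{l+s},\beta_{l+s})$ exceeds $p^{e_0}\beta_{l+t}$; and $e_0$ is the least integer for which such a polynomial exists. The new values of polynomials of degree $<\deg Q_{l+\omega}$ are the stable values under the valuations attached to $(Q_{l+t},\beta_{l+t})$. Put $\alpha_{l+\omega}=p^{e_0}$ and $\theta_{l+\omega}=\delta/\alpha_{l+\omega}$ (integer quotient). **Proposition.** (1) Let $Q_l$ be a vertex of $U$ in Case (b) with $Q_l(x)\ne0$. Then only finitely many vertices $Q_{l+1}^{(1)},\dots,Q_{l+1}^{(s)}$ immediately follow $Q_l$, and $$\sum_{j=1}^s\alpha_{l+1}^{(j)}\theta_{l+1}^{(j)}=\theta_l .$$ (2) If $Q_l$ is in Case (a) and $Q_{l+\omega}$ is the vertex which follows it, then $\theta_l=\alpha_{l+\omega}\theta_{l+\omega}$.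 **Corollary.** Let $U'\subset U$ be a finite subtree with least element $Q_l$ which, whenever it contains one vertex of $U$ immediately following a vertex of $U'$, contains all of them. Let $Q_{l_1},\dots,Q_{l_t}$ be the maximal vertices of $U'$. Then $$\theta_l=\sum_{j=1}^t\Bigl(\prod_{Q_l<Q_{l'}\le Q_{l_j}}\alpha_{l'}\Bigr)\theta_{l_j}.$$ Moreover $\theta_1=n$; hence, if $Q_l=Q_1$ (for example $U'=U$ when $U$ is finite), $$n=\sum_{j=1}^t\Bigl(\prod_{Q_{l'}\in D_j}\alpha_{l'}\Bigr)\Bigl(\prod_{Q_{l'}\in E_j}\alpha_{l'}\Bigr)\theta_{l_j},$$ where $D_j$ is the set of the vertices $Q_{l'}\le Q_{l_j}$ whose immediately preceding vertex is in Case (a), and $E_j$ is the set of the other vertices $Q_{l'}\le Q_{l_j}$. -/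

import Mathlib

open Polynomial

noncomputable section

namespace KeyPoly

/-! ### Graded algebras -/

section Graded

variable {R : Type*} [CommRing R]

/-- The Rees-type ring of all finite sums `∑ a_β T^β` with `μ a_β ≥ β`, as a subring of the group
algebra `R[T^ℝ]`: the subring generated by the monomials `a T^β` with `μ a ≥ β`. -/
def rees (μ : R → WithTop ℝ) : Subring (AddMonoidAlgebra R ℝ) :=
  Subring.closure {y | ∃ (β : ℝ) (a : R), (β : WithTop ℝ) ≤ μ a ∧ y = AddMonoidAlgebra.single β a}

/-- The ideal of the Rees-type ring generated by the monomials `a T^β` with `μ a > β`. -/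
def reesIdeal (μ : R → WithTop ℝ) : Ideal (rees μ) :=
  Ideal.span {y | ∃ (β : ℝ) (a : R),
    (β : WithTop ℝ) < μ a ∧ (y : AddMonoidAlgebra R ℝ) = AddMonoidAlgebra.single β a}

/-- The graded algebra `⨁_β P_β / P_{β+}` of a valuation `μ` of `R`, where
`P_β = {a | μ a ≥ β}` and `P_{β+} = {a | μ a > β}`. -/
abbrev Gr (μ : R → WithTop ℝ) : Type _ := rees μ ⧸ reesIdeal μ

open Classical in
/-- The initial form of `a`: its class in `P_{μ a} / P_{(μ a)+}`; it is `0` if `μ a = ∞`. -/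
def inForm (μ : R → WithTop ℝ) (a : R) : Gr μ :=
  if h : μ a = ⊤ then 0
  else Ideal.Quotient.mk (reesIdeal μ)
    ⟨AddMonoidAlgebra.single ((μ a).untop h) a,
      Subring.subset_closure ⟨(μ a).untop h, a, (WithTop.coe_untop _ h).le, rfl⟩⟩

end Graded

variable {K : Type*} [Field K]

/-! ### Expansions, Newton polygons and initial forms with respect to a monic polynomial

Below, `w` gives the values of the polynomials of degree less than `deg Q`; the polynomials of
degree less than `deg Q` are the standard expansions not involving `Q`. -/

/-- The `j`-th coefficient `d_j` of the `Q`-adic expansion `h = ∑ d_j Q ^ j`, `deg d_j < deg Q`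
(for `Q` monic). -/
def digit (Q h : K[X]) (j : ℕ) : K[X] := (h /ₘ Q ^ j) %ₘ Q

/-- `min_j (w d_j + j β)`, where `h = ∑ d_j Q ^ j`. -/
def truncVal (w : K[X] → WithTop ℝ) (Q : K[X]) (β : ℝ) (h : K[X]) : WithTop ℝ :=
  (Finset.range (h.natDegree + 1)).inf fun j => w (digit Q h j) + ((j * β : ℝ) : WithTop ℝ)

open Classical in
/-- The set of all `j` such that the point `(w d_j, j)` lies on the line of the Newton polygon of
`h` that is determined by `β`. -/
def sideSet (w : K[X] → WithTop ℝ) (Q : K[X]) (β : ℝ) (h : K[X]) : Finset ℕ :=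
  (Finset.range (h.natDegree + 1)).filter fun j =>
    w (digit Q h j) + ((j * β : ℝ) : WithTop ℝ) = truncVal w Q β h

/-- `β` determines a side of the Newton polygon of `h`. -/
def DeterminesSide (w : K[X] → WithTop ℝ) (Q : K[X]) (β : ℝ) (h : K[X]) : Prop :=
  2 ≤ (sideSet w Q β h).card

/-- The height `δ` of the upper endpoint of the side determined by `β` (the pivotal vertex). -/
def topIndex (w : K[X] → WithTop ℝ) (Q : K[X]) (β : ℝ) (h : K[X]) : ℕ :=
  (sideSet w Q β h).sup id

/-- The initial form `∑ in(d_j) Q̄ ^ j` of `h`, the sum being over the points of the side determined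
by `β`; `Q̄` is the polynomial variable. -/
def inPoly (w : K[X] → WithTop ℝ) (Q : K[X]) (β : ℝ) (h : K[X]) : (Gr (truncVal w Q β))[X] :=
  ∑ j ∈ sideSet w Q β h, C (inForm (truncVal w Q β) (digit Q h j)) * X ^ j

/-- `β` determines a side of the Newton polygon of `f` with upper endpoint at height `δ`. -/
def IsCharSide (w : K[X] → WithTop ℝ) (f Q : K[X]) (β : ℝ) (δ : ℕ) : Prop :=
  DeterminesSide w Q β f ∧ topIndex w Q β f = δ

/-- The initial form of `f` along the side determined by `β` is `in(a_δ) (Q̄ + in z) ^ δ`, where `z`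
has degree less than `deg Q`. -/
def IsLinearPower (w : K[X] → WithTop ℝ) (f Q : K[X]) (β : ℝ) (δ : ℕ) (z : K[X]) : Prop :=
  z.degree < Q.degree ∧
  inPoly w Q β f = C (inForm (truncVal w Q β) (digit Q f δ)) *
    (X + C (inForm (truncVal w Q β) z)) ^ δ

/-- The set `T` of all `Q' = Q + z_0 + ⋯ + z_i` such that, for every partial sum `Q'_j`, the initial
form of `f` along the characteristic side of its Newton polygon with respect to `Q'_j` (the side with
upper endpoint at height `δ`) is `in(a_δ) (Q̄ + in z_j) ^ δ`. An element `Q'` is recorded together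
with the number `β'` which determines its characteristic side. -/
inductive InT (w : K[X] → WithTop ℝ) (f Q : K[X]) (β : ℝ) (δ : ℕ) : K[X] → ℝ → Prop
  | base : InT w f Q β δ Q β
  | step (Q' : K[X]) (β' : ℝ) (z : K[X]) (β'' : ℝ) : InT w f Q β δ Q' β' →
      IsLinearPower w f Q' β' δ z → IsCharSide w f (Q' + z) β'' δ → InT w f Q β δ (Q' + z) β''

/-- `T` has no maximal element, and the values of its elements are bounded. -/
def NoMaxBounded (w : K[X] → WithTop ℝ) (f Q : K[X]) (β : ℝ) (δ : ℕ) : Prop :=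
  (∀ Q' β', InT w f Q β δ Q' β' →
    ∃ z β'', IsLinearPower w f Q' β' δ z ∧ IsCharSide w f (Q' + z) β'' δ) ∧
  ∃ B : ℝ, ∀ Q' β', InT w f Q β δ Q' β' → β' ≤ B

/-- An infinite sequence `Q_l = Qs 0, Qs 1, …` in `T`, each term an immediate successor of the
preceding one, whose values `βs t` tend to the supremum of the values of the elements of `T`. -/
def IsLimitSeq (w : K[X] → WithTop ℝ) (f Q : K[X]) (β : ℝ) (δ : ℕ)
    (Qs : ℕ → K[X]) (βs : ℕ → ℝ) : Prop :=
  Qs 0 = Q ∧ βs 0 = β ∧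
  (∀ t, IsLinearPower w f (Qs t) (βs t) δ (Qs (t + 1) - Qs t) ∧
    IsCharSide w f (Qs (t + 1)) (βs (t + 1)) δ) ∧
  ∀ Q' β', InT w f Q β δ Q' β' → ∃ t, β' ≤ βs t

/-- `q` is, for some `i`, a weakly affine expansion in `Qs i`, monic of degree `p ^ e₀` in `Qs i`,
with `1 ≤ e₀ ≤ e` where `p ^ e` is the highest power of `p` that divides `δ`, and its value is at
least `p ^ e₀ * sup βs`: its values for the valuations attached to the `Qs t` eventually
exceed every `p ^ e₀ * βs t`. -/
def IsWeaklyAffineLimit (w : K[X] → WithTop ℝ) (p : ℕ) (Q : K[X]) (δ : ℕ)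
    (Qs : ℕ → K[X]) (βs : ℕ → ℝ) (e₀ : ℕ) (q : K[X]) : Prop :=
  1 ≤ e₀ ∧ e₀ ≤ padicValNat p δ ∧
  q.Monic ∧ q.natDegree = p ^ e₀ * Q.natDegree ∧
  (∃ i, ∀ j, 0 < j → digit (Qs i) q j ≠ 0 → ∃ e : ℕ, j = p ^ e) ∧
  ∀ t, ∃ i, (((p : ℝ) ^ e₀ * βs t : ℝ) : WithTop ℝ) < truncVal w (Qs i) (βs i) q

/-- The limit key polynomials `Q_{l+ω}`: weakly affine, with the least possible `e₀`. -/
def IsLimitKey (w : K[X] → WithTop ℝ) (p : ℕ) (Q : K[X]) (δ : ℕ)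
    (Qs : ℕ → K[X]) (βs : ℕ → ℝ) (q : K[X]) : Prop :=
  ∃ e₀, IsWeaklyAffineLimit w p Q δ Qs βs e₀ q ∧
    ∀ e₁ q₁, IsWeaklyAffineLimit w p Q δ Qs βs e₁ q₁ → e₀ ≤ e₁

open Classical in
/-- The value at which the sequence `s` stabilizes (`∞` if it does not stabilize). -/
def stableValue (s : ℕ → WithTop ℝ) : WithTop ℝ :=
  if h : ∃ a, ∀ᶠ t in Filter.atTop, s t = a then h.choose else ⊤

/-! ### Vertices -/

/-- A vertex `Q_l` together with all the data that precede it in its branch.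
`root` is the vertex `Q_1 = X`; `step b β Q` is the vertex `Q = Q_{l+1}` that
follows the vertex `b` when the value of the key polynomial of `b` is `β`; `limit b Qs βs q` is the
vertex `q = Q_{l+ω}` that follows the vertex `b` when the key polynomials `Q_{l+t}` and their values
are `Qs t` and `βs t`. -/
inductive Branch (K : Type*) [Field K] : Type _
  | root : Branch K
  | step (b : Branch K) (β : ℝ) (Q : K[X]) : Branch K
  | limit (b : Branch K) (Qs : ℕ → K[X]) (βs : ℕ → ℝ) (q : K[X]) : Branch K

namespace Branch

/-- The key polynomial `Q_l` at the vertex. -/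
def key : Branch K → K[X]
  | root => X
  | step _ _ Q => Q
  | limit _ _ _ q => q

/-- The key polynomials that precede `Q_l` in the branch. -/
def preceding : Branch K → Set K[X]
  | root => ∅
  | step b _ _ => insert b.key b.preceding
  | limit b Qs _ _ => b.preceding ∪ Set.range Qs

/-- The values `ν'(c)` of the polynomials `c` of degree less than `deg Q_l`, which are determined by
the branch. -/
def coeffVal (v : AddValuation K (WithTop ℝ)) : Branch K → K[X] → WithTop ℝ
  | root => fun c => v (c.coeff 0)
  | step b β _ => truncVal (b.coeffVal v) b.key β
  | limit b Qs βs _ => fun c => stableValue fun t => truncVal (b.coeffVal v) (Qs t) (βs t) c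

/-- The valuation `ν_l` of `K[X]` obtained by giving `Q_l` the value `β`. -/
def val (v : AddValuation K (WithTop ℝ)) (b : Branch K) (β : ℝ) : K[X] → WithTop ℝ :=
  truncVal (b.coeffVal v) b.key β

/-- `α_l`: the degree of `Q_l` in the preceding vertex; `α_1 = 1`. -/
def alpha : Branch K → ℕ
  | root => 1
  | step b _ Q => Q.natDegree / b.key.natDegree
  | limit b _ _ q => q.natDegree / b.key.natDegree

/-- `θ_l(f)`, the height of the characteristic vertex: `θ_1 = deg f`; if `f = ∑ d_j Q_{l+1} ^ j`
then `θ_{l+1}` is the least `j` with `ν_l(d_j Q_{l+1} ^ j) = ν_l(f)`; and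
`θ_{l+ω} = δ / α_{l+ω}`. -/
def theta (v : AddValuation K (WithTop ℝ)) (f : K[X]) : Branch K → ℕ
  | root => f.natDegree
  | step b β Q => sInf {j | j ≤ f.natDegree ∧ b.val v β (digit Q f j * Q ^ j) = b.val v β f}
  | limit b Qs βs q =>
      topIndex (b.coeffVal v) b.key (βs 0) f / (limit b Qs βs q).alpha

/-- Condition (*) on the value `β` of `Q_l`. -/
def CondStar : Branch K → ℝ → Prop
  | root, _ => True
  | step b β' Q, β => ((step b β' Q).alpha : ℝ) * β' < β
  | limit b Qs βs q, β => ((limit b Qs βs q).alpha : ℝ) * (⨆ t, βs t) ≤ β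

/-- The possible values `β` of `Q_l`: those which determine a side of the Newton polygon of `f`
and satisfy Condition (*). -/
def Admissible (v : AddValuation K (WithTop ℝ)) (f : K[X]) (b : Branch K) (β : ℝ) : Prop :=
  0 ≤ β ∧ DeterminesSide (b.coeffVal v) b.key β f ∧ b.CondStar β

/-- The algebra `G_ν[in Q_i, i < l]`. -/
def coeffRing (v : AddValuation K (WithTop ℝ)) (b : Branch K) (β : ℝ) :
    Subring (Gr (b.val v β)) :=
  Subring.closure
    (Set.range (fun a : K => inForm (b.val v β) (C a)) ∪ inForm (b.val v β) '' b.preceding)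

/-- `g` is a monic irreducible factor of `in_l f` in `G_ν[in Q_i, i < l][Q̄]`, other than `Q̄`. -/
def IsFactor (v : AddValuation K (WithTop ℝ)) (f : K[X]) (b : Branch K) (β : ℝ)
    (g : (b.coeffRing v β)[X]) : Prop :=
  g.Monic ∧ Irreducible g ∧ g ≠ X ∧
  g.map (b.coeffRing v β).subtype ∣ inPoly (b.coeffVal v) b.key β f

/-- `Q' = Q_l ^ α + ∑_{j < α} c_j Q_l ^ j`, with `deg c_j < deg Q_l`, is a lifting of
`g = Q̄ ^ α + ∑_{j < α} in(c_j) Q̄ ^ j`. -/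
def IsLift (v : AddValuation K (WithTop ℝ)) (b : Branch K) (β : ℝ)
    (g : (b.coeffRing v β)[X]) (Q' : K[X]) : Prop :=
  Q'.Monic ∧ Q'.natDegree = g.natDegree * b.key.natDegree ∧
  ∀ j < g.natDegree, inForm (b.val v β) (digit b.key Q' j) = (g.coeff j : Gr (b.val v β))

/-- Case (a): `char K = p > 0`, there is a unique possible value `β` of `Q_l`, and the set `T` of
`Q_l` has no maximal element and has bounded values. Case (b) is its negation. -/
def CaseA (v : AddValuation K (WithTop ℝ)) (f : K[X]) (b : Branch K) : Prop :=
  0 < ringChar K ∧ ∃ β, (∀ β', b.Admissible v f β' ↔ β' = β) ∧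
    NoMaxBounded (b.coeffVal v) f b.key β (topIndex (b.coeffVal v) b.key β f)

/-- `c` immediately follows `b`. -/
def Follows : Branch K → Branch K → Prop
  | _, root => False
  | b, step b' _ _ => b = b'
  | b, limit b' _ _ _ => b = b'

/-- The partial order of the vertices. -/
def Le : Branch K → Branch K → Prop := Relation.ReflTransGen Follows

end Branch

open Branch

/-- `U` is a tree of branches of the algorithm for `f`: a vertex in Case (b) is
followed by exactly one lifting `Q_{l+1}` for every possible value `β` of `Q_l` and every monic
irreducible factor `g ≠ Q̄` of `in_l f`; a vertex in Case (a) is followed by exactly one vertex, a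
limit key polynomial `Q_{l+ω}`. -/
structure IsAlgorithmTree (v : AddValuation K (WithTop ℝ)) (f : K[X]) (U : Set (Branch K)) :
    Prop where
  root_mem : root ∈ U
  mem_of_follows : ∀ b c, Follows b c → c ∈ U → b ∈ U
  existsUnique_step : ∀ b ∈ U, ¬ b.CaseA v f → ∀ β, b.Admissible v f β →
    ∀ g, b.IsFactor v f β g → ∃! Q', b.IsLift v β g Q' ∧ step b β Q' ∈ U
  eq_step : ∀ b ∈ U, ¬ b.CaseA v f → ∀ c ∈ U, Follows b c →
    ∃ β g Q', b.Admissible v f β ∧ b.IsFactor v f β g ∧ b.IsLift v β g Q' ∧ c = step b β Q'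
  existsUnique_limit : ∀ b ∈ U, b.CaseA v f → ∃! c, c ∈ U ∧ Follows b c
  eq_limit : ∀ b ∈ U, b.CaseA v f → ∀ c ∈ U, Follows b c →
    ∃ β Qs βs q, b.Admissible v f β ∧
      IsLimitSeq (b.coeffVal v) f b.key β (topIndex (b.coeffVal v) b.key β f) Qs βs ∧
      IsLimitKey (b.coeffVal v) (ringChar K) b.key (topIndex (b.coeffVal v) b.key β f) Qs βs q ∧
      c = limit b Qs βs q

/-- The vertices of `U` which immediately follow `b`. -/
def followers (U : Set (Branch K)) (b : Branch K) : Set (Branch K) := {c | c ∈ U ∧ Follows b c}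

/-- `U'` is a finite subtree of `U` with least element `b₀` which, as soon as it contains one of the
vertices of `U` immediately following a vertex `b` of `U'`, contains all of them. -/
structure IsFullSubtree (U : Set (Branch K)) (b₀ : Branch K) (U' : Finset (Branch K)) : Prop where
  subset : ∀ b ∈ U', b ∈ U
  base_mem : b₀ ∈ U'
  exists_mem : ∀ c ∈ U', c ≠ b₀ → ∃ b ∈ U', Follows b c
  base_le : ∀ c ∈ U', Le b₀ c
  full : ∀ b ∈ U', (∃ c ∈ U', Follows b c) → ∀ c ∈ followers U b, c ∈ U'

open Classical in
/-- The maximal vertices of a finite subtree. -/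
def leaves (U' : Finset (Branch K)) : Finset (Branch K) :=
  U'.filter fun m => ∀ c ∈ U', Le m c → c = m

open Classical in
/-- The vertices `c` of `U'` with `b₀ < c ≤ m`. -/
def pathTo (U' : Finset (Branch K)) (b₀ m : Branch K) : Finset (Branch K) :=
  U'.filter fun c => c ≠ b₀ ∧ Le c m

/-- The vertex immediately preceding `c` is in Case (a). -/
def AfterCaseA (v : AddValuation K (WithTop ℝ)) (f : K[X]) (c : Branch K) : Prop :=
  ∃ b, Follows b c ∧ b.CaseA v f

open Classical in
/-- The set `D`: the vertices `c ≤ m` of `U'` whose preceding vertex is in Case (a). -/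
def setD (v : AddValuation K (WithTop ℝ)) (f : K[X]) (U' : Finset (Branch K)) (m : Branch K) :
    Finset (Branch K) :=
  U'.filter fun c => Le c m ∧ AfterCaseA v f c

open Classical in
/-- The set `E`: the other vertices `c ≤ m` of `U'`. -/
def setE (v : AddValuation K (WithTop ℝ)) (f : K[X]) (U' : Finset (Branch K)) (m : Branch K) :
    Finset (Branch K) :=
  U'.filter fun c => Le c m ∧ ¬ AfterCaseA v f c

end KeyPoly

end

noncomputable section
namespace KeyPoly

/-! ### Valuations as functions -/

/-! The proof is a count of multiplicities in graded algebras. Let `Q` be a key polynomial of value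
β, and let `A` be the ring generated by the initial forms of the polynomials of degree less than
`deg Q`. Two facts about the valuation `truncVal w Q β` carry everything: the nonzero homogeneous
elements of `A` are invertible (`StrictKey.gradedField`), and the initial form of `Q` is
transcendental over `A` (`StrictKey.evKey_injective`). Hence the initial form of `f` along a side is
a homogeneous polynomial over `A`, and Euclid's algorithm factors it uniquely into a unit, a power
of the variable and monic irreducible polynomials `g`. The degrees of the factors `g`, with
multiplicities, add up to the height of the side, upper minus lower endpoint
(`StrictKey.exists_factors`).

If `Q'` lifts `g` and `α = deg g`, the `Q'`-expansion with slope αβ computes the same valuation, and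
the multiplicity of `g` is the least index on the corresponding line of the Newton polygon of `f`,
which is θ of the new vertex (`Lifts.exists_eq_pow_mul`). Summing αθ over the `g` of one side gives
its height. By Condition (*) the admissible sides are those below the characteristic vertex, and
they stack up from height 0 to θ (`IsKey.exists_sides`, `IsKey.exists_sides_of_le`). This is part
(1).

In Case (a) the value of `f` along the sequence is `A + δ β_t` with constant `A`. If all polynomials
of degree less than that of the limit polynomial `q` have stable values, the `q`-expansion of `f`
shows that this value is eventually `a + J p^e₀ β_t`, where `J` is the height of the upper endpoint
for the slope `p^e₀ sup β_t`. Comparison gives `δ = p^e₀ J` (`LimitData.topIndex_mul`), which is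
part (2).

The hard point is stability. An unstable polynomial of least degree is expanded by Taylor's formula
in a late `Q_t`. The terms that decide the limit of its values have orders which are powers of `p`,
because other orders would bring in a nonzero binomial coefficient and a contradiction. Keeping only
these terms and the constant one yields a weakly affine polynomial of no larger degree
(`UnstableData.exists_weaklyAffine`). Below `deg q` this contradicts the minimality of `e₀`, or, in
the degree of `Q`, the choice of the sequence (`LimitData.not_exists_limit`).

That each vertex really carries such a valuation, and that its coefficient ring is the ring `A`
above, is proved by induction along the branch (`Branch.Good`). The corollary is a formal induction
over the finite tree. -/

/-- A valuation with real values which takes the value `∞` only at `0`, as a function. -/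
structure IsVal {R : Type*} [CommRing R] (μ : R → WithTop ℝ) : Prop where
  map_zero : μ 0 = ⊤
  map_one : μ 1 = 0
  map_add : ∀ a b, min (μ a) (μ b) ≤ μ (a + b)
  map_mul : ∀ a b, μ (a * b) = μ a + μ b
  ne_top : ∀ a, a ≠ 0 → μ a ≠ ⊤

namespace IsVal

variable {R : Type*} [CommRing R] {μ : R → WithTop ℝ} (hμ : IsVal μ)
include hμ

lemma map_neg (a : R) : μ (-a) = μ a :=
  (AddValuation.of μ hμ.map_zero hμ.map_one hμ.map_add hμ.map_mul).map_neg a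

lemma map_sub (a b : R) : min (μ a) (μ b) ≤ μ (a - b) :=
  (AddValuation.of μ hμ.map_zero hμ.map_one hμ.map_add hμ.map_mul).map_sub a b

lemma map_sub_swap (a b : R) : μ (a - b) = μ (b - a) :=
  (AddValuation.of μ hμ.map_zero hμ.map_one hμ.map_add hμ.map_mul).map_sub_swap a b

lemma map_pow (a : R) (n : ℕ) : μ (a ^ n) = n • μ a :=
  (AddValuation.of μ hμ.map_zero hμ.map_one hμ.map_add hμ.map_mul).map_pow a n

lemma map_add_eq {a b : R} (h : μ a < μ b) : μ (a + b) = μ a :=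
  (AddValuation.of μ hμ.map_zero hμ.map_one hμ.map_add hμ.map_mul).map_add_eq_of_lt_left h

lemma eq_of_lt_sub {a b : R} (h : μ a < μ (b - a)) : μ b = μ a :=
  (AddValuation.of μ hμ.map_zero hμ.map_one hμ.map_add hμ.map_mul).map_eq_of_lt_sub h

lemma le_add {a b : R} {γ : WithTop ℝ} (ha : γ ≤ μ a) (hb : γ ≤ μ b) : γ ≤ μ (a + b) :=
  (le_min ha hb).trans (hμ.map_add a b)

lemma lt_add {a b : R} {γ : WithTop ℝ} (ha : γ < μ a) (hb : γ < μ b) : γ < μ (a + b) :=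
  (lt_min ha hb).trans_le (hμ.map_add a b)

lemma le_sub {a b : R} {γ : WithTop ℝ} (ha : γ ≤ μ a) (hb : γ ≤ μ b) : γ ≤ μ (a - b) :=
  (le_min ha hb).trans (hμ.map_sub a b)

lemma le_sum {ι : Type*} {s : Finset ι} {f : ι → R} {γ : WithTop ℝ} (h : ∀ i ∈ s, γ ≤ μ (f i)) :
    γ ≤ μ (∑ i ∈ s, f i) :=
  (AddValuation.of μ hμ.map_zero hμ.map_one hμ.map_add hμ.map_mul).map_le_sum h

lemma lt_sum {ι : Type*} {s : Finset ι} {f : ι → R} {γ : ℝ} (h : ∀ i ∈ s, (γ : WithTop ℝ) < μ (f i)) :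
    (γ : WithTop ℝ) < μ (∑ i ∈ s, f i) :=
  (AddValuation.of μ hμ.map_zero hμ.map_one hμ.map_add hμ.map_mul).map_lt_sum
    (WithTop.coe_ne_top) h

lemma exists_real {a : R} (ha : a ≠ 0) : ∃ r : ℝ, μ a = r :=
  ⟨_, (WithTop.coe_untop _ (hμ.ne_top a ha)).symm⟩

end IsVal

/-- A finite summand crosses the inequality as its opposite, which stays meaningful when `a` or `γ`
is `∞`. -/
lemma withTop_le_add_iff {a γ : WithTop ℝ} {b : ℝ} : γ ≤ a + (b : WithTop ℝ) ↔
    γ + ((-b : ℝ) : WithTop ℝ) ≤ a := by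
  induction γ using WithTop.recTopCoe <;> induction a using WithTop.recTopCoe
  · simp
  · simp only [WithTop.top_add, top_le_iff]; norm_cast; simp
  · simp
  · norm_cast; constructor <;> intro h <;> linarith

/-! ### Expansions -/

variable {K : Type*} [Field K] {Q : K[X]}

lemma degree_digit_lt (hQ : Q.Monic) (h : K[X]) (j : ℕ) : (digit Q h j).degree < Q.degree :=
  degree_modByMonic_lt _ hQ

@[simp] lemma digit_zero_right (j : ℕ) : digit Q 0 j = 0 := by simp [digit]

lemma digit_zero (h : K[X]) : digit Q h 0 = h %ₘ Q := by simp [digit]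

lemma add_mul_divByMonic (hQ : Q.Monic) {u : K[X]} (v : K[X]) (hu : u.degree < Q.degree) :
    (u + Q * v) /ₘ Q = v :=
  (div_modByMonic_unique v u hQ ⟨rfl, hu⟩).1

lemma add_mul_modByMonic (hQ : Q.Monic) {u : K[X]} (v : K[X]) (hu : u.degree < Q.degree) :
    (u + Q * v) %ₘ Q = u :=
  (div_modByMonic_unique v u hQ ⟨rfl, hu⟩).2

lemma add_divByMonic (hQ : Q.Monic) (a b : K[X]) : (a + b) /ₘ Q = a /ₘ Q + b /ₘ Q :=
  (div_modByMonic_unique _ (a %ₘ Q + b %ₘ Q) hQ ⟨by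
    conv_rhs => rw [← modByMonic_add_div a Q, ← modByMonic_add_div b Q]
    ring, (degree_add_le _ _).trans_lt
      (max_lt (degree_modByMonic_lt _ hQ) (degree_modByMonic_lt _ hQ))⟩).1

/-- The remainder for the higher power is assembled from the remainders of the divisions by `Q` and
by `Q ^ j`. Thus digits arise by repeated division by `Q`, on which all inductions over expansions
rest. -/
lemma divByMonic_pow_succ (hQ : Q.Monic) (h : K[X]) (j : ℕ) :
    h /ₘ Q ^ (j + 1) = (h /ₘ Q) /ₘ Q ^ j := by
  refine (div_modByMonic_unique ((h /ₘ Q) /ₘ Q ^ j) (h %ₘ Q + Q * ((h /ₘ Q) %ₘ Q ^ j))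
    (hQ.pow _) ⟨?_, ?_⟩).1
  · conv_rhs => rw [← modByMonic_add_div h Q, ← modByMonic_add_div (h /ₘ Q) (Q ^ j)]
    ring
  · refine (degree_add_le _ _).trans_lt (max_lt ?_ ?_)
    · refine (degree_modByMonic_lt _ hQ).trans_le ?_
      rw [pow_succ', degree_mul]
      have : (0 : WithBot ℕ) ≤ (Q ^ j).degree := by
        rw [zero_le_degree_iff]; exact (hQ.pow j).ne_zero
      calc Q.degree = Q.degree + 0 := (add_zero _).symm
        _ ≤ _ := by gcongr
    · rw [pow_succ', degree_mul, degree_mul]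
      have := degree_modByMonic_lt (h /ₘ Q) (hQ.pow j)
      exact WithBot.add_lt_add_left (degree_ne_bot.2 hQ.ne_zero) this

lemma digit_succ (hQ : Q.Monic) (h : K[X]) (j : ℕ) :
    digit Q h (j + 1) = digit Q (h /ₘ Q) j := by
  rw [digit, digit, divByMonic_pow_succ hQ]

lemma digit_add_mul_zero (hQ : Q.Monic) {u : K[X]} (v : K[X]) (hu : u.degree < Q.degree) :
    digit Q (u + Q * v) 0 = u := by
  rw [digit_zero, add_mul_modByMonic hQ v hu]

lemma digit_add_mul_succ (hQ : Q.Monic) {u : K[X]} (v : K[X]) (hu : u.degree < Q.degree) (j : ℕ) :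
    digit Q (u + Q * v) (j + 1) = digit Q v j := by
  rw [digit_succ hQ, add_mul_divByMonic hQ v hu]

lemma digit_mul_succ (hQ : Q.Monic) (hQ0 : 0 < Q.degree) (v : K[X]) (j : ℕ) :
    digit Q (Q * v) (j + 1) = digit Q v j := by
  have := digit_add_mul_succ hQ (u := 0) v (by simpa using bot_lt_iff_ne_bot.2 hQ0.ne_bot) j
  simpa using this

lemma digit_of_degree_lt (hQ : Q.Monic) {u : K[X]} (hu : u.degree < Q.degree) (j : ℕ) :
    digit Q u (j + 1) = 0 := by
  have := digit_add_mul_succ hQ 0 hu j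
  simpa using this

lemma digit_zero_of_degree_lt (hQ : Q.Monic) {u : K[X]} (hu : u.degree < Q.degree) :
    digit Q u 0 = u := by
  rw [digit_zero, (modByMonic_eq_self_iff hQ).2 hu]

lemma digit_add (hQ : Q.Monic) (a b : K[X]) (j : ℕ) :
    digit Q (a + b) j = digit Q a j + digit Q b j := by
  rw [digit, digit, digit, add_divByMonic (hQ.pow j), add_modByMonic]

lemma digit_sum (hQ : Q.Monic) {ι : Type*} (s : Finset ι) (a : ι → K[X]) (j : ℕ) :
    digit Q (∑ i ∈ s, a i) j = ∑ i ∈ s, digit Q (a i) j := by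
  classical
  induction s using Finset.induction_on with
  | empty => simp
  | insert i s hi ih => rw [Finset.sum_insert hi, Finset.sum_insert hi, digit_add hQ, ih]

/-- The digits of `u Q ^ i` for `deg u < deg Q`. -/
lemma digit_mul_pow (hQ : Q.Monic) (hQ0 : 0 < Q.degree) {u : K[X]} (hu : u.degree < Q.degree)
    (i j : ℕ) : digit Q (u * Q ^ i) j = if j = i then u else 0 := by
  induction i generalizing j with
  | zero =>
    cases j with
    | zero => simp [digit_zero_of_degree_lt hQ hu]
    | succ j => simp [digit_of_degree_lt hQ hu]
  | succ i ih =>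
    rw [pow_succ, ← mul_assoc, mul_comm _ Q]
    cases j with
    | zero =>
      rw [digit_zero, self_mul_modByMonic hQ]; simp
    | succ j => rw [digit_mul_succ hQ hQ0, ih]; simp

lemma digit_sum_mul_pow (hQ : Q.Monic) (hQ0 : 0 < Q.degree) (s : Finset ℕ) (e : ℕ → K[X])
    (he : ∀ i ∈ s, (e i).degree < Q.degree) (j : ℕ) :
    digit Q (∑ i ∈ s, e i * Q ^ i) j = if j ∈ s then e j else 0 := by
  rw [digit_sum hQ, Finset.sum_congr rfl fun i hi => digit_mul_pow hQ hQ0 (he i hi) i j]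
  simp

lemma sum_digit_add (hQ : Q.Monic) (h : K[X]) (N : ℕ) :
    ∑ j ∈ Finset.range N, digit Q h j * Q ^ j + Q ^ N * (h /ₘ Q ^ N) = h := by
  induction N generalizing h with
  | zero => simp
  | succ N ih =>
    rw [Finset.sum_range_succ', divByMonic_pow_succ hQ]
    simp only [digit_succ hQ]
    conv_rhs => rw [← modByMonic_add_div h Q, ← ih (h /ₘ Q)]
    rw [digit_zero, mul_add, Finset.mul_sum]
    simp only [pow_succ]
    rw [Finset.sum_congr rfl fun i _ => show digit Q (h /ₘ Q) i * (Q ^ i * Q) =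
      Q * (digit Q (h /ₘ Q) i * Q ^ i) by ring]
    ring

lemma digit_eq_zero (hQ : Q.Monic) {h : K[X]} {j : ℕ} (hj : h.natDegree < j * Q.natDegree) :
    digit Q h j = 0 := by
  rw [digit, (divByMonic_eq_zero_iff (hQ.pow j)).2, zero_modByMonic]
  apply degree_lt_degree
  rwa [hQ.natDegree_pow]

lemma digit_eq_zero' (hQ : Q.Monic) (hQ0 : 0 < Q.natDegree) {h : K[X]} {j : ℕ}
    (hj : h.natDegree < j) : digit Q h j = 0 :=
  digit_eq_zero hQ (hj.trans_le (Nat.le_mul_of_pos_right _ hQ0))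

lemma sum_digit (hQ : Q.Monic) (hQ0 : 0 < Q.natDegree) {h : K[X]} {N : ℕ} (hN : h.natDegree < N) :
    ∑ j ∈ Finset.range N, digit Q h j * Q ^ j = h := by
  conv_rhs => rw [← sum_digit_add hQ h N]
  rw [(divByMonic_eq_zero_iff (hQ.pow N)).2, mul_zero, add_zero]
  apply degree_lt_degree
  rw [hQ.natDegree_pow]
  exact hN.trans_le (Nat.le_mul_of_pos_right _ hQ0)

/-- Induction on the length of the expansion. -/
lemma digit_induction (hQ : Q.Monic) (hQ0 : 0 < Q.natDegree) {P : K[X] → Prop} (h0 : P 0)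
    (hs : ∀ u v : K[X], u.degree < Q.degree → P v → P (u + Q * v)) (h : K[X]) : P h := by
  induction hn : h.natDegree using Nat.strong_induction_on generalizing h with
  | _ n ih =>
    rw [← modByMonic_add_div h Q]
    refine hs _ _ (degree_modByMonic_lt _ hQ) ?_
    by_cases hd : h.natDegree < Q.natDegree
    · rw [(divByMonic_eq_zero_iff hQ).2 (degree_lt_degree hd)]; exact h0
    · refine ih _ ?_ _ rfl
      rw [natDegree_divByMonic _ hQ]; omega

/-! ### Truncations -/

variable {w : K[X] → WithTop ℝ} {β : ℝ}

/-- The minimum in `truncVal` is over indices up to `natDegree h`. All further digits vanish and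
have value `∞`, so a lower bound may be tested on every `j`. -/
lemma le_truncVal_iff (hQ : Q.Monic) (hQ0 : 0 < Q.natDegree) (hw : w 0 = ⊤) {h : K[X]}
    {γ : WithTop ℝ} :
    γ ≤ truncVal w Q β h ↔ ∀ j : ℕ, γ ≤ w (digit Q h j) + ((j * β : ℝ) : WithTop ℝ) := by
  rw [truncVal, Finset.le_inf_iff]
  refine ⟨fun H j => ?_, fun H j _ => H j⟩
  by_cases hj : j ∈ Finset.range (h.natDegree + 1)
  · exact H j hj
  · rw [digit_eq_zero' hQ hQ0 (by simpa using hj), hw]; simp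

lemma truncVal_le (hQ : Q.Monic) (hQ0 : 0 < Q.natDegree) (hw : w 0 = ⊤) (h : K[X]) (j : ℕ) :
    truncVal w Q β h ≤ w (digit Q h j) + ((j * β : ℝ) : WithTop ℝ) :=
  (le_truncVal_iff hQ hQ0 hw).1 le_rfl j

lemma exists_truncVal_eq (w : K[X] → WithTop ℝ) (Q : K[X]) (β : ℝ) (h : K[X]) :
    ∃ j ≤ h.natDegree, truncVal w Q β h = w (digit Q h j) + ((j * β : ℝ) : WithTop ℝ) := by
  obtain ⟨j, hj, e⟩ := Finset.exists_mem_eq_inf (Finset.range (h.natDegree + 1)) ⟨0, by simp⟩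
    (fun j => w (digit Q h j) + ((j * β : ℝ) : WithTop ℝ))
  exact ⟨j, by simpa [Nat.lt_succ_iff] using hj, e⟩

/-- The Horner step for truncations; with `digit_induction` it replaces computations with whole
expansions. -/
lemma truncVal_add_mul (hQ : Q.Monic) (hQ0 : 0 < Q.natDegree) (hw : w 0 = ⊤) {u : K[X]} (v : K[X])
    (hu : u.degree < Q.degree) :
    truncVal w Q β (u + Q * v) = min (w u) (truncVal w Q β v + (β : WithTop ℝ)) := by
  refine eq_of_forall_le_iff fun γ => ?_
  rw [le_truncVal_iff hQ hQ0 hw, le_min_iff, withTop_le_add_iff, le_truncVal_iff hQ hQ0 hw]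
  constructor
  · intro H
    refine ⟨by simpa [digit_add_mul_zero hQ v hu] using H 0, fun j => ?_⟩
    have := H (j + 1)
    rw [digit_add_mul_succ hQ v hu] at this
    rw [← withTop_le_add_iff, add_assoc, ← WithTop.coe_add]
    convert this using 3
    push_cast; ring
  · rintro ⟨h1, h2⟩ j
    cases j with
    | zero => simpa [digit_add_mul_zero hQ v hu] using h1
    | succ j =>
      have := h2 j
      rw [digit_add_mul_succ hQ v hu]
      rw [← withTop_le_add_iff, add_assoc, ← WithTop.coe_add] at this
      convert this using 3
      push_cast; ring

lemma truncVal_zero (hw : w 0 = ⊤) : truncVal w Q β 0 = ⊤ := by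
  obtain ⟨j, -, e⟩ := exists_truncVal_eq w Q β 0
  rw [e]; simp [hw]

lemma truncVal_of_degree_lt (hQ : Q.Monic) (hQ0 : 0 < Q.natDegree) (hw : w 0 = ⊤) {u : K[X]}
    (hu : u.degree < Q.degree) : truncVal w Q β u = w u := by
  have := truncVal_add_mul (β := β) hQ hQ0 hw 0 hu
  rw [truncVal_zero hw] at this
  simpa using this

lemma truncVal_mul (hQ : Q.Monic) (hQ0 : 0 < Q.natDegree) (hw : w 0 = ⊤) (v : K[X]) :
    truncVal w Q β (Q * v) = truncVal w Q β v + (β : WithTop ℝ) := by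
  have := truncVal_add_mul (β := β) (u := 0) hQ hQ0 hw v
    (by simpa using bot_lt_iff_ne_bot.2 (degree_ne_bot.2 hQ.ne_zero))
  rw [hw] at this
  simpa using this

lemma truncVal_congr {w' : K[X] → WithTop ℝ} (hQ : Q.Monic)
    (hww : ∀ c, c.degree < Q.degree → w c = w' c) : truncVal w Q β = truncVal w' Q β := by
  funext h
  unfold truncVal
  exact Finset.inf_congr rfl fun j _ => by rw [hww _ (degree_digit_lt hQ h j)]

lemma truncVal_mono (hQ : Q.Monic) (hQ0 : 0 < Q.natDegree) (hw : w 0 = ⊤) {β' : ℝ} (hβ : β ≤ β')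
    (h : K[X]) : truncVal w Q β h ≤ truncVal w Q β' h := by
  rw [le_truncVal_iff hQ hQ0 hw]
  intro j
  refine (truncVal_le hQ hQ0 hw h j).trans (add_le_add_right (WithTop.coe_le_coe.2 ?_) _)
  gcongr

lemma mem_sideSet_iff {h : K[X]} {j : ℕ} : j ∈ sideSet w Q β h ↔ j ≤ h.natDegree ∧
    w (digit Q h j) + ((j * β : ℝ) : WithTop ℝ) = truncVal w Q β h := by
  rw [sideSet, Finset.mem_filter, Finset.mem_range, Nat.lt_succ_iff]

/-! ### Key polynomials -/

/-- `w` gives the values of the polynomials of degree less than `deg Q` and these, together with the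
value `β` of `Q`, determine a valuation. -/
structure IsKey (w : K[X] → WithTop ℝ) (Q : K[X]) (β : ℝ) : Prop where
  monic : Q.Monic
  natDegree_pos : 0 < Q.natDegree
  map_zero : w 0 = ⊤
  ne_top : ∀ c : K[X], c ≠ 0 → c.degree < Q.degree → w c ≠ ⊤
  map_add : ∀ c d : K[X], c.degree < Q.degree → d.degree < Q.degree → min (w c) (w d) ≤ w (c + d)
  -- This field and the next say that in the expansion `c * d = u + Q * v` the term `u` already has
  -- the expected value and `Q * v` has no smaller one. They express multiplicativity of `truncVal`
  -- on low degrees, from which `val_mul` follows in general.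
  mul_mod : ∀ c d : K[X], c.degree < Q.degree → d.degree < Q.degree →
    w (c * d %ₘ Q) = w c + w d
  mul_div : ∀ c d : K[X], c.degree < Q.degree → d.degree < Q.degree →
    w c + w d ≤ w (c * d /ₘ Q) + (β : WithTop ℝ)

/-- `IsKey` with a strict inequality: the initial form of `Q` is transcendental over those
of the polynomials of degree less than `deg Q`, which are closed under products. -/
structure StrictKey (w : K[X] → WithTop ℝ) (Q : K[X]) (β : ℝ) : Prop extends IsKey w Q β where
  mul_div_lt : ∀ c d : K[X], c ≠ 0 → d ≠ 0 → c.degree < Q.degree → d.degree < Q.degree →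
    w c + w d < w (c * d /ₘ Q) + (β : WithTop ℝ)

lemma degree_mul_div_lt (hQ : Q.Monic) {c d : K[X]}
    (hc : c.degree < Q.degree) (hd : d.degree < Q.degree) : (c * d /ₘ Q).degree < Q.degree := by
  by_cases h0 : c * d /ₘ Q = 0
  · rw [h0, degree_zero]; exact bot_lt_iff_ne_bot.2 (degree_ne_bot.2 hQ.ne_zero)
  apply degree_lt_degree
  rw [natDegree_divByMonic _ hQ]
  have hc0 : c ≠ 0 := by rintro rfl; simp at h0
  have hd0 : d ≠ 0 := by rintro rfl; simp at h0
  have h1 := natDegree_lt_natDegree hc0 hc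
  have h2 := natDegree_lt_natDegree hd0 hd
  rw [natDegree_mul hc0 hd0]
  omega

namespace IsKey

variable (hk : IsKey w Q β)
include hk

lemma degree_pos : 0 < Q.degree := natDegree_pos_iff_degree_pos.1 hk.natDegree_pos

lemma degree_zero_lt : (0 : K[X]).degree < Q.degree := by
  rw [degree_zero]; exact bot_lt_iff_ne_bot.2 (degree_ne_bot.2 hk.monic.ne_zero)

lemma degree_one_lt : (1 : K[X]).degree < Q.degree := by
  rw [degree_one]; exact hk.degree_pos

lemma map_one : w 1 = 0 := by
  have h := hk.mul_mod 1 1 hk.degree_one_lt hk.degree_one_lt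
  rw [mul_one, (modByMonic_eq_self_iff hk.monic).2 hk.degree_one_lt] at h
  have h2 := hk.ne_top 1 one_ne_zero hk.degree_one_lt
  lift w 1 to ℝ using h2 with r
  norm_cast at h ⊢
  linarith

lemma map_neg (c : K[X]) (hc : c.degree < Q.degree) : w (-c) = w c := by
  have hn : (-1 : K[X]).degree < Q.degree := by rw [degree_neg]; exact hk.degree_one_lt
  have h := hk.mul_mod (-1) (-1) hn hn
  rw [show (-1 : K[X]) * -1 = 1 by ring, (modByMonic_eq_self_iff hk.monic).2 hk.degree_one_lt,
    hk.map_one] at h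
  have h2 := hk.ne_top (-1) (by simp) hn
  have h1 : w (-1) = 0 := by
    lift w (-1) to ℝ using h2 with r
    norm_cast at h ⊢
    linarith
  have h := hk.mul_mod (-1) c hn hc
  rw [show (-1 : K[X]) * c = -c by ring,
    (modByMonic_eq_self_iff hk.monic).2 (by rwa [degree_neg]), h1, zero_add] at h
  exact h

lemma val_add (a b : K[X]) :
    min (truncVal w Q β a) (truncVal w Q β b) ≤ truncVal w Q β (a + b) := by
  rw [le_truncVal_iff hk.monic hk.natDegree_pos hk.map_zero]
  intro j
  rw [digit_add hk.monic]
  have h := hk.map_add _ _ (degree_digit_lt hk.monic a j) (degree_digit_lt hk.monic b j)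
  have h1 := truncVal_le (β := β) hk.monic hk.natDegree_pos hk.map_zero a j
  have h2 := truncVal_le (β := β) hk.monic hk.natDegree_pos hk.map_zero b j
  refine le_trans ?_ (add_le_add_left h _)
  rcases le_total (w (digit Q a j)) (w (digit Q b j)) with h' | h'
  · rw [min_eq_left h']; exact (min_le_left _ _).trans h1
  · rw [min_eq_right h']; exact (min_le_right _ _).trans h2

lemma val_neg (a : K[X]) : truncVal w Q β (-a) = truncVal w Q β a := by
  have hle : ∀ a, truncVal w Q β a ≤ truncVal w Q β (-a) := fun a => by
    rw [le_truncVal_iff hk.monic hk.natDegree_pos hk.map_zero]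
    intro j
    have h : digit Q (-a) j = - digit Q a j := by
      rw [eq_neg_iff_add_eq_zero, ← digit_add hk.monic]; simp
    rw [h, hk.map_neg _ (degree_digit_lt hk.monic a j)]
    exact truncVal_le hk.monic hk.natDegree_pos hk.map_zero a j
  refine le_antisymm ?_ (hle a)
  simpa using hle (-a)

lemma val_of_degree_lt {c : K[X]} (hc : c.degree < Q.degree) : truncVal w Q β c = w c :=
  truncVal_of_degree_lt hk.monic hk.natDegree_pos hk.map_zero hc

lemma val_add_mul {u : K[X]} (v : K[X]) (hu : u.degree < Q.degree) :
    truncVal w Q β (u + Q * v) = min (w u) (truncVal w Q β v + (β : WithTop ℝ)) :=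
  truncVal_add_mul hk.monic hk.natDegree_pos hk.map_zero v hu

lemma val_key_mul (v : K[X]) : truncVal w Q β (Q * v) = truncVal w Q β v + (β : WithTop ℝ) :=
  truncVal_mul hk.monic hk.natDegree_pos hk.map_zero v

lemma val_key_pow_mul (i : ℕ) (v : K[X]) :
    truncVal w Q β (Q ^ i * v) = truncVal w Q β v + ((i * β : ℝ) : WithTop ℝ) := by
  induction i with
  | zero => simp
  | succ i ih =>
    rw [pow_succ', mul_assoc, hk.val_key_mul, ih, add_assoc, ← WithTop.coe_add]
    congr 2; push_cast; ring

lemma val_le_mod (h : K[X]) : truncVal w Q β h ≤ w (h %ₘ Q) := by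
  conv_lhs => rw [← modByMonic_add_div h Q]
  rw [hk.val_add_mul _ (degree_modByMonic_lt _ hk.monic)]
  exact min_le_left _ _

lemma val_le_div (h : K[X]) : truncVal w Q β h ≤ truncVal w Q β (h /ₘ Q) + (β : WithTop ℝ) := by
  conv_lhs => rw [← modByMonic_add_div h Q]
  rw [hk.val_add_mul _ (degree_modByMonic_lt _ hk.monic)]
  exact min_le_right _ _

lemma val_mul_low {c d : K[X]} (hc : c.degree < Q.degree) (hd : d.degree < Q.degree) :
    truncVal w Q β (c * d) = w c + w d := by
  rw [← modByMonic_add_div (c * d) Q, hk.val_add_mul _ (degree_modByMonic_lt _ hk.monic),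
    hk.val_of_degree_lt (degree_mul_div_lt hk.monic hc hd), hk.mul_mod c d hc hd,
    min_eq_left (hk.mul_div c d hc hd)]

lemma le_val_low_mul {c : K[X]} (hc : c.degree < Q.degree) (b : K[X]) :
    w c + truncVal w Q β b ≤ truncVal w Q β (c * b) := by
  refine digit_induction hk.monic hk.natDegree_pos
    (P := fun b => w c + truncVal w Q β b ≤ truncVal w Q β (c * b)) ?_ ?_ b
  · rw [mul_zero, truncVal_zero hk.map_zero]; exact le_top
  · intro u v hu ih
    rw [mul_add, show c * (Q * v) = Q * (c * v) by ring, hk.val_add_mul v hu]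
    refine le_trans (le_min ?_ ?_) (hk.val_add _ _)
    · rw [hk.val_mul_low hc hu]; gcongr; exact min_le_left _ _
    · rw [hk.val_key_mul]
      calc _ ≤ w c + (truncVal w Q β v + (β : WithTop ℝ)) := by gcongr; exact min_le_right _ _
        _ ≤ _ := by rw [← add_assoc]; gcongr

lemma le_val_mul (a b : K[X]) :
    truncVal w Q β a + truncVal w Q β b ≤ truncVal w Q β (a * b) := by
  refine digit_induction hk.monic hk.natDegree_pos
    (P := fun a => truncVal w Q β a + truncVal w Q β b ≤ truncVal w Q β (a * b)) ?_ ?_ a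
  · rw [zero_mul, truncVal_zero hk.map_zero]; exact le_top
  · intro u v hu ih
    rw [add_mul, mul_assoc, hk.val_add_mul v hu]
    refine le_trans (le_min ?_ ?_) (hk.val_add _ _)
    · refine le_trans ?_ (hk.le_val_low_mul hu b); gcongr; exact min_le_left _ _
    · rw [hk.val_key_mul]
      calc _ ≤ (truncVal w Q β v + (β : WithTop ℝ)) + truncVal w Q β b := by
            gcongr; exact min_le_right _ _
        _ = (truncVal w Q β v + truncVal w Q β b) + (β : WithTop ℝ) := by ac_rfl
        _ ≤ _ := by gcongr

lemma val_ne_top (a : K[X]) (ha : a ≠ 0) : truncVal w Q β a ≠ ⊤ := by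
  intro h
  apply ha
  rw [← sum_digit hk.monic hk.natDegree_pos (Nat.lt_succ_self a.natDegree)]
  refine Finset.sum_eq_zero fun j _ => ?_
  have h1 := truncVal_le (β := β) hk.monic hk.natDegree_pos hk.map_zero a j
  rw [h, top_le_iff, WithTop.add_eq_top, or_iff_left WithTop.coe_ne_top] at h1
  by_contra hne
  exact hk.ne_top _ (left_ne_zero_of_mul hne) (degree_digit_lt hk.monic a j) h1

/-- `i` is the least index at which the minimum is attained: the terms below it make up `r`, and the
zeroth digit of `h₁` attains the value of `h₁`. The least index is the useful one, because the
zeroth digit is what reduction modulo `Q` retains. -/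
lemma exists_leading (h : K[X]) (h0 : h ≠ 0) : ∃ (i : ℕ) (r h₁ : K[X]), h = r + Q ^ i * h₁ ∧
    truncVal w Q β h₁ + ((i * β : ℝ) : WithTop ℝ) = truncVal w Q β h ∧
    w (h₁ %ₘ Q) = truncVal w Q β h₁ ∧ truncVal w Q β h < truncVal w Q β r := by
  revert h0
  refine digit_induction hk.monic hk.natDegree_pos (P := fun h => h ≠ 0 →
    ∃ (i : ℕ) (r h₁ : K[X]), h = r + Q ^ i * h₁ ∧
    truncVal w Q β h₁ + ((i * β : ℝ) : WithTop ℝ) = truncVal w Q β h ∧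
    w (h₁ %ₘ Q) = truncVal w Q β h₁ ∧ truncVal w Q β h < truncVal w Q β r) (by simp) ?_ h
  intro u v hu ih hne
  rcases le_or_gt (w u) (truncVal w Q β v + (β : WithTop ℝ)) with hle | hlt
  · refine ⟨0, 0, u + Q * v, by simp, by simp, ?_, ?_⟩
    · rw [add_mul_modByMonic hk.monic v hu, hk.val_add_mul v hu, min_eq_left hle]
    · rw [truncVal_zero hk.map_zero, lt_top_iff_ne_top]
      exact hk.val_ne_top _ hne
  · have hv : v ≠ 0 := by
      rintro rfl
      rw [truncVal_zero hk.map_zero] at hlt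
      simp at hlt
    obtain ⟨i, r, h₁, e, e1, e2, e3⟩ := ih hv
    refine ⟨i + 1, u + Q * r, h₁, ?_, ?_, e2, ?_⟩
    · rw [e]; ring
    · rw [hk.val_add_mul v hu, min_eq_right hlt.le, ← e1, add_assoc, ← WithTop.coe_add]
      congr 2; push_cast; ring
    · rw [hk.val_add_mul v hu, hk.val_add_mul r hu, min_eq_right hlt.le]
      exact lt_min hlt (WithTop.add_lt_add_right WithTop.coe_ne_top e3)

/-- Gauss's lemma. Modulo `Q` the product `a₁ * b₁` of the leading parts reduces to the product of
their zeroth digits, whose value is the sum by `mul_mod`; hence `a₁ * b₁` cannot have a larger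
value. What remains of `a * b` has a larger value and cannot interfere. -/
lemma val_mul (a b : K[X]) :
    truncVal w Q β (a * b) = truncVal w Q β a + truncVal w Q β b := by
  by_cases ha : a = 0
  · rw [ha, zero_mul, truncVal_zero hk.map_zero, top_add]
  by_cases hb : b = 0
  · rw [hb, mul_zero, truncVal_zero hk.map_zero, add_top]
  obtain ⟨i, r, a₁, ea, ea1, ea2, ea3⟩ := hk.exists_leading a ha
  obtain ⟨j, s, b₁, eb, eb1, eb2, eb3⟩ := hk.exists_leading b hb
  have hfa := hk.val_ne_top a ha
  have hfb := hk.val_ne_top b hb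
  have h1 : truncVal w Q β (a₁ * b₁) = truncVal w Q β a₁ + truncVal w Q β b₁ := by
    refine le_antisymm ?_ (hk.le_val_mul _ _)
    refine (hk.val_le_mod _).trans ?_
    rw [mul_modByMonic, hk.mul_mod _ _ (degree_modByMonic_lt _ hk.monic)
      (degree_modByMonic_lt _ hk.monic), ea2, eb2]
  set A := Q ^ (i + j) * (a₁ * b₁) with hA
  have h2 : truncVal w Q β A = truncVal w Q β a + truncVal w Q β b := by
    rw [hA, hk.val_key_pow_mul, h1, ← ea1, ← eb1]
    rw [show (((i + j : ℕ) : ℝ) * β) = i * β + j * β by push_cast; ring, WithTop.coe_add]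
    ac_rfl
  have h3 : truncVal w Q β a + truncVal w Q β b < truncVal w Q β (a * b - A) := by
    have e : a * b - A = r * b + (Q ^ i * a₁) * s := by
      have e1 : Q ^ i * a₁ = a - r := by rw [ea]; ring
      have e2 : Q ^ j * b₁ = b - s := by rw [eb]; ring
      rw [hA, show Q ^ (i + j) * (a₁ * b₁) = (Q ^ i * a₁) * (Q ^ j * b₁) by ring, e1, e2]; ring
    rw [e]
    refine lt_of_lt_of_le (lt_min ?_ ?_) (hk.val_add _ _)
    · exact (WithTop.add_lt_add_right hfb ea3).trans_le (hk.le_val_mul _ _)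
    · refine lt_of_lt_of_le ?_ (hk.le_val_mul _ _)
      rw [hk.val_key_pow_mul, ea1]
      exact WithTop.add_lt_add_left hfa eb3
  refine le_antisymm ?_ (hk.le_val_mul a b)
  by_contra hlt
  rw [not_le] at hlt
  have h4 := hk.val_add (a * b) (-(a * b - A))
  rw [hk.val_neg, show a * b + -(a * b - A) = A by ring, h2] at h4
  exact absurd h4 (not_le.2 (lt_min hlt h3))

lemma isVal : IsVal (truncVal w Q β) where
  map_zero := truncVal_zero hk.map_zero
  map_one := by rw [hk.val_of_degree_lt hk.degree_one_lt, hk.map_one]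
  map_add := hk.val_add
  map_mul := hk.val_mul
  ne_top := hk.val_ne_top

lemma val_key : truncVal w Q β Q = β := by
  have := hk.val_key_mul 1
  rwa [mul_one, hk.isVal.map_one, zero_add] at this

/-- Raising the value of `Q` makes `mul_div` strict. This is where a strict inequality in Condition
(*) takes effect. -/
lemma strictKey {β' : ℝ} (hβ : β < β') : StrictKey w Q β' where
  toIsKey := { hk with
    mul_div := fun c d hc hd => (hk.mul_div c d hc hd).trans
      (add_le_add_right (WithTop.coe_le_coe.2 hβ.le) _) }
  mul_div_lt := fun c d hc0 hd0 hc hd => by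
    refine lt_of_le_of_ne ((hk.mul_div c d hc hd).trans
      (add_le_add_right (WithTop.coe_le_coe.2 hβ.le) _)) fun h => ?_
    have h1 := hk.mul_div c d hc hd
    have h2 := hk.ne_top c hc0 hc
    have h3 := hk.ne_top d hd0 hd
    rw [h] at h1
    have h4 : w (c * d /ₘ Q) ≠ ⊤ := by
      intro h5; rw [h5, top_add, WithTop.add_eq_top] at h; tauto
    lift w (c * d /ₘ Q) to ℝ using h4 with x
    norm_cast at h1
    linarith

end IsKey

end KeyPoly
end
noncomputable section
namespace KeyPoly

variable {K : Type*} [Field K] {Q Q' : K[X]} {w : K[X] → WithTop ℝ} {β : ℝ} {α : ℕ}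

/-! ### Division by a polynomial `Q ^ α + z` with `z` of large value -/

namespace IsKey

variable (hk : IsKey w Q β)
include hk

lemma val_le_div_pow (i : ℕ) (h : K[X]) :
    truncVal w Q β h ≤ truncVal w Q β (h /ₘ Q ^ i) + ((i * β : ℝ) : WithTop ℝ) := by
  induction i generalizing h with
  | zero => simp
  | succ i ih =>
    rw [divByMonic_pow_succ hk.monic]
    refine (hk.val_le_div h).trans ((add_le_add_left (ih _) _).trans ?_)
    rw [add_assoc, ← WithTop.coe_add]
    refine add_le_add_right (WithTop.coe_le_coe.2 (le_of_eq ?_)) _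
    push_cast; ring

/-- One division by `Q ^ α`, `h = r + Q ^ α * v`, is rewritten as `h = (r - v * (Q' - Q ^ α)) + Q' *
v`. The bracket has value at least that of `h` and smaller degree, so the estimate follows by
induction on the degree. -/
lemma val_le_div_shift (hQ' : Q'.Monic) (hdeg : (Q' - Q ^ α).degree < (Q ^ α).degree)
    (hz : ((α * β : ℝ) : WithTop ℝ) ≤ truncVal w Q β (Q' - Q ^ α)) (h : K[X]) :
    truncVal w Q β h ≤ truncVal w Q β (h /ₘ Q') + ((α * β : ℝ) : WithTop ℝ) := by
  have hQQ : Q'.degree = (Q ^ α).degree := by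
    have := degree_add_eq_right_of_degree_lt hdeg
    rwa [sub_add_cancel] at this
  induction hn : h.natDegree using Nat.strong_induction_on generalizing h with
  | _ n ih =>
    by_cases hlt : h.degree < Q'.degree
    · rw [(divByMonic_eq_zero_iff hQ').2 hlt, truncVal_zero hk.map_zero, top_add]
      exact le_top
    set v := h /ₘ Q ^ α with hv
    set r := h %ₘ Q ^ α with hr
    have hrv : r + Q ^ α * v = h := modByMonic_add_div h (Q ^ α)
    have h1 : truncVal w Q β h ≤ truncVal w Q β v + ((α * β : ℝ) : WithTop ℝ) :=
      hk.val_le_div_pow α h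
    have h2 : truncVal w Q β h ≤ truncVal w Q β r := by
      have : r = h - Q ^ α * v := by rw [← hrv]; ring
      rw [this]
      refine hk.isVal.le_sub le_rfl ?_
      rwa [hk.val_key_pow_mul]
    set h' := r - v * (Q' - Q ^ α) with hh'
    have e : h = h' + Q' * v := by rw [hh', ← hrv]; ring
    have h3 : truncVal w Q β h ≤ truncVal w Q β h' := by
      refine hk.isVal.le_sub h2 (h1.trans ?_)
      rw [hk.val_mul]; gcongr
    have h4 : truncVal w Q β h' ≤ truncVal w Q β (h' /ₘ Q') + ((α * β : ℝ) : WithTop ℝ) := by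
      by_cases h0 : h' = 0
      · rw [h0, zero_divByMonic, truncVal_zero hk.map_zero, top_add]
      refine ih _ ?_ h' rfl
      rw [← hn]
      refine natDegree_lt_natDegree h0 ((degree_sub_le _ _).trans_lt (max_lt ?_ ?_))
      · refine (degree_modByMonic_lt _ (hk.monic.pow α)).trans_le ?_
        rw [← hQQ]; exact not_lt.1 hlt
      · have h5 : (Q ^ α).degree ≤ h.degree := by rw [← hQQ]; exact not_lt.1 hlt
        rw [← degree_add_divByMonic (hk.monic.pow α) h5, degree_mul, add_comm]
        refine WithBot.add_lt_add_right ?_ hdeg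
        rw [degree_ne_bot, Ne, divByMonic_eq_zero_iff (hk.monic.pow α)]
        exact not_lt.2 h5
    conv_rhs => rw [e, add_divByMonic hQ', mul_divByMonic_cancel_left _ hQ']
    refine le_trans ?_ (add_le_add_left (hk.val_add _ _) _)
    rw [min_add]
    exact le_min (h3.trans h4) h1

lemma le_val_shift (hz : ((α * β : ℝ) : WithTop ℝ) ≤ truncVal w Q β (Q' - Q ^ α)) :
    ((α * β : ℝ) : WithTop ℝ) ≤ truncVal w Q β Q' := by
  rw [show Q' = Q ^ α * 1 + (Q' - Q ^ α) by ring]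
  refine hk.isVal.le_add ?_ hz
  rw [hk.val_key_pow_mul, hk.isVal.map_one, zero_add]

lemma val_le_mod_shift (hQ' : Q'.Monic) (hdeg : (Q' - Q ^ α).degree < (Q ^ α).degree)
    (hz : ((α * β : ℝ) : WithTop ℝ) ≤ truncVal w Q β (Q' - Q ^ α)) (h : K[X]) :
    truncVal w Q β h ≤ truncVal w Q β (h %ₘ Q') := by
  rw [modByMonic_eq_sub_mul_div]
  refine hk.isVal.le_sub le_rfl ((hk.val_le_div_shift hQ' hdeg hz h).trans ?_)
  rw [hk.val_mul, add_comm]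
  gcongr
  exact hk.le_val_shift hz

/-- Quotient and remainder of a division by `Q'` have the values required, so both expansions
compute one valuation. This allows the polygons of two successive vertices to be compared. -/
lemma truncVal_shift (hQ' : Q'.Monic) (hQ'0 : 0 < Q'.natDegree)
    (hdeg : (Q' - Q ^ α).degree < (Q ^ α).degree)
    (hz : ((α * β : ℝ) : WithTop ℝ) ≤ truncVal w Q β (Q' - Q ^ α)) :
    truncVal (truncVal w Q β) Q' (α * β) = truncVal w Q β := by
  have h0 := truncVal_zero (Q := Q) (β := β) hk.map_zero
  funext h
  refine digit_induction hQ' hQ'0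
    (P := fun h => truncVal (truncVal w Q β) Q' (α * β) h = truncVal w Q β h) ?_ ?_ h
  · rw [truncVal_zero h0, h0]
  · intro u v hu ih
    rw [truncVal_add_mul hQ' hQ'0 h0 v hu, ih]
    refine le_antisymm ?_ (le_min ?_ ?_)
    · refine le_trans (min_le_min_left _ ?_) (hk.val_add _ _)
      rw [hk.val_mul, add_comm]
      gcongr
      exact hk.le_val_shift hz
    · have := hk.val_le_mod_shift hQ' hdeg hz (u + Q' * v)
      rwa [add_mul_modByMonic hQ' v hu] at this
    · have := hk.val_le_div_shift hQ' hdeg hz (u + Q' * v)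
      rwa [add_mul_divByMonic hQ' v hu] at this

end IsKey

/-- With `v = c * d /ₘ Q`, the quotient by `Q'` differs from `v` by the quotient of `-(v * (Q' -
Q))`. Since `Q' - Q` has value at least `β`, dividing its product with `v` by `Q'` gives a value no
less than that of `v`, so the strict inequality persists. -/
lemma StrictKey.isKey_of_shift_aux (hk : StrictKey w Q β) (hQ' : Q'.Monic)
    (hdeg : (Q' - Q).degree < Q.degree) (hz : (β : WithTop ℝ) ≤ w (Q' - Q)) :
    StrictKey w Q' β ∧ truncVal w Q' β = truncVal w Q β := by
  have hQQ : Q'.degree = Q.degree := by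
    have := degree_add_eq_right_of_degree_lt hdeg
    rwa [sub_add_cancel] at this
  have hQ'0 : 0 < Q'.natDegree := by
    rw [natDegree_eq_of_degree_eq hQQ]; exact hk.natDegree_pos
  have hdeg1 : (Q' - Q ^ 1).degree < (Q ^ 1).degree := by simpa using hdeg
  have hz1 : (((1 : ℕ) * β : ℝ) : WithTop ℝ) ≤ truncVal w Q β (Q' - Q ^ 1) := by
    rw [pow_one, hk.val_of_degree_lt hdeg]; simpa using hz
  have hcon : ∀ c, c.degree < Q'.degree → truncVal w Q β c = w c := fun c hc =>
    hk.val_of_degree_lt (hQQ ▸ hc)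
  have hmain : ∀ c d : K[X], c ≠ 0 → d ≠ 0 → c.degree < Q'.degree → d.degree < Q'.degree →
      w c + w d < w (c * d /ₘ Q') + (β : WithTop ℝ) := by
    intro c d hc0 hd0 hc hd
    have hcd := degree_mul_div_lt hQ' hc hd
    set v := c * d /ₘ Q with hv
    have hvd : v.degree < Q.degree := degree_mul_div_lt hk.monic (hQQ ▸ hc) (hQQ ▸ hd)
    have hlt := hk.mul_div_lt c d hc0 hd0 (hQQ ▸ hc) (hQQ ▸ hd)
    rw [← hv] at hlt
    set u := c * d %ₘ Q with hu
    have e : c * d = (u - v * (Q' - Q)) + Q' * v := by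
      rw [← modByMonic_add_div (c * d) Q, ← hu, ← hv]; ring
    have e2 : c * d /ₘ Q' = (- (v * (Q' - Q))) /ₘ Q' + v := by
      rw [e, add_divByMonic hQ', mul_divByMonic_cancel_left _ hQ', sub_eq_add_neg,
        add_divByMonic hQ', (divByMonic_eq_zero_iff hQ').2
          (hQQ ▸ degree_modByMonic_lt _ hk.monic), zero_add]
    rw [← hcon _ hcd, e2]
    refine lt_of_lt_of_le ?_ (add_le_add_left (hk.val_add _ _) _)
    rw [min_add]
    refine lt_min (hlt.trans_le ?_) ?_
    · have := hk.val_le_div_shift hQ' hdeg1 hz1 (- (v * (Q' - Q)))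
      rw [hk.val_neg, hk.val_mul, hk.val_of_degree_lt hvd, hk.val_of_degree_lt hdeg] at this
      refine le_trans ?_ (this.trans ?_)
      · gcongr
      · simp
    · rwa [hk.val_of_degree_lt hvd]
  refine ⟨{ monic := hQ', natDegree_pos := hQ'0, map_zero := hk.map_zero,
            ne_top := fun c h0 hc => hk.ne_top c h0 (hQQ ▸ hc),
            map_add := fun c d hc hd => hk.map_add c d (hQQ ▸ hc) (hQQ ▸ hd),
            mul_mod := ?_, mul_div := ?_, mul_div_lt := hmain }, ?_⟩
  · intro c d hc hd
    by_cases hc0 : c = 0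
    · simp [hc0, hk.map_zero]
    by_cases hd0 : d = 0
    · simp [hd0, hk.map_zero]
    rw [← hcon _ (degree_modByMonic_lt _ hQ'), modByMonic_eq_sub_mul_div, sub_eq_add_neg,
      hk.isVal.map_add_eq, hk.val_mul_low (hQQ ▸ hc) (hQQ ▸ hd)]
    rw [hk.val_neg, hk.val_mul_low (hQQ ▸ hc) (hQQ ▸ hd), hk.val_mul,
      hcon _ (degree_mul_div_lt hQ' hc hd), add_comm (truncVal w Q β Q')]
    refine (hmain c d hc0 hd0 hc hd).trans_le ?_
    gcongr
    have := hk.le_val_shift hz1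
    simpa using this
  · intro c d hc hd
    by_cases hc0 : c = 0
    · simp [hc0, hk.map_zero]
    by_cases hd0 : d = 0
    · simp [hd0, hk.map_zero]
    exact (hmain c d hc0 hd0 hc hd).le
  · have := hk.truncVal_shift hQ' hQ'0 hdeg1 hz1
    rw [← this, truncVal_congr hQ' hcon]
    simp

lemma StrictKey.shift (hk : StrictKey w Q β) (hQ' : Q'.Monic)
    (hdeg : (Q' - Q).degree < Q.degree) (hz : (β : WithTop ℝ) ≤ w (Q' - Q)) : StrictKey w Q' β :=
  (hk.isKey_of_shift_aux hQ' hdeg hz).1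

lemma StrictKey.truncVal_shift_eq (hk : StrictKey w Q β) (hQ' : Q'.Monic)
    (hdeg : (Q' - Q).degree < Q.degree) (hz : (β : WithTop ℝ) ≤ w (Q' - Q)) :
    truncVal w Q' β = truncVal w Q β :=
  (hk.isKey_of_shift_aux hQ' hdeg hz).2

end KeyPoly
end
noncomputable section
namespace KeyPoly

/-! ### The graded algebra of a valuation -/

section Graded

variable {R : Type*} [CommRing R] {μ : R → WithTop ℝ}

lemma single_mem_rees {γ : ℝ} {a : R} (h : (γ : WithTop ℝ) ≤ μ a) :
    AddMonoidAlgebra.single γ a ∈ rees μ :=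
  Subring.subset_closure ⟨γ, a, h, rfl⟩

open Classical in
/-- The class of `a` in degree `γ`, for `γ ≤ μ a`. -/
def hom (μ : R → WithTop ℝ) (γ : ℝ) (a : R) : Gr μ :=
  if h : (γ : WithTop ℝ) ≤ μ a then
    Ideal.Quotient.mk (reesIdeal μ) ⟨AddMonoidAlgebra.single γ a, single_mem_rees h⟩
  else 0

lemma hom_def {γ : ℝ} {a : R} (h : (γ : WithTop ℝ) ≤ μ a) : hom μ γ a =
    Ideal.Quotient.mk (reesIdeal μ) ⟨AddMonoidAlgebra.single γ a, single_mem_rees h⟩ :=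
  dif_pos h

lemma inForm_eq_hom {γ : ℝ} {a : R} (h : μ a = γ) : inForm μ a = hom μ γ a := by
  have h' : μ a ≠ ⊤ := by rw [h]; exact WithTop.coe_ne_top
  have h2 : (μ a).untop h' = γ := by
    apply WithTop.coe_injective; rw [WithTop.coe_untop, h]
  rw [hom_def h.ge, inForm, dif_neg h']
  simp only [h2]

lemma inForm_of_top {a : R} (h : μ a = ⊤) : inForm μ a = 0 := dif_pos h

variable (hμ : IsVal μ)
include hμ

lemma le_coeff_mul {x y : AddMonoidAlgebra R ℝ} (hx : ∀ γ : ℝ, (γ : WithTop ℝ) ≤ μ (x.coeff γ))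
    (hy : ∀ γ : ℝ, (γ : WithTop ℝ) ≤ μ (y.coeff γ)) (γ : ℝ) :
    (γ : WithTop ℝ) ≤ μ ((x * y).coeff γ) := by
  classical
  rw [AddMonoidAlgebra.coeff_mul]
  refine hμ.le_sum fun i _ => hμ.le_sum fun j _ => ?_
  dsimp only
  split_ifs with h
  · rw [hμ.map_mul, ← h, WithTop.coe_add]; exact add_le_add (hx i) (hy j)
  · rw [hμ.map_zero]; exact le_top

lemma lt_coeff_mul {x y : AddMonoidAlgebra R ℝ} (hx : ∀ γ : ℝ, (γ : WithTop ℝ) ≤ μ (x.coeff γ))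
    (hy : ∀ γ : ℝ, (γ : WithTop ℝ) < μ (y.coeff γ)) (γ : ℝ) :
    (γ : WithTop ℝ) < μ ((x * y).coeff γ) := by
  classical
  rw [AddMonoidAlgebra.coeff_mul]
  refine hμ.lt_sum fun i _ => hμ.lt_sum fun j _ => ?_
  dsimp only
  split_ifs with h
  · rw [hμ.map_mul, ← h, WithTop.coe_add]
    exact (WithTop.add_lt_add_left WithTop.coe_ne_top (hy j)).trans_le
      (by gcongr; exact hx i)
  · rw [hμ.map_zero]; exact WithTop.coe_lt_top _

lemma le_coeff_of_mem_rees {x : AddMonoidAlgebra R ℝ} (hx : x ∈ rees μ) :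
    ∀ γ : ℝ, (γ : WithTop ℝ) ≤ μ (x.coeff γ) := by
  classical
  induction hx using Subring.closure_induction with
  | mem x hx =>
    obtain ⟨β, a, h, rfl⟩ := hx
    intro γ
    rw [AddMonoidAlgebra.coeff_single, Finsupp.single_apply]
    split_ifs with e
    · rwa [← e]
    · rw [hμ.map_zero]; exact le_top
  | zero => intro γ; simp [hμ.map_zero]
  | one =>
    intro γ
    rw [AddMonoidAlgebra.one_def, AddMonoidAlgebra.coeff_single, Finsupp.single_apply]
    split_ifs with e
    · rw [hμ.map_one, ← e]; simp
    · rw [hμ.map_zero]; exact le_top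
  | add x y _ _ hx hy =>
    intro γ
    rw [AddMonoidAlgebra.coeff_add, Finsupp.add_apply]
    exact hμ.le_add (hx γ) (hy γ)
  | neg x _ hx =>
    intro γ
    rw [AddMonoidAlgebra.coeff_neg, Finsupp.neg_apply, hμ.map_neg]
    exact hx γ
  | mul x y _ _ hx hy => exact le_coeff_mul hμ hx hy

/-- Membership can be tested degree by degree, so computations in `Gr μ` become inequalities for the
coefficients of representatives. -/
lemma mem_reesIdeal_iff {x : rees μ} :
    x ∈ reesIdeal μ ↔ ∀ γ : ℝ, (γ : WithTop ℝ) < μ (x.1.coeff γ) := by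
  classical
  constructor
  · intro hx
    induction hx using Submodule.span_induction with
    | mem x hx =>
      obtain ⟨β, a, h, e⟩ := hx
      intro γ
      rw [e, AddMonoidAlgebra.coeff_single, Finsupp.single_apply]
      split_ifs with e
      · rwa [← e]
      · rw [hμ.map_zero]; exact WithTop.coe_lt_top _
    | zero => intro γ; simp [hμ.map_zero]
    | add x y _ _ hx hy =>
      intro γ
      rw [Subring.coe_add, AddMonoidAlgebra.coeff_add, Finsupp.add_apply]
      exact hμ.lt_add (hx γ) (hy γ)
    | smul a x _ hx =>
      rw [smul_eq_mul, Subring.coe_mul]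
      exact lt_coeff_mul hμ (le_coeff_of_mem_rees hμ a.2) hx
  · intro hx
    have e : x = ∑ γ ∈ x.1.coeff.support,
        (⟨AddMonoidAlgebra.single γ (x.1.coeff γ), single_mem_rees (hx γ).le⟩ : rees μ) := by
      apply Subtype.ext
      rw [AddSubmonoidClass.coe_finsetSum]
      exact (AddMonoidAlgebra.sum_coeff_single x.1).symm
    rw [e]
    exact Ideal.sum_mem _ fun γ _ => Ideal.subset_span ⟨γ, x.1.coeff γ, hx γ, rfl⟩

lemma hom_eq_zero_iff {γ : ℝ} {a : R} (h : (γ : WithTop ℝ) ≤ μ a) :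
    hom μ γ a = 0 ↔ (γ : WithTop ℝ) < μ a := by
  classical
  rw [hom_def h, Ideal.Quotient.eq_zero_iff_mem, mem_reesIdeal_iff hμ]
  constructor
  · intro H
    simpa using H γ
  · intro H σ
    rw [AddMonoidAlgebra.coeff_single, Finsupp.single_apply]
    split_ifs with e
    · rwa [← e]
    · rw [hμ.map_zero]; exact WithTop.coe_lt_top _

lemma hom_zero (γ : ℝ) : hom μ γ 0 = 0 := by
  rw [hom_eq_zero_iff hμ] <;> rw [hμ.map_zero]
  · exact WithTop.coe_lt_top _
  · exact le_top

lemma hom_add {γ : ℝ} {a b : R} (ha : (γ : WithTop ℝ) ≤ μ a) (hb : (γ : WithTop ℝ) ≤ μ b) :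
    hom μ γ (a + b) = hom μ γ a + hom μ γ b := by
  rw [hom_def ha, hom_def hb, hom_def (hμ.le_add ha hb), ← map_add]
  congr 1
  apply Subtype.ext
  simp [AddMonoidAlgebra.single_add]

lemma hom_neg {γ : ℝ} {a : R} (ha : (γ : WithTop ℝ) ≤ μ a) : hom μ γ (-a) = - hom μ γ a := by
  rw [eq_neg_iff_add_eq_zero, ← hom_add hμ (by rwa [hμ.map_neg]) ha, neg_add_cancel, hom_zero hμ]

lemma hom_sub {γ : ℝ} {a b : R} (ha : (γ : WithTop ℝ) ≤ μ a) (hb : (γ : WithTop ℝ) ≤ μ b) :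
    hom μ γ (a - b) = hom μ γ a - hom μ γ b := by
  rw [sub_eq_add_neg, sub_eq_add_neg, hom_add hμ ha (by rwa [hμ.map_neg]), hom_neg hμ hb]

lemma hom_sum {ι : Type*} (s : Finset ι) {γ : ℝ} {a : ι → R}
    (ha : ∀ i ∈ s, (γ : WithTop ℝ) ≤ μ (a i)) :
    hom μ γ (∑ i ∈ s, a i) = ∑ i ∈ s, hom μ γ (a i) := by
  classical
  induction s using Finset.induction_on with
  | empty => simp [hom_zero hμ]
  | insert i s hi ih =>
    rw [Finset.sum_insert hi, Finset.sum_insert hi, hom_add hμ (ha i (by simp))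
      (hμ.le_sum fun j hj => ha j (by simp [hj])), ih fun j hj => ha j (by simp [hj])]

lemma hom_mul {γ δ : ℝ} {a b : R} (ha : (γ : WithTop ℝ) ≤ μ a) (hb : (δ : WithTop ℝ) ≤ μ b) :
    hom μ γ a * hom μ δ b = hom μ (γ + δ) (a * b) := by
  rw [hom_def ha, hom_def hb, hom_def (by rw [hμ.map_mul, WithTop.coe_add]; exact add_le_add ha hb),
    ← map_mul]
  congr 1
  apply Subtype.ext
  simp

lemma hom_one : hom μ 0 1 = 1 := by
  rw [hom_def (by rw [hμ.map_one]; simp), ← map_one (Ideal.Quotient.mk (reesIdeal μ))]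
  rfl

lemma hom_pow {γ : ℝ} {a : R} (ha : (γ : WithTop ℝ) ≤ μ a) (n : ℕ) :
    hom μ γ a ^ n = hom μ (n * γ) (a ^ n) ∧ ((n * γ : ℝ) : WithTop ℝ) ≤ μ (a ^ n) := by
  induction n with
  | zero => simp [hom_one hμ, hμ.map_one]
  | succ n ih =>
    have e : ((n + 1 : ℕ) : ℝ) * γ = n * γ + γ := by push_cast; ring
    rw [pow_succ, ih.1, hom_mul hμ ih.2 ha, pow_succ, e]
    refine ⟨rfl, ?_⟩
    rw [hμ.map_mul, WithTop.coe_add]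
    exact add_le_add ih.2 ha

lemma hom_eq_hom_iff {γ : ℝ} {a b : R} (ha : (γ : WithTop ℝ) ≤ μ a) (hb : (γ : WithTop ℝ) ≤ μ b) :
    hom μ γ a = hom μ γ b ↔ (γ : WithTop ℝ) < μ (a - b) := by
  rw [← sub_eq_zero, ← hom_sub hμ ha hb, hom_eq_zero_iff hμ (hμ.le_sub ha hb)]

lemma inForm_eq_zero_iff {a : R} : inForm μ a = 0 ↔ a = 0 := by
  constructor
  · intro h
    by_contra h0
    obtain ⟨r, hr⟩ := hμ.exists_real h0
    rw [inForm_eq_hom hr, hom_eq_zero_iff hμ hr.ge, hr] at h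
    exact lt_irrefl _ h
  · rintro rfl
    exact inForm_of_top hμ.map_zero

lemma inForm_one : inForm μ 1 = 1 := by
  rw [inForm_eq_hom (γ := 0) (by simp [hμ.map_one]), hom_one hμ]

lemma inForm_mul (a b : R) : inForm μ (a * b) = inForm μ a * inForm μ b := by
  by_cases ha : a = 0
  · rw [ha, zero_mul, inForm_of_top hμ.map_zero, zero_mul]
  by_cases hb : b = 0
  · rw [hb, mul_zero, inForm_of_top hμ.map_zero, mul_zero]
  obtain ⟨r, hr⟩ := hμ.exists_real ha
  obtain ⟨s, hs⟩ := hμ.exists_real hb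
  rw [inForm_eq_hom hr, inForm_eq_hom hs, hom_mul hμ hr.ge hs.ge,
    inForm_eq_hom (γ := r + s) (by rw [hμ.map_mul, hr, hs, WithTop.coe_add])]

lemma inForm_pow (a : R) (n : ℕ) : inForm μ (a ^ n) = inForm μ a ^ n := by
  induction n with
  | zero => simp [inForm_one hμ]
  | succ n ih => rw [pow_succ, pow_succ, inForm_mul hμ, ih]

/-- Two elements whose difference has a larger value have the same initial form. -/
lemma inForm_eq_of_lt {a b : R} (h : μ a < μ (b - a)) : inForm μ b = inForm μ a := by
  have ha : a ≠ 0 := by rintro rfl; rw [hμ.map_zero] at h; exact not_top_lt h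
  obtain ⟨r, hr⟩ := hμ.exists_real ha
  have hb := hμ.eq_of_lt_sub h
  rw [inForm_eq_hom hr, inForm_eq_hom (hb.trans hr), hom_eq_hom_iff hμ (hb.trans hr).ge hr.ge, ← hr]
  exact h

/-- The components of different degrees are independent. -/
lemma lt_of_sum_hom_eq_zero (s : Finset ℝ) (a : ℝ → R)
    (ha : ∀ σ ∈ s, (σ : WithTop ℝ) ≤ μ (a σ)) (h : ∑ σ ∈ s, hom μ σ (a σ) = 0) :
    ∀ σ ∈ s, (σ : WithTop ℝ) < μ (a σ) := by
  classical
  intro σ hσ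
  have e : ∑ σ ∈ s, hom μ σ (a σ) = Ideal.Quotient.mk (reesIdeal μ)
      (∑ σ ∈ s.attach, ⟨AddMonoidAlgebra.single σ.1 (a σ.1), single_mem_rees (ha σ.1 σ.2)⟩) := by
    rw [map_sum, ← Finset.sum_attach]
    exact Finset.sum_congr rfl fun τ _ => hom_def (ha τ.1 τ.2)
  rw [e, Ideal.Quotient.eq_zero_iff_mem, mem_reesIdeal_iff hμ] at h
  have h1 := h σ
  rw [AddSubmonoidClass.coe_finsetSum] at h1
  rw [Finset.sum_attach s (fun τ => AddMonoidAlgebra.single τ (a τ)),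
    AddMonoidAlgebra.coeff_sum, Finsupp.finsetSum_apply] at h1
  simpa [Finsupp.single_apply, hσ] using h1

/-- If the values of the elements of degree `γ` and `δ` agree and are not zero then `γ = δ`. -/
lemma degree_eq_of_hom_eq {γ δ : ℝ} {a b : R} (ha : (γ : WithTop ℝ) ≤ μ a)
    (hb : (δ : WithTop ℝ) ≤ μ b) (h : hom μ γ a = hom μ δ b) (h0 : hom μ γ a ≠ 0) : γ = δ := by
  classical
  by_contra hne
  have h1 := lt_of_sum_hom_eq_zero hμ {γ, δ} (fun σ => if σ = γ then a else -b) (by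
    intro σ hσ
    rw [Finset.mem_insert, Finset.mem_singleton] at hσ
    rcases hσ with rfl | rfl
    · simpa using ha
    · rw [if_neg (Ne.symm hne), hμ.map_neg]; exact hb) (by
    rw [Finset.sum_pair hne]
    simp only [if_true, if_neg (Ne.symm hne)]
    rw [hom_neg hμ hb, h, add_neg_cancel]) γ (by simp)
  rw [if_pos rfl, ← hom_eq_zero_iff hμ ha] at h1
  exact h0 h1

/-- The degrees in which the value equals the degree are those of the nonzero components of the
class; a representative may have further terms that vanish in the quotient. -/
lemma exists_exact_support (x : rees μ) (hx : Ideal.Quotient.mk (reesIdeal μ) x ≠ 0) :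
    ∃ E : Finset ℝ, E.Nonempty ∧ ∀ γ, γ ∈ E ↔ μ (x.1.coeff γ) = γ := by
  classical
  refine ⟨x.1.coeff.support.filter fun γ => μ (x.1.coeff γ) = γ, ?_, ?_⟩
  · by_contra hE
    apply hx
    rw [Ideal.Quotient.eq_zero_iff_mem, mem_reesIdeal_iff hμ]
    intro γ
    refine lt_of_le_of_ne (le_coeff_of_mem_rees hμ x.2 γ) fun e => hE ⟨γ, ?_⟩
    rw [Finset.mem_filter, Finsupp.mem_support_iff]
    refine ⟨fun e0 => ?_, e.symm⟩
    rw [e0, hμ.map_zero] at e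
    exact WithTop.coe_ne_top e
  · intro γ
    rw [Finset.mem_filter, Finsupp.mem_support_iff]
    refine ⟨fun H => H.2, fun H => ⟨fun e0 => ?_, H⟩⟩
    rw [e0, hμ.map_zero] at H
    exact WithTop.coe_ne_top H.symm

/-- By `h3` the pair of degrees is the only pair of nonzero components with its sum, so one product
survives uncancelled. This is applied to the two greatest and to the two least degrees. -/
lemma val_coeff_mul {r s : rees μ} {γ₁ γ₂ : ℝ} (h1 : μ (r.1.coeff γ₁) = γ₁)
    (h2 : μ (s.1.coeff γ₂) = γ₂) (h3 : ∀ i j : ℝ, i + j = γ₁ + γ₂ → (i = γ₁ ∧ j = γ₂) ∨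
      μ (r.1.coeff i) ≠ i ∨ μ (s.1.coeff j) ≠ j) :
    μ ((r.1 * s.1).coeff (γ₁ + γ₂)) = ((γ₁ + γ₂ : ℝ) : WithTop ℝ) := by
  classical
  have hr := le_coeff_of_mem_rees hμ r.2
  have hs := le_coeff_of_mem_rees hμ s.2
  have e : ((r.1 * s.1).coeff (γ₁ + γ₂)) = r.1.coeff γ₁ * s.1.coeff γ₂ +
      (∑ p ∈ (r.1.coeff.support ×ˢ s.1.coeff.support).erase (γ₁, γ₂),
        if p.1 + p.2 = γ₁ + γ₂ then r.1.coeff p.1 * s.1.coeff p.2 else 0) := by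
    rw [AddMonoidAlgebra.coeff_mul]
    simp only [Finsupp.sum]
    rw [← Finset.sum_product', ← Finset.add_sum_erase _ _ (a := (γ₁, γ₂))]
    · simp
    · rw [Finset.mem_product, Finsupp.mem_support_iff, Finsupp.mem_support_iff]
      constructor
      · intro e0; simp only at e0; rw [e0, hμ.map_zero] at h1; exact WithTop.coe_ne_top h1.symm
      · intro e0; simp only at e0; rw [e0, hμ.map_zero] at h2; exact WithTop.coe_ne_top h2.symm
  have hv : μ (r.1.coeff γ₁ * s.1.coeff γ₂) = ((γ₁ + γ₂ : ℝ) : WithTop ℝ) := by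
    rw [hμ.map_mul, h1, h2, WithTop.coe_add]
  rw [e, hμ.map_add_eq, hv]
  rw [hv]
  refine hμ.lt_sum fun p hp => ?_
  split_ifs with hp2
  · rw [hμ.map_mul, ← hp2, WithTop.coe_add]
    rcases h3 p.1 p.2 hp2 with h4 | h4 | h4
    · exact absurd (Prod.ext h4.1 h4.2) (Finset.ne_of_mem_erase hp)
    · exact (WithTop.add_lt_add_right WithTop.coe_ne_top (lt_of_le_of_ne (hr _) h4.symm)).trans_le
        (by gcongr; exact hs _)
    · exact (WithTop.add_lt_add_left WithTop.coe_ne_top (lt_of_le_of_ne (hs _) h4.symm)).trans_le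
        (by gcongr; exact hr _)
  · rw [hμ.map_zero]; exact WithTop.coe_lt_top _

lemma val_coeff_mul_max {r s : rees μ} {E F : Finset ℝ} (hE : E.Nonempty) (hF : F.Nonempty)
    (hEm : ∀ γ, γ ∈ E ↔ μ (r.1.coeff γ) = γ) (hFm : ∀ γ, γ ∈ F ↔ μ (s.1.coeff γ) = γ) :
    μ ((r.1 * s.1).coeff (E.max' hE + F.max' hF)) =
      ((E.max' hE + F.max' hF : ℝ) : WithTop ℝ) :=
  val_coeff_mul hμ ((hEm _).1 (E.max'_mem hE)) ((hFm _).1 (F.max'_mem hF)) fun i j hij => by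
    by_contra! hcon
    have h1 := E.le_max' i ((hEm i).2 hcon.2.1)
    have h2 := F.le_max' j ((hFm j).2 hcon.2.2)
    exact hcon.1 (by linarith) (by linarith)

/-- The product of the components of greatest degree cannot cancel. -/
lemma isDomain_gr : IsDomain (Gr μ) := by
  have hnt : Nontrivial (Gr μ) := ⟨0, 1, fun h => by
    have := (inForm_eq_zero_iff hμ (a := 1)).1 (by rw [inForm_one hμ, h])
    have h1 := hμ.map_one
    rw [this, hμ.map_zero] at h1
    simp at h1⟩
  have : NoZeroDivisors (Gr μ) := ⟨fun {y z} h => by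
    obtain ⟨r, rfl⟩ := Ideal.Quotient.mk_surjective y
    obtain ⟨s, rfl⟩ := Ideal.Quotient.mk_surjective z
    by_contra! hne
    obtain ⟨E, hE, hEm⟩ := exists_exact_support hμ r hne.1
    obtain ⟨F, hF, hFm⟩ := exists_exact_support hμ s hne.2
    rw [← map_mul, Ideal.Quotient.eq_zero_iff_mem, mem_reesIdeal_iff hμ] at h
    have h1 := h (E.max' hE + F.max' hF)
    rw [Subring.coe_mul, val_coeff_mul_max hμ hE hF hEm hFm] at h1
    exact lt_irrefl _ h1⟩
  exact NoZeroDivisors.to_isDomain _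

/-- The factors of a nonzero homogeneous element are homogeneous. -/
lemma exists_hom_of_mul_eq {y z : Gr μ} {σ : ℝ} {a : R} (ha : (σ : WithTop ℝ) ≤ μ a)
    (h : y * z = hom μ σ a) (h0 : hom μ σ a ≠ 0) :
    ∃ (γ : ℝ) (b : R), (γ : WithTop ℝ) ≤ μ b ∧ y = hom μ γ b := by
  classical
  obtain ⟨r, rfl⟩ := Ideal.Quotient.mk_surjective y
  obtain ⟨s, rfl⟩ := Ideal.Quotient.mk_surjective z
  have hr0 : Ideal.Quotient.mk (reesIdeal μ) r ≠ 0 := fun e => h0 (by rw [← h, e, zero_mul])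
  have hs0 : Ideal.Quotient.mk (reesIdeal μ) s ≠ 0 := fun e => h0 (by rw [← h, e, mul_zero])
  obtain ⟨E, hE, hEm⟩ := exists_exact_support hμ r hr0
  obtain ⟨F, hF, hFm⟩ := exists_exact_support hμ s hs0
  have hr := le_coeff_of_mem_rees hμ r.2
  have hprod : ∀ γ, μ ((r.1 * s.1).coeff γ) = γ → γ = σ := by
    intro γ hγ
    by_contra hne
    have h1 : Ideal.Quotient.mk (reesIdeal μ)
        (r * s - ⟨AddMonoidAlgebra.single σ a, single_mem_rees ha⟩) = 0 := by
      rw [map_sub, map_mul, h, hom_def ha, sub_self]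
    rw [Ideal.Quotient.eq_zero_iff_mem, mem_reesIdeal_iff hμ] at h1
    have h2 := h1 γ
    rw [AddSubgroupClass.coe_sub, Subring.coe_mul, AddMonoidAlgebra.coeff_sub, Finsupp.sub_apply] at h2
    rw [AddMonoidAlgebra.coeff_single, Finsupp.single_apply, if_neg (Ne.symm hne), sub_zero, hγ]
      at h2
    exact lt_irrefl _ h2
  -- Both the sum of the greatest and the sum of the least degrees must be `σ`. Hence greatest and
  -- least degree coincide in each factor.
  have hmax := hprod _ (val_coeff_mul_max hμ hE hF hEm hFm)
  have hmin := hprod _ (val_coeff_mul hμ ((hEm _).1 (E.min'_mem hE)) ((hFm _).1 (F.min'_mem hF))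
    (fun i j hij => by
      by_contra! hcon
      have h1 := E.min'_le i ((hEm i).2 hcon.2.1)
      have h2 := F.min'_le j ((hFm j).2 hcon.2.2)
      exact hcon.1 (by linarith) (by linarith)))
  have hEle := E.min'_le _ (E.max'_mem hE)
  have hFle := F.min'_le _ (F.max'_mem hF)
  refine ⟨E.min' hE, r.1.coeff (E.min' hE), hr _, ?_⟩
  rw [hom_def (hr _), ← sub_eq_zero, ← map_sub, Ideal.Quotient.eq_zero_iff_mem,
    mem_reesIdeal_iff hμ]
  intro γ
  rw [AddSubgroupClass.coe_sub, AddMonoidAlgebra.coeff_sub, Finsupp.sub_apply,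
    AddMonoidAlgebra.coeff_single, Finsupp.single_apply]
  split_ifs with hγ
  · rw [hγ, sub_self, hμ.map_zero]; exact WithTop.coe_lt_top _
  · rw [sub_zero]
    refine lt_of_le_of_ne (hr γ) fun e => hγ ?_
    have h1 := E.le_max' γ ((hEm γ).2 e.symm)
    have h2 := E.min'_le γ ((hEm γ).2 e.symm)
    linarith

end Graded

end KeyPoly
end
noncomputable section
namespace KeyPoly

/-! ### Homogeneous polynomials over a graded field -/

section GradedField

variable {A : Type*} [CommRing A]

/-- The homogeneous elements of a ring graded by `ℝ` in which all the nonzero ones are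
invertible. -/
structure GradedField (H : ℝ → Set A) : Prop where
  zero_mem : ∀ γ, 0 ∈ H γ
  add_mem : ∀ γ, ∀ a ∈ H γ, ∀ b ∈ H γ, a + b ∈ H γ
  neg_mem : ∀ γ, ∀ a ∈ H γ, -a ∈ H γ
  mul_mem : ∀ γ δ, ∀ a ∈ H γ, ∀ b ∈ H δ, a * b ∈ H (γ + δ)
  one_mem : 1 ∈ H 0
  degree_one : ∀ γ, 1 ∈ H γ → γ = 0
  exists_inv : ∀ γ, ∀ a ∈ H γ, a ≠ 0 → ∃ b ∈ H (-γ), a * b = 1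

/-- `P` is homogeneous of degree `σ` if the variable has degree `β`. -/
def IsHP (H : ℝ → Set A) (β σ : ℝ) (P : A[X]) : Prop := ∀ k : ℕ, P.coeff k ∈ H (σ - k * β)

variable {H : ℝ → Set A} (hH : GradedField H) {β σ τ : ℝ} {P P' g m : A[X]}
include hH

namespace IsHP

lemma add (h : IsHP H β σ P) (h' : IsHP H β σ P') : IsHP H β σ (P + P') := fun k => by
  rw [coeff_add]; exact hH.add_mem _ _ (h k) _ (h' k)

lemma neg (h : IsHP H β σ P) : IsHP H β σ (-P) := fun k => by
  rw [coeff_neg]; exact hH.neg_mem _ _ (h k)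

lemma sub (h : IsHP H β σ P) (h' : IsHP H β σ P') : IsHP H β σ (P - P') := by
  rw [sub_eq_add_neg]; exact h.add hH (h'.neg hH)

lemma mul (h : IsHP H β σ P) (h' : IsHP H β τ P') : IsHP H β (σ + τ) (P * P') := fun k => by
  classical
  rw [coeff_mul]
  refine Finset.sum_induction _ (· ∈ H (σ + τ - k * β)) (fun a b ha hb => hH.add_mem _ a ha b hb)
    (hH.zero_mem _) fun p hp => ?_
  rw [Finset.HasAntidiagonal.mem_antidiagonal] at hp
  have := hH.mul_mem _ _ _ (h p.1) _ (h' p.2)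
  rwa [show σ - p.1 * β + (τ - p.2 * β) = σ + τ - k * β by rw [← hp]; push_cast; ring] at this

lemma C {a : A} {γ : ℝ} (ha : a ∈ H γ) : IsHP H β γ (Polynomial.C a) := fun k => by
  rw [coeff_C]
  split_ifs with h
  · rw [h]; simpa using ha
  · exact hH.zero_mem _

lemma X_pow (n : ℕ) : IsHP H β (n * β) ((X : A[X]) ^ n) := fun k => by
  rw [coeff_X_pow]
  split_ifs with h
  · rw [h]; simpa using hH.one_mem
  · exact hH.zero_mem _

lemma degree_of_monic (h : IsHP H β τ m) (hm : m.Monic) : τ = m.natDegree * β := by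
  have h1 := h m.natDegree
  rw [hm.coeff_natDegree] at h1
  have := hH.degree_one _ h1
  linarith

lemma modByMonic [Nontrivial A] (hP : IsHP H β σ P) (hm : m.Monic) (hmh : IsHP H β τ m) :
    IsHP H β σ (P %ₘ m) := by
  have hτ := hmh.degree_of_monic hH hm
  induction hn : P.natDegree using Nat.strong_induction_on generalizing P with
  | _ n ih =>
    by_cases hlt : P.degree < m.degree
    · rwa [(modByMonic_eq_self_iff hm).2 hlt]
    have hP0 : P ≠ 0 := by
      rintro rfl
      rw [degree_zero] at hlt
      exact hlt (bot_lt_iff_ne_bot.2 (degree_ne_bot.2 hm.ne_zero))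
    have hwf := div_wf_lemma ⟨not_lt.1 hlt, hP0⟩ hm
    set S := m * (Polynomial.C P.leadingCoeff * X ^ (P.natDegree - m.natDegree)) with hS
    have hle := natDegree_le_natDegree (not_lt.1 hlt)
    have hSh : IsHP H β σ S := by
      have h1 := hmh.mul hH ((C hH (β := β) (hP P.natDegree)).mul hH
        (X_pow hH (P.natDegree - m.natDegree)))
      have e : σ = τ + (σ - P.natDegree * β + ((P.natDegree - m.natDegree : ℕ) : ℝ) * β) := by
        rw [hτ, Nat.cast_sub hle]; ring
      rw [e]
      exact h1
    have e : P %ₘ m = (P - S) %ₘ m := by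
      refine modByMonic_eq_of_dvd_sub hm ?_
      rw [sub_sub_cancel]
      exact dvd_mul_right _ _
    rw [e]
    by_cases h0 : P - S = 0
    · rw [h0, zero_modByMonic]
      intro k; rw [coeff_zero]; exact hH.zero_mem _
    · exact ih _ (hn ▸ natDegree_lt_natDegree h0 hwf) (hP.sub hH hSh) rfl

lemma exists_inv_leadingCoeff (h : IsHP H β σ P) (h0 : P ≠ 0) :
    ∃ b : A, P.leadingCoeff * b = 1 ∧ (Polynomial.C b * P).Monic ∧
      ∃ τ, IsHP H β τ (Polynomial.C b * P) := by
  obtain ⟨b, hb, e⟩ := hH.exists_inv _ _ (h P.natDegree) (leadingCoeff_ne_zero.2 h0)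
  exact ⟨b, e, monic_C_mul_of_mul_leadingCoeff_eq_one (by rw [mul_comm]; exact e), _,
    (C hH hb).mul hH h⟩

/-- Euclid's algorithm with `g` kept fixed. The remainder of `g` modulo the normalized `P` is
nonzero because `g` is irreducible, and an inverse of it modulo `g` yields one of `P`. Only nonzero
homogeneous coefficients are known to be invertible, so every remainder has to be homogeneous again
in order to be normalized. -/
lemma exists_dvd_sub_one_aux [Nontrivial A] (hg : g.Monic) (hgi : Irreducible g)
    (hgh : IsHP H β τ g) (hP : IsHP H β σ P) (hP0 : P ≠ 0) (hlt : P.degree < g.degree) :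
    ∃ v : A[X], g ∣ v * P - 1 := by
  induction hn : P.natDegree using Nat.strong_induction_on generalizing P σ with
  | _ n ih =>
    obtain ⟨b, hb, hm, τ', hmh⟩ := hP.exists_inv_leadingCoeff hH hP0
    have hmdeg : (Polynomial.C b * P).natDegree = P.natDegree :=
      natDegree_C_mul_of_isUnit (IsUnit.of_mul_eq_one _ (by rw [mul_comm]; exact hb)) P
    set m := Polynomial.C b * P with hmdef
    by_cases h0 : m.natDegree = 0
    · refine ⟨Polynomial.C b, ?_⟩
      rw [← hmdef, hm.natDegree_eq_zero.1 h0, sub_self]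
      exact dvd_zero _
    set r := g %ₘ m with hr
    have hgr : r + m * (g /ₘ m) = g := modByMonic_add_div g m
    have hr0 : r ≠ 0 := by
      intro hr0
      rw [hr0, zero_add] at hgr
      rcases hgi.isUnit_or_isUnit hgr.symm with hu | hu
      · rw [hm.isUnit_iff] at hu
        rw [hu] at h0; simp at h0
      · have hs : (g /ₘ m).Monic := hm.of_mul_monic_left (by rwa [hgr])
        rw [hs.isUnit_iff] at hu
        rw [hu, mul_one] at hgr
        have := natDegree_lt_natDegree hP0 hlt
        rw [← hgr, hmdeg] at this
        exact lt_irrefl _ this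
    have hrm : r.degree < m.degree := degree_modByMonic_lt _ hm
    have hrd : r.natDegree < n := by
      rw [← hn, ← hmdeg]; exact natDegree_lt_natDegree hr0 hrm
    obtain ⟨v, hv⟩ := ih _ hrd (hgh.modByMonic hH hm hmh) hr0 (by
      refine hrm.trans_le ((degree_le_natDegree).trans ?_)
      rw [hmdeg]
      exact (degree_eq_natDegree hP0 ▸ hlt).le) rfl
    refine ⟨-(v * (g /ₘ m)) * Polynomial.C b, ?_⟩
    have e : -(v * (g /ₘ m)) * Polynomial.C b * P - 1 = (v * r - 1) - v * g := by
      rw [mul_assoc, ← hmdef]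
      have : v * g = v * r + v * (m * (g /ₘ m)) := by rw [← mul_add, hgr]
      rw [this]
      ring
    rw [e]
    exact dvd_sub hv (dvd_mul_left _ _)

/-- A monic irreducible homogeneous polynomial is prime to the homogeneous polynomials that it
does not divide. -/
lemma exists_dvd_sub_one [Nontrivial A] (hg : g.Monic) (hgi : Irreducible g)
    (hgh : IsHP H β τ g) (hP : IsHP H β σ P) (hnd : ¬ g ∣ P) : ∃ v : A[X], g ∣ v * P - 1 := by
  obtain ⟨v, hv⟩ := IsHP.exists_dvd_sub_one_aux hH hg hgi hgh (hP.modByMonic hH hg hgh)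
    (fun h => hnd ((modByMonic_eq_zero_iff_dvd hg).1 h)) (degree_modByMonic_lt _ hg)
  refine ⟨v, ?_⟩
  have e : v * P - 1 = (v * (P %ₘ g) - 1) + g * (v * (P /ₘ g)) := by
    conv_lhs => rw [← modByMonic_add_div P g]
    ring
  rw [e]
  exact dvd_add hv (dvd_mul_right _ _)

lemma dvd_or_dvd [Nontrivial A] (hg : g.Monic) (hgi : Irreducible g) (hgh : IsHP H β τ g)
    (hP : IsHP H β σ P) (hdvd : g ∣ P * P') : g ∣ P ∨ g ∣ P' := by
  by_cases hnd : g ∣ P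
  · exact Or.inl hnd
  obtain ⟨v, hv⟩ := IsHP.exists_dvd_sub_one hH hg hgi hgh hP hnd
  right
  have e : P' = v * (P * P') - (v * P - 1) * P' := by ring
  rw [e]
  exact dvd_sub (hdvd.mul_left _) (hv.mul_right _)

end IsHP

/-- Factorization of homogeneous polynomials into monic irreducible ones. -/
lemma exists_factorization [IsDomain A]
    (hfac : ∀ σ, ∀ P a b : A[X], IsHP H β σ P → P ≠ 0 → P = a * b → ∃ τ, IsHP H β τ a)
    (hP : IsHP H β σ P) (hP0 : P ≠ 0) :
    ∃ (c : A) (s : Multiset A[X]), IsUnit c ∧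
      (∀ g ∈ s, g.Monic ∧ Irreducible g ∧ ∃ τ, IsHP H β τ g) ∧ P = C c * s.prod := by
  classical
  induction hn : P.natDegree using Nat.strong_induction_on generalizing P σ with
  | _ n ih =>
    by_cases h0 : P.natDegree = 0
    · obtain ⟨b, hb, -, -⟩ := hP.exists_inv_leadingCoeff hH hP0
      refine ⟨P.leadingCoeff, 0, IsUnit.of_mul_eq_one _ hb, by simp, ?_⟩
      rw [Multiset.prod_zero, mul_one]
      conv_lhs => rw [eq_C_of_natDegree_eq_zero h0]
      rw [leadingCoeff, h0]
    -- A monic homogeneous divisor of least positive degree is irreducible: by `hfac` its own monic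
    -- divisors are homogeneous and would compete with it.
    have hex : ∃ d, ∃ m : A[X], m.Monic ∧ (∃ τ, IsHP H β τ m) ∧ m ∣ P ∧ m.natDegree = d ∧ 0 < d := by
      obtain ⟨b, hb, hm, τ, hmh⟩ := hP.exists_inv_leadingCoeff hH hP0
      have hbu : IsUnit b := IsUnit.of_mul_eq_one _ (by rw [mul_comm]; exact hb)
      refine ⟨_, C b * P, hm, ⟨τ, hmh⟩, ?_, rfl, ?_⟩
      · exact (IsUnit.mul_left_dvd (isUnit_C.2 hbu)).2 dvd_rfl
      · rw [natDegree_C_mul_of_isUnit hbu]; omega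
    obtain ⟨m, hm, ⟨τ, hmh⟩, hmP, hmd, hpos⟩ := Nat.find_spec hex
    have hmi : Irreducible m := by
      rw [hm.irreducible_iff_lt_natDegree_lt (by rintro rfl; simp at hmd; omega)]
      intro q hq hqd hqm
      rw [Finset.mem_Ioc] at hqd
      obtain ⟨q', hq'⟩ := hqm
      refine Nat.find_min hex (m := q.natDegree) (by omega) ⟨q, hq, ?_, ?_, rfl, hqd.1⟩
      · exact hfac τ m q q' hmh hm.ne_zero hq'
      · exact (Dvd.intro _ hq'.symm).trans hmP
    obtain ⟨P', hP'⟩ := hmP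
    have hP'0 : P' ≠ 0 := by rintro rfl; simp at hP'; exact hP0 hP'
    obtain ⟨τ', hP'h⟩ := hfac σ P P' m hP hP0 (by rw [hP', mul_comm])
    obtain ⟨c, s, hc, hs, e⟩ := ih P'.natDegree (by
      rw [← hn, hP', hm.natDegree_mul' hP'0]; omega) hP'h hP'0 rfl
    refine ⟨c, m ::ₘ s, hc, ?_, ?_⟩
    · intro g hg
      rw [Multiset.mem_cons] at hg
      rcases hg with rfl | hg
      · exact ⟨hm, hmi, τ, hmh⟩
      · exact hs g hg
    · rw [hP', e, Multiset.prod_cons]; ring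

omit hH in
lemma eq_of_dvd_of_monic_of_irreducible {g g' : A[X]} (hg : g.Monic) (hg' : g'.Monic)
    (hgi : Irreducible g) (hgi' : Irreducible g') (h : g ∣ g') : g = g' := by
  obtain ⟨u, hu⟩ := h
  rcases hgi'.isUnit_or_isUnit hu with h1 | h1
  · exact absurd h1 hgi.not_isUnit
  · have hum : u.Monic := hg.of_mul_monic_left (hu ▸ hg')
    rw [hum.isUnit_iff] at h1
    rw [hu, h1, mul_one]

lemma IsHP.mem_of_dvd_prod [Nontrivial A] (hg : g.Monic) (hgi : Irreducible g) (hgh : IsHP H β τ g)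
    {s : Multiset A[X]} (hs : ∀ g ∈ s, g.Monic ∧ Irreducible g ∧ ∃ τ, IsHP H β τ g)
    (h : g ∣ s.prod) : g ∈ s := by
  induction s using Multiset.induction_on with
  | empty =>
    rw [Multiset.prod_zero] at h
    exact absurd (isUnit_of_dvd_one h) hgi.not_isUnit
  | cons a s ih =>
    rw [Multiset.prod_cons] at h
    obtain ⟨ha, hai, τ', hah⟩ := hs a (Multiset.mem_cons_self _ _)
    rcases IsHP.dvd_or_dvd hH hg hgi hgh hah h with h | h
    · rw [eq_of_dvd_of_monic_of_irreducible hg ha hgi hai h]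
      exact Multiset.mem_cons_self _ _
    · exact Multiset.mem_cons_of_mem (ih (fun g hg => hs g (Multiset.mem_cons_of_mem hg)) h)

open Classical in
/-- The exact power of `g` that divides a product of irreducible homogeneous polynomials. -/
lemma count_eq_of_isHP [IsDomain A] (hg : g.Monic) (hgi : Irreducible g) (hgh : IsHP H β τ g)
    {s : Multiset A[X]} (hs : ∀ g ∈ s, g.Monic ∧ Irreducible g ∧ ∃ τ, IsHP H β τ g) {c : A}
    (hc : IsUnit c) {e : ℕ} {F : A[X]} (hF : C c * s.prod = g ^ e * F) (hgF : ¬ g ∣ F) :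
    s.count g = e := by
  have hnd : ¬ g ∣ C c * (s.filter (g ≠ ·)).prod := by
    rw [IsUnit.dvd_mul_left (isUnit_C.2 hc)]
    intro h
    have := IsHP.mem_of_dvd_prod hH hg hgi hgh
      (fun g hg => hs g (Multiset.mem_of_mem_filter hg)) h
    exact (Multiset.mem_filter.1 this).2 rfl
  have e1 : C c * s.prod = g ^ (s.count g) * (C c * (s.filter (g ≠ ·)).prod) := by
    conv_lhs => rw [← Multiset.filter_add_not (g = ·) s]
    rw [Multiset.filter_eq, Multiset.prod_add, Multiset.prod_replicate]
    ring
  rw [e1] at hF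
  rcases lt_trichotomy (s.count g) e with h | h | h
  · exfalso
    obtain ⟨k, rfl⟩ := Nat.exists_eq_add_of_lt h
    rw [add_assoc, pow_add, mul_assoc] at hF
    have := mul_left_cancel₀ (pow_ne_zero _ hg.ne_zero) hF
    exact hnd ⟨g ^ k * F, by rw [this]; ring⟩
  · exact h
  · exfalso
    obtain ⟨k, hk⟩ := Nat.exists_eq_add_of_lt h
    rw [hk, add_assoc, pow_add, mul_assoc] at hF
    have := mul_left_cancel₀ (pow_ne_zero _ hg.ne_zero) hF
    exact hgF ⟨g ^ k * (C c * (s.filter (g ≠ ·)).prod), by rw [← this]; ring⟩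

omit hH in
open Classical in
lemma sum_count_mul_natDegree [Nontrivial A] {s : Multiset A[X]} (hs : ∀ g ∈ s, g.Monic) {c : A}
    (hc : IsUnit c) :
    ∑ g ∈ s.toFinset, g.natDegree * s.count g = (C c * s.prod).natDegree := by
  rw [natDegree_C_mul_of_isUnit hc, natDegree_multiset_prod_of_monic _ hs,
    Finset.sum_multiset_map_count]
  exact Finset.sum_congr rfl fun g _ => by rw [smul_eq_mul, mul_comm]

omit hH in
lemma exists_eq_X_pow_mul {A : Type*} [CommRing A] {P : A[X]} {e : ℕ}
    (h : ∀ d < e, P.coeff d = 0) (h' : P.coeff e ≠ 0) : ∃ P₁, P = X ^ e * P₁ ∧ ¬ X ∣ P₁ := by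
  obtain ⟨P₁, hP₁⟩ := X_pow_dvd_iff.2 h
  refine ⟨P₁, hP₁, fun hX => h' ?_⟩
  have h1 := coeff_X_pow_mul P₁ e 0
  rw [zero_add, ← hP₁, X_dvd_iff.1 hX] at h1
  exact h1

/-- The monic irreducible factors, other than the variable, of a homogeneous polynomial, and their
multiplicities. -/
lemma exists_irreducible_factors [IsDomain A]
    (hfac : ∀ σ, ∀ P a b : A[X], IsHP H β σ P → P ≠ 0 → P = a * b → ∃ τ, IsHP H β τ a)
    (hP : IsHP H β σ P) (hP0 : P ≠ 0) :
    ∃ (T : Finset A[X]) (m : A[X] → ℕ),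
      (∀ g, g ∈ T ↔ g.Monic ∧ Irreducible g ∧ g ≠ X ∧ g ∣ P) ∧
      (∀ g ∈ T, ∃ τ, IsHP H β τ g) ∧
      (∀ g ∈ T, ∀ e F, P = g ^ e * F → ¬ g ∣ F → m g = e) ∧
      ∀ e, (∀ d < e, P.coeff d = 0) → P.coeff e ≠ 0 →
        ∑ g ∈ T, g.natDegree * m g + e = P.natDegree := by
  classical
  obtain ⟨c, s, hc, hs, hPs⟩ := exists_factorization hH hfac hP hP0
  have hX : IsHP H β (((1 : ℕ) : ℝ) * β) (X : A[X]) := by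
    have := IsHP.X_pow hH (β := β) 1
    rwa [pow_one] at this
  refine ⟨s.toFinset.erase X, fun g => s.count g, ?_, ?_, ?_, ?_⟩
  · intro g
    rw [Finset.mem_erase, Multiset.mem_toFinset]
    constructor
    · rintro ⟨h1, h2⟩
      obtain ⟨h3, h4, -⟩ := hs g h2
      refine ⟨h3, h4, h1, ?_⟩
      rw [hPs]
      exact (Multiset.dvd_prod h2).mul_left _
    · rintro ⟨h1, h2, h3, b, hb⟩
      refine ⟨h3, ?_⟩
      obtain ⟨τ, hτ⟩ := hfac _ _ _ _ hP hP0 hb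
      refine IsHP.mem_of_dvd_prod hH h1 h2 hτ hs ?_
      have : g ∣ C c * s.prod := ⟨b, hPs.symm.trans hb⟩
      rwa [IsUnit.dvd_mul_left (isUnit_C.2 hc)] at this
  · intro g hg
    rw [Finset.mem_erase, Multiset.mem_toFinset] at hg
    exact (hs g hg.2).2.2
  · intro g hg e F hF hnd
    rw [Finset.mem_erase, Multiset.mem_toFinset] at hg
    obtain ⟨h1, h2, τ, h3⟩ := hs g hg.2
    exact count_eq_of_isHP hH h1 h2 h3 hs hc (hPs.symm.trans hF) hnd
  · intro e he he'
    obtain ⟨P₁, hP₁, hnd⟩ := exists_eq_X_pow_mul he he'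
    -- The variable takes up exactly the `e` vanishing lowest coefficients, so the other factors
    -- account for the degree minus `e`.
    have hcX : s.count X = e :=
      count_eq_of_isHP hH monic_X irreducible_X hX hs hc (hPs.symm.trans hP₁) hnd
    have h1 := sum_count_mul_natDegree (fun g hg => (hs g hg).1) hc (s := s)
    rw [hPs, ← h1, ← hcX]
    by_cases hXs : X ∈ s.toFinset
    · rw [← Finset.sum_erase_add _ _ hXs, natDegree_X, one_mul]
    · rw [Finset.erase_eq_of_notMem hXs, Multiset.count_eq_zero.2 (by simpa using hXs), add_zero]

end GradedField

end KeyPoly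
end
noncomputable section
namespace KeyPoly

/-! ### The graded algebra of a key polynomial -/

variable {K : Type*} [Field K] {Q : K[X]} {w : K[X] → WithTop ℝ} {β : ℝ}

/-- In a proper factorization both factors would have finite values, whereas their product leaves
the remainder 0, of value `∞`, against `mul_mod`. -/
lemma IsKey.irreducible (hk : IsKey w Q β) : Irreducible Q := by
  rw [hk.monic.irreducible_iff_lt_natDegree_lt
    (by rintro rfl; have := hk.natDegree_pos; simp at this)]
  rintro q hq hqd ⟨r, hr⟩
  rw [Finset.mem_Ioc] at hqd
  have hr' : r.Monic := hq.of_mul_monic_left (hr ▸ hk.monic)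
  have hd := congrArg natDegree hr
  rw [hq.natDegree_mul hr'] at hd
  have h1 : q.degree < Q.degree := degree_lt_degree (by omega)
  have h2 : r.degree < Q.degree := degree_lt_degree (by omega)
  have h := hk.mul_mod q r h1 h2
  rw [← hr, modByMonic_self hk.monic, hk.map_zero, eq_comm, WithTop.add_eq_top] at h
  exact h.elim (hk.ne_top q hq.ne_zero h1) (hk.ne_top r hr'.ne_zero h2)

lemma IsKey.exists_inv (hk : IsKey w Q β) {c : K[X]} (hc0 : c ≠ 0) (hc : c.degree < Q.degree) :
    ∃ d : K[X], d.degree < Q.degree ∧ c * d %ₘ Q = 1 := by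
  rcases EuclideanDomain.dvd_or_coprime Q c hk.irreducible with h | ⟨a, b, h⟩
  · exact absurd (degree_le_of_dvd h hc0) (not_le.2 hc)
  · refine ⟨b %ₘ Q, degree_modByMonic_lt _ hk.monic, ?_⟩
    rw [mul_modByMonic, (modByMonic_eq_self_iff hk.monic).2 (degree_modByMonic_lt b hk.monic),
      ← mul_modByMonic, ← (modByMonic_eq_self_iff hk.monic).2 hk.degree_one_lt, ← h]
    refine modByMonic_eq_of_dvd_sub hk.monic ⟨-a, by ring⟩

/-- `A` is the subring of the initial forms of the polynomials of degree less than `deg Q`. -/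
structure IsLowRing (w : K[X] → WithTop ℝ) (Q : K[X]) (β : ℝ)
    (A : Subring (Gr (truncVal w Q β))) : Prop where
  inForm_mem : ∀ c : K[X], c.degree < Q.degree → inForm (truncVal w Q β) c ∈ A
  mem_closure : ∀ y ∈ A,
    y ∈ AddSubgroup.closure {y | ∃ c : K[X], c.degree < Q.degree ∧ y = inForm (truncVal w Q β) c}

/-- The homogeneous elements of `A`. -/
def lowHom (w : K[X] → WithTop ℝ) (Q : K[X]) (β : ℝ) (A : Subring (Gr (truncVal w Q β))) (γ : ℝ) :
    Set A :=
  {a | ∃ c : K[X], c.degree < Q.degree ∧ (γ : WithTop ℝ) ≤ w c ∧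
    (a : Gr (truncVal w Q β)) = hom (truncVal w Q β) γ c}

/-- The polynomial `P` over `A` represents the class of `h` in degree `σ`. -/
def Rep (A : Subring (Gr (truncVal w Q β))) (σ : ℝ) (P : A[X]) (h : K[X]) : Prop :=
  (σ : WithTop ℝ) ≤ truncVal w Q β h ∧
    ∀ k : ℕ, (P.coeff k : Gr (truncVal w Q β)) = hom (truncVal w Q β) (σ - k * β) (digit Q h k)

/-- Evaluation at the initial form of `Q`. -/
def evKey (A : Subring (Gr (truncVal w Q β))) : A[X] →+* Gr (truncVal w Q β) :=
  eval₂RingHom A.subtype (inForm (truncVal w Q β) Q)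

lemma IsKey.le_digit (hk : IsKey w Q β) {σ : ℝ} {h : K[X]}
    (hσ : (σ : WithTop ℝ) ≤ truncVal w Q β h) (k : ℕ) :
    ((σ - k * β : ℝ) : WithTop ℝ) ≤ w (digit Q h k) := by
  have := hσ.trans (truncVal_le hk.monic hk.natDegree_pos hk.map_zero h k)
  rw [withTop_le_add_iff, ← WithTop.coe_add] at this
  rwa [sub_eq_add_neg]

lemma IsKey.lt_digit (hk : IsKey w Q β) {σ : ℝ} {h : K[X]}
    (hσ : (σ : WithTop ℝ) < truncVal w Q β h) (k : ℕ) :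
    ((σ - k * β : ℝ) : WithTop ℝ) < w (digit Q h k) := by
  refine lt_of_le_of_ne (hk.le_digit hσ.le k) fun e => ?_
  have := hσ.trans_le (truncVal_le hk.monic hk.natDegree_pos hk.map_zero h k)
  rw [← e, ← WithTop.coe_add, sub_add_cancel] at this
  exact lt_irrefl _ this

namespace StrictKey

variable (hk : StrictKey w Q β) {A : Subring (Gr (truncVal w Q β))}
  {σ τ : ℝ} {P P' : A[X]} {h h' : K[X]}
include hk

lemma val_low {c : K[X]} (hc : c.degree < Q.degree) : truncVal w Q β c = w c :=
  hk.val_of_degree_lt hc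

/-- The quotient term `Q * (c * d /ₘ Q)` has strictly larger value by `mul_div_lt` and disappears in
the graded algebra; the remainder, again of low degree, represents the product. This is the use of
strictness. -/
lemma hom_mul_low {γ δ : ℝ} {c d : K[X]} (hc : c.degree < Q.degree) (hd : d.degree < Q.degree)
    (hγ : (γ : WithTop ℝ) ≤ w c) (hδ : (δ : WithTop ℝ) ≤ w d) :
    hom (truncVal w Q β) γ c * hom (truncVal w Q β) δ d =
      hom (truncVal w Q β) (γ + δ) (c * d %ₘ Q) ∧
    ((γ + δ : ℝ) : WithTop ℝ) ≤ w (c * d %ₘ Q) := by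
  have hle : ((γ + δ : ℝ) : WithTop ℝ) ≤ w (c * d %ₘ Q) := by
    rw [hk.mul_mod c d hc hd, WithTop.coe_add]; exact add_le_add hγ hδ
  refine ⟨?_, hle⟩
  rw [hom_mul hk.isVal (by rwa [hk.val_low hc]) (by rwa [hk.val_low hd]), hom_eq_hom_iff hk.isVal]
  · rw [show c * d - c * d %ₘ Q = Q * (c * d /ₘ Q) by
      nth_rewrite 1 [← modByMonic_add_div (c * d) Q]; ring, hk.val_key_mul,
      hk.val_low (degree_mul_div_lt hk.monic hc hd)]
    by_cases hc0 : c = 0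
    · rw [hc0, zero_mul, zero_divByMonic, hk.map_zero, top_add]; exact WithTop.coe_lt_top _
    by_cases hd0 : d = 0
    · rw [hd0, mul_zero, zero_divByMonic, hk.map_zero, top_add]; exact WithTop.coe_lt_top _
    refine lt_of_le_of_lt ?_ (hk.mul_div_lt c d hc0 hd0 hc hd)
    rw [WithTop.coe_add]; exact add_le_add hγ hδ
  · rw [hk.val_mul_low hc hd, WithTop.coe_add]; exact add_le_add hγ hδ
  · rwa [hk.val_low (degree_modByMonic_lt _ hk.monic)]

/-- The additive span of the initial forms of small degree is a ring. -/
lemma mul_mem_closure {y z : Gr (truncVal w Q β)}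
    (hy : y ∈ AddSubgroup.closure
      {y | ∃ c : K[X], c.degree < Q.degree ∧ y = inForm (truncVal w Q β) c})
    (hz : z ∈ AddSubgroup.closure
      {y | ∃ c : K[X], c.degree < Q.degree ∧ y = inForm (truncVal w Q β) c}) :
    y * z ∈ AddSubgroup.closure
      {y | ∃ c : K[X], c.degree < Q.degree ∧ y = inForm (truncVal w Q β) c} := by
  induction hy using AddSubgroup.closure_induction with
  | zero => rw [zero_mul]; exact zero_mem _
  | add a b _ _ ha hb => rw [add_mul]; exact add_mem ha hb
  | neg a _ ha => rw [neg_mul]; exact neg_mem ha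
  | mem a ha =>
    obtain ⟨c, hc, rfl⟩ := ha
    induction hz using AddSubgroup.closure_induction with
    | zero => rw [mul_zero]; exact zero_mem _
    | add a b _ _ ha hb => rw [mul_add]; exact add_mem ha hb
    | neg a _ ha => rw [mul_neg]; exact neg_mem ha
    | mem b hb =>
      obtain ⟨d, hd, rfl⟩ := hb
      by_cases hc0 : c = 0
      · rw [hc0, inForm_of_top hk.isVal.map_zero, zero_mul]; exact zero_mem _
      by_cases hd0 : d = 0
      · rw [hd0, inForm_of_top hk.isVal.map_zero, mul_zero]; exact zero_mem _
      obtain ⟨r, hr⟩ := hk.isVal.exists_real hc0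
      obtain ⟨s, hs⟩ := hk.isVal.exists_real hd0
      have h1 := hk.hom_mul_low hc hd (by rw [← hk.val_low hc, hr]) (by rw [← hk.val_low hd, hs])
      refine AddSubgroup.subset_closure ⟨c * d %ₘ Q, degree_modByMonic_lt _ hk.monic, ?_⟩
      rw [inForm_eq_hom hr, inForm_eq_hom hs, h1.1, inForm_eq_hom]
      rw [hk.val_low (degree_modByMonic_lt _ hk.monic), hk.mul_mod c d hc hd, ← hk.val_low hc,
        ← hk.val_low hd, hr, hs, WithTop.coe_add]

variable (hA : IsLowRing w Q β A)

include hA in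
lemma hom_mem {γ : ℝ} {c : K[X]} (hc : c.degree < Q.degree) (hγ : (γ : WithTop ℝ) ≤ w c) :
    hom (truncVal w Q β) γ c ∈ A := by
  rcases hγ.lt_or_eq with hlt | heq
  · rw [(hom_eq_zero_iff hk.isVal (by rwa [hk.val_low hc])).2 (by rwa [hk.val_low hc])]
    exact zero_mem _
  · rw [← inForm_eq_hom (by rw [hk.val_low hc, heq])]
    exact hA.inForm_mem c hc

-- Since `Q` is irreducible, a nonzero polynomial of low degree has an inverse modulo `Q`; by
-- `mul_mod` its value is the opposite one, which gives `exists_inv`.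
include hA in
lemma gradedField : GradedField (lowHom w Q β A) where
  zero_mem := fun γ => ⟨0, hk.degree_zero_lt, by rw [hk.map_zero]; exact le_top, by
    rw [hom_zero hk.isVal]; rfl⟩
  add_mem := by
    rintro γ a ⟨c, hc, hγ, e⟩ b ⟨d, hd, hδ, e'⟩
    refine ⟨c + d, (degree_add_le _ _).trans_lt (max_lt hc hd),
      (le_min hγ hδ).trans (hk.map_add c d hc hd), ?_⟩
    rw [hom_add hk.isVal (by rwa [hk.val_low hc]) (by rwa [hk.val_low hd]), ← e, ← e']
    rfl
  neg_mem := by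
    rintro γ a ⟨c, hc, hγ, e⟩
    refine ⟨-c, by rwa [degree_neg], by rwa [hk.map_neg c hc], ?_⟩
    rw [hom_neg hk.isVal (by rwa [hk.val_low hc]), ← e]
    rfl
  mul_mem := by
    rintro γ δ a ⟨c, hc, hγ, e⟩ b ⟨d, hd, hδ, e'⟩
    have := hk.hom_mul_low hc hd hγ hδ
    exact ⟨c * d %ₘ Q, degree_modByMonic_lt _ hk.monic, this.2, by rw [← this.1, ← e, ← e']; rfl⟩
  one_mem := ⟨1, hk.degree_one_lt, by rw [hk.map_one]; simp, by rw [hom_one hk.isVal]; rfl⟩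
  degree_one := by
    rintro γ ⟨c, hc, hγ, e⟩
    have h1 : hom (truncVal w Q β) 0 1 = hom (truncVal w Q β) γ c := by
      rw [← e, hom_one hk.isVal]; rfl
    refine (degree_eq_of_hom_eq hk.isVal ?_ (by rwa [hk.val_low hc]) h1 ?_).symm
    · rw [hk.isVal.map_one]; simp
    · rw [Ne, hom_eq_zero_iff hk.isVal, hk.isVal.map_one]
      · simp
      · rw [hk.isVal.map_one]; simp
  exists_inv := by
    rintro γ a ⟨c, hc, hγ, e⟩ ha
    have hw : w c = γ := by
      by_contra hne
      apply ha
      apply Subtype.ext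
      rw [e, ZeroMemClass.coe_zero, hom_eq_zero_iff hk.isVal (by rwa [hk.val_low hc]),
        hk.val_low hc]
      exact lt_of_le_of_ne hγ (Ne.symm hne)
    have hc0 : c ≠ 0 := by
      rintro rfl; rw [hk.map_zero] at hw; exact WithTop.top_ne_coe hw
    obtain ⟨d, hd, hcd⟩ := hk.exists_inv hc0 hc
    have h1 := hk.mul_mod c d hc hd
    rw [hcd, hk.map_one, hw] at h1
    have hd0 : d ≠ 0 := by
      rintro rfl; rw [hk.map_zero, add_top] at h1; exact WithTop.zero_ne_top h1
    have hwd : w d = ((-γ : ℝ) : WithTop ℝ) := by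
      have h2 := hk.ne_top d hd0 hd
      lift w d to ℝ using h2 with r
      norm_cast at h1 ⊢
      linarith
    have h3 := hk.hom_mul_low hc hd hw.ge hwd.ge
    refine ⟨⟨_, hk.hom_mem hA hd hwd.ge⟩, ⟨d, hd, hwd.ge, rfl⟩, ?_⟩
    apply Subtype.ext
    rw [Subring.coe_mul, e, h3.1, hcd, add_neg_cancel, hom_one hk.isVal]
    rfl

lemma hom_mul_key_pow {h : K[X]} {k : ℕ} (hσ : ((σ - k * β : ℝ) : WithTop ℝ) ≤ truncVal w Q β h) :
    hom (truncVal w Q β) (σ - k * β) h * inForm (truncVal w Q β) Q ^ k =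
      hom (truncVal w Q β) σ (h * Q ^ k) := by
  rw [inForm_eq_hom hk.val_key, (hom_pow hk.isVal hk.val_key.ge k).1,
    hom_mul hk.isVal hσ (hom_pow hk.isVal hk.val_key.ge k).2, sub_add_cancel]

lemma le_digit_mul_pow (hσ : (σ : WithTop ℝ) ≤ truncVal w Q β h) (k : ℕ) :
    (σ : WithTop ℝ) ≤ truncVal w Q β (digit Q h k * Q ^ k) := by
  rw [mul_comm, hk.val_key_pow_mul, hk.val_low (degree_digit_lt hk.monic h k)]
  exact hσ.trans (truncVal_le hk.monic hk.natDegree_pos hk.map_zero h k)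

end StrictKey

namespace Rep

variable {A : Subring (Gr (truncVal w Q β))} {σ τ : ℝ} {P P' : A[X]} {h h' : K[X]}
variable (hk : StrictKey w Q β)
include hk

lemma ev (hR : Rep A σ P h) : evKey A P = hom (truncVal w Q β) σ h := by
  set N := max P.natDegree h.natDegree + 1 with hN
  rw [evKey, coe_eval₂RingHom, eval₂_eq_sum_range' A.subtype (n := N) (by omega)]
  conv_rhs => rw [← sum_digit hk.monic hk.natDegree_pos (h := h) (N := N) (by omega)]
  rw [hom_sum hk.isVal _ fun k _ => hk.le_digit_mul_pow hR.1 k]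
  refine Finset.sum_congr rfl fun k _ => ?_
  rw [← hk.hom_mul_key_pow]
  · rw [Subring.coe_subtype, hR.2 k]
  · rw [hk.val_low (degree_digit_lt hk.monic h k)]
    exact hk.le_digit hR.1 k

lemma add (hR : Rep A σ P h) (hR' : Rep A σ P' h') : Rep A σ (P + P') (h + h') := by
  refine ⟨hk.isVal.le_add hR.1 hR'.1, fun k => ?_⟩
  rw [coeff_add, Subring.coe_add, hR.2, hR'.2, digit_add hk.monic, hom_add hk.isVal]
  · rw [hk.val_low (degree_digit_lt hk.monic h k)]; exact hk.le_digit hR.1 k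
  · rw [hk.val_low (degree_digit_lt hk.monic h' k)]; exact hk.le_digit hR'.1 k

lemma zero : Rep A σ 0 0 := by
  refine ⟨by rw [hk.isVal.map_zero]; exact le_top, fun k => ?_⟩
  rw [coeff_zero, digit_zero_right, hom_zero hk.isVal]; rfl

lemma neg (hR : Rep A σ P h) : Rep A σ (-P) (-h) := by
  refine ⟨by rw [hk.isVal.map_neg]; exact hR.1, fun k => ?_⟩
  have e : digit Q (-h) k = - digit Q h k := by
    rw [eq_neg_iff_add_eq_zero, ← digit_add hk.monic]; simp
  rw [coeff_neg, e, hom_neg hk.isVal, ← hR.2 k]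
  · rfl
  · rw [hk.val_low (degree_digit_lt hk.monic h k)]; exact hk.le_digit hR.1 k

lemma eq_zero_of_lt (hR : Rep A σ P h) (hlt : (σ : WithTop ℝ) < truncVal w Q β h) : P = 0 := by
  ext k
  rw [hR.2, coeff_zero, ZeroMemClass.coe_zero, hom_eq_zero_iff hk.isVal] <;>
    rw [hk.val_low (degree_digit_lt hk.monic h k)]
  · exact hk.lt_digit hlt k
  · exact (hk.lt_digit hlt k).le

end Rep

namespace StrictKey

variable (hk : StrictKey w Q β) {A : Subring (Gr (truncVal w Q β))}
  {σ τ : ℝ} {P P' : A[X]} {h h' : K[X]} (hA : IsLowRing w Q β A)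
include hk hA

lemma exists_rep (hσ : (σ : WithTop ℝ) ≤ truncVal w Q β h) : ∃ P : A[X], Rep A σ P h := by
  have hm : ∀ k : ℕ, hom (truncVal w Q β) (σ - k * β) (digit Q h k) ∈ A := fun k =>
    hk.hom_mem hA (degree_digit_lt hk.monic h k) (hk.le_digit hσ k)
  refine ⟨∑ k ∈ Finset.range (h.natDegree + 1), C ⟨_, hm k⟩ * X ^ k, hσ, fun k => ?_⟩
  rw [finsetSum_coeff]
  simp only [coeff_C_mul_X_pow]
  rw [Finset.sum_ite_eq]
  split_ifs with hmem
  · rfl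
  · rw [digit_eq_zero' hk.monic hk.natDegree_pos (by simpa using hmem), hom_zero hk.isVal]; rfl

/-- Every polynomial over `A` is a sum of homogeneous ones. -/
lemma exists_decomposition (P : A[X]) : ∃ (s : Finset ℝ) (F : ℝ → A[X]),
    (∀ σ, ∃ h, Rep A σ (F σ) h) ∧ (∀ σ ∉ s, F σ = 0) ∧ P = ∑ σ ∈ s, F σ := by
  classical
  let D : A[X] → Prop := fun P => ∃ (s : Finset ℝ) (F : ℝ → A[X]),
    (∀ σ, ∃ h, Rep A σ (F σ) h) ∧ (∀ σ ∉ s, F σ = 0) ∧ P = ∑ σ ∈ s, F σ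
  have hadd : ∀ P P', D P → D P' → D (P + P') := by
    rintro P P' ⟨s, F, h1, h2, rfl⟩ ⟨s', F', h1', h2', rfl⟩
    refine ⟨s ∪ s', F + F', fun σ => ?_, fun σ hσ => ?_, ?_⟩
    · obtain ⟨h, hh⟩ := h1 σ
      obtain ⟨h', hh'⟩ := h1' σ
      exact ⟨h + h', hh.add hk hh'⟩
    · rw [Finset.mem_union, not_or] at hσ
      rw [Pi.add_apply, h2 σ hσ.1, h2' σ hσ.2, add_zero]
    · simp only [Pi.add_apply]
      rw [Finset.sum_add_distrib, Finset.sum_subset Finset.subset_union_left fun σ _ => h2 σ,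
        Finset.sum_subset Finset.subset_union_right fun σ _ => h2' σ]
  have hzero : D 0 := ⟨∅, 0, fun σ => ⟨0, Rep.zero hk⟩, fun _ _ => rfl, by simp⟩
  have hneg : ∀ P, D P → D (-P) := by
    rintro P ⟨s, F, h1, h2, rfl⟩
    refine ⟨s, -F, fun σ => ?_, fun σ hσ => by rw [Pi.neg_apply, h2 σ hσ, neg_zero], by simp⟩
    obtain ⟨h, hh⟩ := h1 σ
    exact ⟨-h, hh.neg hk⟩
  have hrep : ∀ σ P h, Rep A σ P h → D P := by
    intro σ P h hP
    refine ⟨{σ}, Pi.single σ P, fun τ => ?_, fun τ hτ => ?_, by simp⟩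
    · by_cases hτ : τ = σ
      · subst hτ; exact ⟨h, by rwa [Pi.single_eq_same]⟩
      · exact ⟨0, by rw [Pi.single_eq_of_ne hτ]; exact Rep.zero hk⟩
    · rw [Finset.mem_singleton] at hτ
      exact Pi.single_eq_of_ne hτ _
  have hmon : ∀ (k : ℕ) (y : Gr (truncVal w Q β)) (_ : y ∈ AddSubgroup.closure
      {y | ∃ c : K[X], c.degree < Q.degree ∧ y = inForm (truncVal w Q β) c}) (hy : y ∈ A),
      D (C ⟨y, hy⟩ * X ^ k) := by
    have hle : ∀ y ∈ AddSubgroup.closure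
      {y | ∃ c : K[X], c.degree < Q.degree ∧ y = inForm (truncVal w Q β) c}, y ∈ A := by
      intro y hy
      refine (AddSubgroup.closure_le A.toAddSubgroup).2 ?_ hy
      rintro _ ⟨c, hc, rfl⟩
      exact hA.inForm_mem c hc
    intro k y hy
    induction hy using AddSubgroup.closure_induction with
    | zero =>
      intro h0
      have : (⟨0, h0⟩ : A) = 0 := rfl
      rw [this, C_0, zero_mul]; exact hzero
    | add a b ha hb iha ihb =>
      intro hab
      have : (⟨a + b, hab⟩ : A) = ⟨a, hle a ha⟩ + ⟨b, hle b hb⟩ := rfl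
      rw [this, C_add, add_mul]
      exact hadd _ _ (iha _) (ihb _)
    | neg a ha iha =>
      intro hab
      have : C (⟨-a, hab⟩ : A) * X ^ k = -(C ⟨a, hle a ha⟩ * X ^ k) := by
        have e : (⟨-a, hab⟩ : A) + ⟨a, hle a ha⟩ = 0 := Subtype.ext (neg_add_cancel a)
        rw [eq_neg_iff_add_eq_zero, ← add_mul, ← C_add, e, C_0, zero_mul]
      rw [this]
      exact hneg _ (iha _)
    | mem y hy =>
      obtain ⟨c, hc, rfl⟩ := hy
      intro hcm
      by_cases hc0 : c = 0
      · have : (⟨inForm (truncVal w Q β) c, hcm⟩ : A) = 0 := by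
          apply Subtype.ext
          exact inForm_of_top (by rw [hc0, hk.isVal.map_zero])
        rw [this, C_0, zero_mul]; exact hzero
      obtain ⟨r, hr⟩ := hk.isVal.exists_real hc0
      refine hrep (r + k * β) _ (c * Q ^ k) ⟨?_, fun j => ?_⟩
      · rw [mul_comm c, hk.val_key_pow_mul, hr, WithTop.coe_add]
      · rw [coeff_C_mul_X_pow, digit_mul_pow hk.monic hk.degree_pos hc]
        split_ifs with hjk
        · rw [hjk, add_sub_cancel_right]; exact inForm_eq_hom hr
        · rw [hom_zero hk.isVal]; rfl
  have : D P := by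
    rw [as_sum_range_C_mul_X_pow P]
    refine Finset.sum_induction _ D (fun a b => hadd a b) hzero fun k _ => ?_
    exact hmon k _ (hA.mem_closure _ (P.coeff k).2) (P.coeff k).2
  exact this

/-- The initial form of `Q` is transcendental over `A`. -/
lemma evKey_injective : Function.Injective (evKey A) := by
  rw [injective_iff_map_eq_zero]
  intro P hP
  -- Evaluation sends each homogeneous part to the class of some `h σ` in degree `σ`. Components of
  -- different degrees are independent in `Gr`, so each `h σ` has value greater than `σ`, and then
  -- every coefficient of the part `F σ` vanishes.
  obtain ⟨s, F, h1, h2, rfl⟩ := hk.exists_decomposition hA P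
  choose h hh using h1
  rw [map_sum] at hP
  have := lt_of_sum_hom_eq_zero hk.isVal s h (fun σ _ => (hh σ).1) (by
    rw [← hP]
    exact Finset.sum_congr rfl fun σ _ => ((hh σ).ev hk).symm)
  exact Finset.sum_eq_zero fun σ hσ => (hh σ).eq_zero_of_lt hk (this σ hσ)

lemma rep_of_evKey_eq (hσ : (σ : WithTop ℝ) ≤ truncVal w Q β h)
    (e : evKey A P = hom (truncVal w Q β) σ h) : Rep A σ P h := by
  obtain ⟨P', hP'⟩ := hk.exists_rep hA hσ
  have : P = P' := hk.evKey_injective hA (by rw [e, hP'.ev hk])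
  rwa [this]

-- Homogeneous coefficients are classes of low polynomials, which can be taken as digits. This
-- translates between factorization over `A` and values in `K[X]`.
omit hA in
lemma isHP_iff : IsHP (lowHom w Q β A) β σ P ↔ ∃ h, Rep A σ P h := by
  constructor
  · intro hP
    choose c hc hσ e using hP
    have hdig : ∀ k, digit Q (∑ i ∈ Finset.range (P.natDegree + 1), c i * Q ^ i) k =
        if k ∈ Finset.range (P.natDegree + 1) then c k else 0 := fun k =>
      digit_sum_mul_pow hk.monic hk.degree_pos _ c (fun i _ => hc i) k
    refine ⟨∑ k ∈ Finset.range (P.natDegree + 1), c k * Q ^ k, ?_, fun k => ?_⟩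
    · refine hk.isVal.le_sum fun k _ => ?_
      rw [mul_comm, hk.val_key_pow_mul, hk.val_low (hc k), withTop_le_add_iff, ← WithTop.coe_add]
      exact hσ k
    · rw [hdig]
      split_ifs with hk'
      · exact e k
      · rw [coeff_eq_zero_of_natDegree_lt (by simpa using hk'), hom_zero hk.isVal]; rfl
  · rintro ⟨h, hR⟩ k
    exact ⟨digit Q h k, degree_digit_lt hk.monic h k, hk.le_digit hR.1 k, hR.2 k⟩

/-- Homogeneity of factors holds in the graded algebra of the valuation and is pulled back along the
injective evaluation `evKey`. -/
lemma isHP_of_mul (hP : IsHP (lowHom w Q β A) β σ P) (hP0 : P ≠ 0) {a b : A[X]} (e : P = a * b) :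
    ∃ τ, IsHP (lowHom w Q β A) β τ a := by
  obtain ⟨h, hR⟩ := (hk.isHP_iff).1 hP
  have h1 : evKey A a * evKey A b = hom (truncVal w Q β) σ h := by
    rw [← map_mul, ← e, hR.ev hk]
  have h2 : hom (truncVal w Q β) σ h ≠ 0 := by
    rw [← hR.ev hk, Ne, map_eq_zero_iff _ (hk.evKey_injective hA)]
    exact hP0
  obtain ⟨τ, b', hb, e'⟩ := exists_hom_of_mul_eq hk.isVal hR.1 h1 h2
  exact ⟨τ, (hk.isHP_iff).2 ⟨b', hk.rep_of_evKey_eq hA hb e'⟩⟩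

end StrictKey

namespace Rep

variable {A : Subring (Gr (truncVal w Q β))} {σ : ℝ} {P : A[X]} {h : K[X]}
variable (hk : StrictKey w Q β)
include hk

lemma coeff_ne_zero_iff (hR : Rep A σ P h) (hσ : truncVal w Q β h = σ) (k : ℕ) :
    P.coeff k ≠ 0 ↔ k ∈ sideSet w Q β h := by
  have hl := hk.le_digit hR.1 k
  have h1 : P.coeff k = 0 ↔ ((σ - k * β : ℝ) : WithTop ℝ) < w (digit Q h k) := by
    rw [← Subtype.coe_inj, hR.2, ZeroMemClass.coe_zero, hom_eq_zero_iff hk.isVal] <;>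
      rw [hk.val_low (degree_digit_lt hk.monic h k)]
    exact hl
  rw [Ne, h1, not_lt, mem_sideSet_iff, hσ]
  constructor
  · intro h2
    have e := le_antisymm h2 hl
    refine ⟨?_, by rw [e, ← WithTop.coe_add, sub_add_cancel]⟩
    by_contra hlt
    rw [digit_eq_zero' hk.monic hk.natDegree_pos (not_le.1 hlt), hk.map_zero] at e
    exact WithTop.top_ne_coe e
  · rintro ⟨-, e⟩
    by_contra hlt
    rw [not_le] at hlt
    have := WithTop.add_lt_add_right (z := ((k * β : ℝ) : WithTop ℝ)) WithTop.coe_ne_top hlt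
    rw [e, ← WithTop.coe_add, sub_add_cancel] at this
    exact lt_irrefl _ this

lemma map_eq_inPoly (hR : Rep A σ P h) (hσ : truncVal w Q β h = σ) :
    P.map A.subtype = inPoly w Q β h := by
  ext k
  rw [coeff_map, inPoly, finsetSum_coeff]
  simp only [coeff_C_mul_X_pow]
  rw [Finset.sum_ite_eq]
  split_ifs with hmem
  · rw [Subring.coe_subtype, hR.2, inForm_eq_hom]
    have := (mem_sideSet_iff.1 hmem).2
    rw [hσ] at this
    rw [hk.val_low (degree_digit_lt hk.monic h k)]
    refine le_antisymm ?_ (hk.le_digit hR.1 k)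
    rw [sub_eq_add_neg, WithTop.coe_add, ← this, add_assoc, ← WithTop.coe_add, add_neg_cancel]
    simp
  · have := (hR.coeff_ne_zero_iff hk hσ k).not.2 hmem
    rw [not_not] at this
    rw [this, map_zero]

lemma ne_zero (hR : Rep A σ P h) (hσ : truncVal w Q β h = σ) : P ≠ 0 := by
  rintro rfl
  obtain ⟨j, hj, e⟩ := exists_truncVal_eq w Q β h
  exact (hR.coeff_ne_zero_iff hk hσ j).2 (mem_sideSet_iff.2 ⟨hj, e.symm⟩) (coeff_zero j)

lemma natDegree_eq (hR : Rep A σ P h) (hσ : truncVal w Q β h = σ) :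
    P.natDegree = topIndex w Q β h := by
  have h0 := hR.ne_zero hk hσ
  refine le_antisymm ?_ ?_
  · exact Finset.le_sup (f := id) ((hR.coeff_ne_zero_iff hk hσ _).1
      (leadingCoeff_ne_zero.2 h0))
  · refine Finset.sup_le fun k hmem => ?_
    exact le_natDegree_of_ne_zero ((hR.coeff_ne_zero_iff hk hσ _).2 hmem)

end Rep

end KeyPoly
end
noncomputable section
namespace KeyPoly

/-! ### Liftings of irreducible homogeneous polynomials -/

variable {K : Type*} [Field K] {Q Q' : K[X]} {w : K[X] → WithTop ℝ} {β : ℝ}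

/-- `Q'` is a lifting of `g`. -/
structure Lifts {A : Subring (Gr (truncVal w Q β))} (g : A[X]) (Q' : K[X]) : Prop where
  monic : Q'.Monic
  natDegree_eq : Q'.natDegree = g.natDegree * Q.natDegree
  inForm_digit : ∀ j < g.natDegree,
    inForm (truncVal w Q β) (digit Q Q' j) = (g.coeff j : Gr (truncVal w Q β))

lemma exists_min_sideSet (w : K[X] → WithTop ℝ) (Q : K[X]) (β : ℝ) (h : K[X]) :
    sInf {j | j ∈ sideSet w Q β h} ∈ sideSet w Q β h := by
  obtain ⟨j, hj, e⟩ := exists_truncVal_eq w Q β h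
  exact Nat.sInf_mem (s := {j | j ∈ sideSet w Q β h}) ⟨j, mem_sideSet_iff.2 ⟨hj, e.symm⟩⟩

lemma natDegree_pos_of_monic_of_irreducible {A : Type*} [CommRing A] {g : A[X]} (hg : g.Monic)
    (hgi : Irreducible g) : 0 < g.natDegree := by
  rw [Nat.pos_iff_ne_zero, Ne, hg.natDegree_eq_zero]
  rintro rfl
  exact hgi.not_isUnit isUnit_one

namespace Lifts

variable {A : Subring (Gr (truncVal w Q β))} {g : A[X]} {τ : ℝ}

section

variable (hk : StrictKey w Q β) (hl : Lifts g Q')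
include hk hl

lemma degree_sub_lt : (Q' - Q ^ g.natDegree).degree < (Q ^ g.natDegree).degree := by
  have hd : Q'.degree = (Q ^ g.natDegree).degree := by
    rw [degree_eq_natDegree hl.monic.ne_zero, degree_eq_natDegree (hk.monic.pow _).ne_zero,
      hk.monic.natDegree_pow, hl.natDegree_eq]
  rw [← hd]
  exact Polynomial.degree_sub_lt_left hd hl.monic.ne_zero
    (by rw [hl.monic.leadingCoeff, (hk.monic.pow _).leadingCoeff])

lemma digit_natDegree : digit Q Q' g.natDegree = 1 := by
  have e : Q' /ₘ Q ^ g.natDegree = 1 :=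
    (div_modByMonic_unique 1 (Q' - Q ^ g.natDegree) (hk.monic.pow _)
      ⟨by ring, hl.degree_sub_lt hk⟩).1
  rw [digit, e, (modByMonic_eq_self_iff hk.monic).2 hk.degree_one_lt]

lemma digit_of_lt {j : ℕ} (hj : g.natDegree < j) : digit Q Q' j = 0 := by
  apply digit_eq_zero hk.monic
  rw [hl.natDegree_eq]
  exact Nat.mul_lt_mul_of_pos_right hj hk.natDegree_pos

end

variable (hk : StrictKey w Q β) (hA : IsLowRing w Q β A) (hl : Lifts g Q')
  (hg : g.Monic) (hgi : Irreducible g) (hgh : IsHP (lowHom w Q β A) β τ g)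
include hk hA hl hg hgi hgh

omit hA hgh in
lemma key_natDegree_pos : 0 < Q'.natDegree := by
  rw [hl.natDegree_eq]
  exact Nat.mul_pos (natDegree_pos_of_monic_of_irreducible hg hgi) hk.natDegree_pos

-- A lifting is only required to have the right initial forms. As `g` is homogeneous, a nonzero
-- initial form determines its degree, so the digits also have the right values.
omit hgi in
lemma rep : Rep A (g.natDegree * β) g Q' := by
  have hτ := hgh.degree_of_monic (hk.gradedField hA) hg
  rw [hτ] at hgh
  have hdig : ∀ j : ℕ, ((g.natDegree * β - j * β : ℝ) : WithTop ℝ) ≤ w (digit Q Q' j) ∧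
      (g.coeff j : Gr (truncVal w Q β)) =
        hom (truncVal w Q β) (g.natDegree * β - j * β) (digit Q Q' j) := by
    intro j
    rcases lt_trichotomy j g.natDegree with hj | hj | hj
    · obtain ⟨c, hc, hγ, e⟩ := hgh j
      have hl3 := hl.inForm_digit j hj
      by_cases h0 : digit Q Q' j = 0
      · rw [h0, inForm_of_top hk.isVal.map_zero] at hl3
        rw [h0, hk.map_zero, ← hl3, hom_zero hk.isVal]
        exact ⟨le_top, rfl⟩
      · obtain ⟨r, hr⟩ := hk.isVal.exists_real h0
        have h1 : inForm (truncVal w Q β) (digit Q Q' j) ≠ 0 := by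
          rwa [Ne, inForm_eq_zero_iff hk.isVal]
        rw [inForm_eq_hom hr] at h1
        rw [e, inForm_eq_hom hr] at hl3
        have h2 := degree_eq_of_hom_eq hk.isVal hr.ge (by rwa [hk.val_low hc]) hl3 h1
        rw [← h2, ← hk.val_low (degree_digit_lt hk.monic Q' j), hr, hl3, h2, ← e]
        exact ⟨le_rfl, rfl⟩
    · rw [hj, hl.digit_natDegree hk, hg.coeff_natDegree, hk.map_one, sub_self, hom_one hk.isVal]
      exact ⟨le_rfl, rfl⟩
    · rw [hl.digit_of_lt hk hj, coeff_eq_zero_of_natDegree_lt hj, hk.map_zero, hom_zero hk.isVal]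
      exact ⟨le_top, rfl⟩
  refine ⟨?_, fun j => (hdig j).2⟩
  rw [le_truncVal_iff hk.monic hk.natDegree_pos hk.map_zero]
  intro j
  rw [withTop_le_add_iff, ← WithTop.coe_add]
  exact (hdig j).1

omit hgi in
lemma val_eq : truncVal w Q β Q' = ((g.natDegree * β : ℝ) : WithTop ℝ) := by
  have hR := hl.rep hk hA hg hgh
  by_contra hne
  exact hg.ne_zero_of_ne (by
    have := isDomain_gr hk.isVal
    exact zero_ne_one) (hR.eq_zero_of_lt hk (lt_of_le_of_ne hR.1 (Ne.symm hne)))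

omit hgi in
lemma le_val_sub : ((g.natDegree * β : ℝ) : WithTop ℝ) ≤ truncVal w Q β (Q' - Q ^ g.natDegree) := by
  refine hk.isVal.le_sub (hl.rep hk hA hg hgh).1 ?_
  have := hk.val_key_pow_mul g.natDegree 1
  rw [mul_one, hk.isVal.map_one, zero_add] at this
  exact this.ge

lemma truncVal_eq : truncVal (truncVal w Q β) Q' (g.natDegree * β) = truncVal w Q β :=
  hk.truncVal_shift hl.monic (hl.key_natDegree_pos hk hg hgi) (hl.degree_sub_lt hk)
    (hl.le_val_sub hk hA hg hgh)

omit hgi in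
lemma val_le_mod (h : K[X]) : truncVal w Q β h ≤ truncVal w Q β (h %ₘ Q') :=
  hk.val_le_mod_shift hl.monic (hl.degree_sub_lt hk) (hl.le_val_sub hk hA hg hgh) h

omit hgi in
lemma val_le_div (h : K[X]) :
    truncVal w Q β h ≤ truncVal w Q β (h /ₘ Q') + ((g.natDegree * β : ℝ) : WithTop ℝ) :=
  hk.val_le_div_shift hl.monic (hl.degree_sub_lt hk) (hl.le_val_sub hk hA hg hgh) h

-- Such a `c` has no nonzero digit of index `deg g` or more, so its representative has degree less
-- than that of the monic `g`.
omit hA hg hgi hgh in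
lemma not_dvd_of_degree_lt [Nontrivial A] (hg : g.Monic) {σ : ℝ} {c : K[X]} {P : A[X]}
    (hP : Rep A σ P c) (hc0 : c ≠ 0) (hσ : truncVal w Q β c = σ) (hc : c.degree < Q'.degree) :
    ¬ g ∣ P := by
  refine hg.not_dvd_of_natDegree_lt (hP.ne_zero hk hσ) ?_
  rw [hP.natDegree_eq hk hσ]
  by_contra hlt
  have hmem : topIndex w Q β c ∈ sideSet w Q β c := by
    obtain ⟨j, hj⟩ := Finset.exists_mem_eq_sup (sideSet w Q β c)
      ⟨_, exists_min_sideSet w Q β c⟩ id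
    rw [topIndex, hj.2]; exact hj.1
  have h1 := (mem_sideSet_iff.1 hmem).2
  rw [digit_eq_zero hk.monic, hk.map_zero, top_add, hσ] at h1
  · exact WithTop.top_ne_coe h1
  · refine (natDegree_lt_natDegree hc0 hc).trans_le ?_
    rw [hl.natDegree_eq]
    exact Nat.mul_le_mul_right _ (not_lt.1 hlt)

/-- A lifting of a monic irreducible polynomial is a key polynomial. -/
lemma isKey : IsKey (truncVal w Q β) Q' (g.natDegree * β) where
  monic := hl.monic
  natDegree_pos := hl.key_natDegree_pos hk hg hgi
  map_zero := hk.isVal.map_zero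
  ne_top := fun c hc0 _ => hk.isVal.ne_top c hc0
  map_add := fun c d _ _ => hk.isVal.map_add c d
  mul_div := fun c d _ _ => by
    rw [← hk.val_mul]; exact hl.val_le_div hk hA hg hgh _
  mul_mod := fun c d hc hd => by
    have := isDomain_gr hk.isVal
    by_cases hc0 : c = 0
    · simp [hc0, hk.isVal.map_zero]
    by_cases hd0 : d = 0
    · simp [hd0, hk.isVal.map_zero]
    rw [← hk.val_mul]
    -- If the remainder had larger value than `c * d`, the initial form of the product would come
    -- from the multiple of `Q'` and would be divisible by `g`. Then `g` would divide the
    -- representative of `c` or that of `d`, both of smaller degree than `g`.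
    by_contra hne
    have hle := hl.val_le_mod hk hA hg hgh (c * d)
    have hlt := lt_of_le_of_ne hle (Ne.symm hne)
    obtain ⟨r, hr⟩ := hk.isVal.exists_real hc0
    obtain ⟨s, hs⟩ := hk.isVal.exists_real hd0
    have hrs : truncVal w Q β (c * d) = ((r + s : ℝ) : WithTop ℝ) := by
      rw [hk.val_mul, hr, hs, WithTop.coe_add]
    obtain ⟨Pc, hPc⟩ := hk.exists_rep hA hr.ge
    obtain ⟨Pd, hPd⟩ := hk.exists_rep hA hs.ge
    have hv : ((r + s - g.natDegree * β : ℝ) : WithTop ℝ) ≤ truncVal w Q β (c * d /ₘ Q') := by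
      have := hl.val_le_div hk hA hg hgh (c * d)
      rw [hrs, withTop_le_add_iff, ← WithTop.coe_add] at this
      rwa [sub_eq_add_neg]
    obtain ⟨Pv, hPv⟩ := hk.exists_rep hA hv
    have hR := hl.rep hk hA hg hgh
    have e : Pc * Pd = g * Pv := by
      apply hk.evKey_injective hA
      rw [map_mul, map_mul, hPc.ev hk, hPd.ev hk, hPv.ev hk, hR.ev hk, hom_mul hk.isVal hr.ge hs.ge,
        hom_mul hk.isVal hR.1 hv, add_sub_cancel, hom_eq_hom_iff hk.isVal hrs.ge, ← hrs,
        ← modByMonic_eq_sub_mul_div]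
      · exact hlt
      · rw [hk.val_mul, hl.val_eq hk hA hg hgh, show r + s = g.natDegree * β +
          (r + s - g.natDegree * β) by ring, WithTop.coe_add]
        exact add_le_add le_rfl hv
    rcases IsHP.dvd_or_dvd (hk.gradedField hA) hg hgi hgh (hk.isHP_iff.2 ⟨c, hPc⟩)
      (Dvd.intro _ e.symm) with h | h
    · exact hl.not_dvd_of_degree_lt hk hg hPc hc0 hr hc h
    · exact hl.not_dvd_of_degree_lt hk hg hPd hd0 hs hd h

/-- The multiplicity of `g` in the initial form of `f` is the least index on the side which
corresponds to the valuation itself. -/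
lemma exists_eq_pow_mul {f : K[X]} {σ : ℝ} {F : A[X]} (hσ : truncVal w Q β f = σ)
    (hF : Rep A σ F f) :
    ∃ F₁ : A[X], F = g ^ (sInf {j | j ≤ f.natDegree ∧
      truncVal w Q β (digit Q' f j * Q' ^ j) = truncVal w Q β f}) * F₁ ∧ ¬ g ∣ F₁ := by
  have := isDomain_gr hk.isVal
  have hQ' := hl.monic
  have hQ'0 := hl.key_natDegree_pos hk hg hgi
  have hR := hl.rep hk hA hg hgh
  have hval : ∀ (j : ℕ) (u : K[X]), truncVal w Q β (u * Q' ^ j) =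
      truncVal w Q β u + ((j * (g.natDegree * β) : ℝ) : WithTop ℝ) := by
    intro j u
    rw [hk.val_mul, hk.isVal.map_pow, hl.val_eq hk hA hg hgh, ← WithTop.coe_nsmul, nsmul_eq_mul]
  set S := {j | j ≤ f.natDegree ∧
      truncVal w Q β (digit Q' f j * Q' ^ j) = truncVal w Q β f} with hS
  have hle : ∀ j, truncVal w Q β f ≤ truncVal w Q β (digit Q' f j * Q' ^ j) := by
    intro j
    rw [hval]
    conv_lhs => rw [← hl.truncVal_eq hk hA hg hgi hgh]
    exact truncVal_le hQ' hQ'0 hk.isVal.map_zero f j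
  have hne : S.Nonempty := by
    obtain ⟨j, hj, e⟩ := exists_truncVal_eq (truncVal w Q β) Q' (g.natDegree * β) f
    rw [hl.truncVal_eq hk hA hg hgi hgh] at e
    exact ⟨j, hj, by rw [hval, e]⟩
  set e := sInf S with he
  have hmem : e ∈ S := Nat.sInf_mem hne
  have hlt : ∀ j < e, truncVal w Q β f < truncVal w Q β (digit Q' f j * Q' ^ j) := by
    intro j hj
    refine lt_of_le_of_ne (hle j) fun h => Nat.notMem_of_lt_sInf hj ⟨?_, h.symm⟩
    exact hj.le.trans hmem.1
  -- The terms of index below `e` have larger value, so `Q' ^ e * f₁` has the initial form of `f`;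
  -- by the choice of `e` the zeroth digit of `f₁` has the value of `f₁`.
  set f₁ := f /ₘ Q' ^ e with hf₁
  set r := ∑ j ∈ Finset.range e, digit Q' f j * Q' ^ j with hr
  have hsum : r + Q' ^ e * f₁ = f := sum_digit_add hQ' f e
  have hrlt : truncVal w Q β f < truncVal w Q β r := by
    rw [hσ]
    refine hk.isVal.lt_sum fun j hj => ?_
    rw [← hσ]
    exact hlt j (Finset.mem_range.1 hj)
  have hfe : truncVal w Q β (Q' ^ e * f₁) = σ := by
    rw [← hσ]
    refine hk.isVal.eq_of_lt_sub ?_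
    rw [hk.isVal.map_sub_swap, show f - Q' ^ e * f₁ = r by rw [← hsum]; ring]
    exact hrlt
  have hf₁v : truncVal w Q β f₁ = ((σ - e * (g.natDegree * β) : ℝ) : WithTop ℝ) := by
    rw [mul_comm (Q' ^ e), hval] at hfe
    have h2 : truncVal w Q β f₁ ≠ ⊤ := by
      intro h2; rw [h2, top_add] at hfe; exact WithTop.top_ne_coe hfe
    lift truncVal w Q β f₁ to ℝ using h2 with x
    norm_cast at hfe ⊢
    linarith
  have hf₁m : truncVal w Q β (f₁ %ₘ Q') = truncVal w Q β f₁ := by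
    have h1 := hmem.2
    rw [hval, hσ, ← hfe, mul_comm (Q' ^ e), hval] at h1
    exact WithTop.add_right_cancel WithTop.coe_ne_top h1
  obtain ⟨F₁, hF₁⟩ := hk.exists_rep hA hf₁v.ge
  refine ⟨F₁, ?_, ?_⟩
  · apply hk.evKey_injective hA
    have hpow := hom_pow hk.isVal hR.1 e
    rw [map_mul, map_pow, hF.ev hk, hR.ev hk, hF₁.ev hk, hpow.1,
      hom_mul hk.isVal hpow.2 hf₁v.ge, add_sub_cancel,
      hom_eq_hom_iff hk.isVal hσ.ge hfe.ge,
      show f - Q' ^ e * f₁ = r by rw [← hsum]; ring, ← hσ]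
    exact hrlt
  -- If `g` divided the initial form of `f₁`, some `f₁ - Q' * v` would have larger value than `f₁`.
  -- But it has the same remainder modulo `Q'`, whose value is that of `f₁` and bounds its value
  -- from above.
  · rintro ⟨G, hG⟩
    have hF₁0 := hF₁.ne_zero hk hf₁v
    obtain ⟨τ', hG'⟩ := hk.isHP_of_mul hA (hk.isHP_iff.2 ⟨f₁, hF₁⟩) hF₁0
      (hG.trans (mul_comm g G))
    obtain ⟨v, hv⟩ := hk.isHP_iff.1 hG'
    have h1 : hom (truncVal w Q β) (σ - e * (g.natDegree * β)) f₁ =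
        hom (truncVal w Q β) (g.natDegree * β + τ') (Q' * v) := by
      rw [← hom_mul hk.isVal hR.1 hv.1, ← hR.ev hk, ← hv.ev hk, ← map_mul, ← hG, hF₁.ev hk]
    have h2 : ((g.natDegree * β + τ' : ℝ) : WithTop ℝ) ≤ truncVal w Q β (Q' * v) := by
      rw [hk.val_mul, WithTop.coe_add]; exact add_le_add hR.1 hv.1
    have h3 := degree_eq_of_hom_eq hk.isVal hf₁v.ge h2 h1 (by
      rw [← hF₁.ev hk, Ne, map_eq_zero_iff _ (hk.evKey_injective hA)]
      exact hF₁0)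
    rw [← h3] at h1 h2
    rw [hom_eq_hom_iff hk.isVal hf₁v.ge h2, ← hf₁v] at h1
    have h4 := hl.val_le_mod hk hA hg hgh (f₁ - Q' * v)
    rw [sub_modByMonic, self_mul_modByMonic hQ', sub_zero, hf₁m] at h4
    exact absurd h1 (not_lt.2 h4)

end Lifts

/-- The monic irreducible factors, other than the variable, of the initial form of `f` and their
multiplicities. -/
lemma StrictKey.exists_factors (hk : StrictKey w Q β) {A : Subring (Gr (truncVal w Q β))}
    (hA : IsLowRing w Q β A) {f : K[X]} (hf : f ≠ 0) :
    ∃ (T : Finset A[X]) (m : A[X] → ℕ),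
      (∀ g, g ∈ T ↔ g.Monic ∧ Irreducible g ∧ g ≠ X ∧ g.map A.subtype ∣ inPoly w Q β f) ∧
      (∀ g ∈ T, ∃ τ, IsHP (lowHom w Q β A) β τ g) ∧
      (∀ g ∈ T, ∀ Q', Lifts g Q' → sInf {j | j ≤ f.natDegree ∧
        truncVal w Q β (digit Q' f j * Q' ^ j) = truncVal w Q β f} = m g) ∧
      ∑ g ∈ T, g.natDegree * m g + sInf {j | j ∈ sideSet w Q β f} = topIndex w Q β f := by
  classical
  have := isDomain_gr hk.isVal
  have hH := hk.gradedField hA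
  obtain ⟨σ, hσ⟩ := hk.isVal.exists_real hf
  obtain ⟨F, hF⟩ := hk.exists_rep hA hσ.ge
  have hF0 := hF.ne_zero hk hσ
  have hFh : IsHP (lowHom w Q β A) β σ F := hk.isHP_iff.2 ⟨f, hF⟩
  have hmap := hF.map_eq_inPoly hk hσ
  obtain ⟨T, m, h1, h2, h3, h4⟩ := exists_irreducible_factors hH
    (fun σ P a b hP hP0 e => hk.isHP_of_mul hA hP hP0 e) hFh hF0
  refine ⟨T, m, fun g => ?_, h2, fun g hg Q' hl => ?_, ?_⟩
  · rw [h1]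
    refine and_congr_right fun hg => ?_
    rw [← hmap, map_dvd_map _ A.subtype_injective hg]
  · obtain ⟨hg1, hg2, -, -⟩ := (h1 g).1 hg
    obtain ⟨τ, hg3⟩ := h2 g hg
    obtain ⟨F₁, e, hnd⟩ := hl.exists_eq_pow_mul hk hA hg1 hg2 hg3 hσ hF
    exact (h3 g hg _ F₁ e hnd).symm
  · rw [← hF.natDegree_eq hk hσ]
    refine h4 _ (fun d hd => ?_) ((hF.coeff_ne_zero_iff hk hσ _).2 (exists_min_sideSet w Q β f))
    by_contra hne
    exact Nat.notMem_of_lt_sInf hd ((hF.coeff_ne_zero_iff hk hσ d).1 hne)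

end KeyPoly
end
noncomputable section
namespace KeyPoly

/-! ### Sides with a linear initial form -/

variable {K : Type*} [Field K] {Q : K[X]} {w : K[X] → WithTop ℝ} {β : ℝ}

lemma sideSet_subset_range {h : K[X]} {j : ℕ} (hj : j ∈ sideSet w Q β h) :
    j ≤ topIndex w Q β h :=
  Finset.le_sup (f := id) hj

lemma topIndex_mem (w : K[X] → WithTop ℝ) (Q : K[X]) (β : ℝ) (h : K[X]) :
    topIndex w Q β h ∈ sideSet w Q β h := by
  have hne : (sideSet w Q β h).Nonempty := ⟨_, exists_min_sideSet w Q β h⟩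
  obtain ⟨j, hj, e⟩ := Finset.exists_mem_eq_sup _ hne id
  rw [topIndex, e]; exact hj

lemma coeff_inPoly (h : K[X]) (j : ℕ) [Decidable (j ∈ sideSet w Q β h)] :
    (inPoly w Q β h).coeff j =
    if j ∈ sideSet w Q β h then inForm (truncVal w Q β) (digit Q h j) else 0 := by
  simp only [inPoly, finsetSum_coeff, coeff_C_mul_X_pow]
  split_ifs with hj
  · rw [Finset.sum_eq_single_of_mem j hj]
    · simp
    · intro b _ hb; simp [Ne.symm hb]
  · exact Finset.sum_eq_zero fun b hb => if_neg (by rintro rfl; exact hj hb)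

lemma IsVal.eq_of_inForm_eq {R : Type*} [CommRing R] {μ : R → WithTop ℝ} (hμ : IsVal μ) {a b : R}
    (h : inForm μ a = inForm μ b) (ha : a ≠ 0) : μ a = μ b := by
  have hb : b ≠ 0 := fun hb => (inForm_eq_zero_iff hμ).not.2 ha
    (h.trans ((inForm_eq_zero_iff hμ).2 hb))
  obtain ⟨r, hr⟩ := hμ.exists_real ha
  obtain ⟨s, hs⟩ := hμ.exists_real hb
  have h0 := (inForm_eq_zero_iff hμ).not.2 ha
  rw [inForm_eq_hom hr] at h h0
  rw [inForm_eq_hom hs] at h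
  rw [hr, hs, degree_eq_of_hom_eq hμ hr.ge hs.ge h h0]

lemma IsVal.lt_sub_of_inForm_eq {R : Type*} [CommRing R] {μ : R → WithTop ℝ} (hμ : IsVal μ)
    {a b : R} (h : inForm μ a = inForm μ b) (ha : a ≠ 0) : μ a < μ (a - b) := by
  have e := hμ.eq_of_inForm_eq h ha
  obtain ⟨r, hr⟩ := hμ.exists_real ha
  rw [inForm_eq_hom hr, inForm_eq_hom (e ▸ hr)] at h
  rw [hr]
  exact (hom_eq_hom_iff hμ hr.ge (e ▸ hr).ge).1 h

/-- The initial form of `h` is obtained from the initial form along the side by substituting the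
initial form of `Q`. -/
lemma IsKey.eval_inPoly (hk : IsKey w Q β) (h : K[X]) (h0 : h ≠ 0) :
    (inPoly w Q β h).eval (inForm (truncVal w Q β) Q) = inForm (truncVal w Q β) h := by
  classical
  have hμ := hk.isVal
  obtain ⟨σ, hσ⟩ := hμ.exists_real h0
  have hle : ∀ j, (σ : WithTop ℝ) ≤ truncVal w Q β (digit Q h j * Q ^ j) := fun j => by
    rw [mul_comm, hk.val_key_pow_mul, hk.val_of_degree_lt (degree_digit_lt hk.monic h j), ← hσ]
    exact truncVal_le hk.monic hk.natDegree_pos hk.map_zero h j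
  have e := sum_digit hk.monic hk.natDegree_pos (Nat.lt_succ_self h.natDegree)
  conv_rhs => rw [inForm_eq_hom hσ, ← e, hom_sum hμ _ fun j _ => hle j]
  rw [inPoly, eval_finsetSum]
  simp only [eval_mul, eval_C, eval_pow, eval_X]
  symm
  rw [sideSet, Finset.sum_filter]
  refine Finset.sum_congr rfl fun j _ => ?_
  have hv : truncVal w Q β (digit Q h j * Q ^ j) =
      w (digit Q h j) + ((j * β : ℝ) : WithTop ℝ) := by
    rw [mul_comm, hk.val_key_pow_mul, hk.val_of_degree_lt (degree_digit_lt hk.monic h j)]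
  split_ifs with hj
  · rw [← inForm_pow hμ, ← inForm_mul hμ]
    exact (inForm_eq_hom (by rw [hv, hj, hσ])).symm
  · rw [hom_eq_zero_iff hμ (hle j)]
    refine lt_of_le_of_ne (hle j) fun h' => hj ?_
    rw [← hv, ← h', hσ]

lemma StrictKey.digit_topIndex_ne_zero (hk : StrictKey w Q β) {f : K[X]} (hf : f ≠ 0) {δ : ℕ}
    (hδ : topIndex w Q β f = δ) : digit Q f δ ≠ 0 := by
  intro h0
  have h := (mem_sideSet_iff.1 (topIndex_mem w Q β f)).2
  rw [hδ, h0, hk.map_zero, top_add] at h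
  exact hk.val_ne_top f hf h.symm

section LinearPower

variable {f z : K[X]} {δ : ℕ} (hk : StrictKey w Q β) (hf : f ≠ 0)
  (hl : IsLinearPower w f Q β δ z)
include hk hf hl

/-- If the initial form of `z` were 0, the side would contain the point at height `δ` only. So the
constant term of the power is nonzero, the side reaches height 0, and comparing its points at
heights 0 and `δ` gives the value of `z`. -/
lemma IsLinearPower.val_eq_and_mem (hs : IsCharSide w f Q β δ) :
    w z = β ∧ 0 ∈ sideSet w Q β f := by
  classical
  have hμ := hk.isVal
  have := isDomain_gr hμ
  have ha := hk.digit_topIndex_ne_zero hf hs.2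
  have hz : inForm (truncVal w Q β) z ≠ 0 := by
    intro h0
    have e := hl.2
    rw [h0, C_0, add_zero] at e
    obtain ⟨j, hj, hne⟩ := (sideSet w Q β f).exists_mem_ne hs.1 δ
    have e1 := congrArg (fun P => coeff P j) e
    simp only [coeff_inPoly, if_pos hj, coeff_C_mul, coeff_X_pow, if_neg hne, mul_zero] at e1
    rw [inForm_eq_zero_iff hμ] at e1
    have h := (mem_sideSet_iff.1 hj).2
    rw [e1, hk.map_zero, top_add] at h
    exact hk.val_ne_top f hf h.symm
  have hz0 : z ≠ 0 := (inForm_eq_zero_iff hμ).not.1 hz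
  have e0 : (inPoly w Q β f).coeff 0 =
      inForm (truncVal w Q β) (digit Q f δ) * inForm (truncVal w Q β) z ^ δ := by
    rw [hl.2]; simp [coeff_zero_eq_eval_zero]
  rw [coeff_inPoly] at e0
  have hne : inForm (truncVal w Q β) (digit Q f δ) * inForm (truncVal w Q β) z ^ δ ≠ 0 :=
    mul_ne_zero ((inForm_eq_zero_iff hμ).not.2 ha) (pow_ne_zero _ hz)
  have h0 : 0 ∈ sideSet w Q β f := by
    by_contra h; rw [if_neg h] at e0; exact hne e0.symm
  rw [if_pos h0, ← inForm_pow hμ, ← inForm_mul hμ] at e0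
  have hd0 : digit Q f 0 ≠ 0 := fun h => by
    have := (mem_sideSet_iff.1 h0).2
    rw [h, hk.map_zero, top_add] at this
    exact hk.val_ne_top f hf this.symm
  have e1 := hμ.eq_of_inForm_eq e0 hd0
  rw [hμ.map_mul, hμ.map_pow, hk.val_of_degree_lt (degree_digit_lt hk.monic f 0),
    hk.val_of_degree_lt (degree_digit_lt hk.monic f δ), hk.val_of_degree_lt hl.1] at e1
  have e2 := (mem_sideSet_iff.1 h0).2.trans (mem_sideSet_iff.1 (topIndex_mem w Q β f)).2.symm
  rw [hs.2] at e2
  have hδ0 : 0 < δ := by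
    obtain ⟨j, hj, hne⟩ := (sideSet w Q β f).exists_mem_ne hs.1 δ
    have := sideSet_subset_range hj
    rw [hs.2] at this; omega
  rw [e1] at e2
  refine ⟨?_, h0⟩
  have h1 := hk.ne_top _ hz0 hl.1
  have h2 := hk.ne_top _ ha (degree_digit_lt hk.monic f δ)
  lift w z to ℝ using h1 with r
  lift w (digit Q f δ) to ℝ using h2 with s
  norm_cast at e2 ⊢
  simp only [nsmul_eq_mul, zero_mul, add_zero] at e2
  have : (δ : ℝ) * r = δ * β := by linarith
  exact mul_left_cancel₀ (Nat.cast_ne_zero.2 hδ0.ne') this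

/-- The value of the correction equals the value of the key polynomial. -/
lemma IsLinearPower.val_eq (hs : IsCharSide w f Q β δ) : w z = β :=
  (IsLinearPower.val_eq_and_mem hk hf hl hs).1

omit hf in
lemma IsLinearPower.monic : (Q + z).Monic := by
  rw [add_comm]; exact hk.monic.add_of_right hl.1

/-- After the correction the side determined by `β` is the point at height `δ`. -/
lemma IsLinearPower.lt_digit (hs : IsCharSide w f Q β δ) :
    w (digit (Q + z) f δ) = w (digit Q f δ) ∧ ∀ j ≠ δ,
      w (digit (Q + z) f δ) + ((δ * β : ℝ) : WithTop ℝ) <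
        w (digit (Q + z) f j) + ((j * β : ℝ) : WithTop ℝ) := by
  have hμ := hk.isVal
  have hz := IsLinearPower.val_eq hk hf hl hs
  have ha := hk.digit_topIndex_ne_zero hf hs.2
  have hm := IsLinearPower.monic hk hl
  have hdeg : (Q + z - Q).degree < Q.degree := by simpa using hl.1
  have hk' : StrictKey w (Q + z) β := hk.shift hm hdeg (by simp [hz])
  have hv : truncVal w (Q + z) β = truncVal w Q β := hk.truncVal_shift_eq hm hdeg (by simp [hz])
  have hdQ : (Q + z).degree = Q.degree := degree_add_eq_left_of_degree_lt hl.1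
  have hzμ : truncVal w Q β z = β := by rw [hk.val_of_degree_lt hl.1, hz]
  have hQz : truncVal w Q β (Q + z) = β := by rw [← hv]; exact hk'.val_key
  -- Initial forms of equal degree add, so the hypothesis says that `f` and `digit Q f δ * (Q + z) ^
  -- δ` have the same initial form. Since `Q + z` with value `β` defines the same valuation, the
  -- larger value of their difference can be read off from the digits with respect to `Q + z`.
  have e1 : inForm (truncVal w Q β) (Q + z) =
      inForm (truncVal w Q β) Q + inForm (truncVal w Q β) z := by
    rw [inForm_eq_hom hQz, inForm_eq_hom hk.val_key, inForm_eq_hom hzμ,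
      hom_add hμ hk.val_key.ge hzμ.ge]
  have e2 := hk.eval_inPoly f hf
  rw [hl.2] at e2
  simp only [eval_mul, eval_C, eval_pow, eval_add, eval_X] at e2
  rw [← e1, ← inForm_pow hμ, ← inForm_mul hμ] at e2
  have hlt := hμ.lt_sub_of_inForm_eq e2.symm hf
  have hfv : truncVal w Q β f = w (digit Q f δ) + ((δ * β : ℝ) : WithTop ℝ) := by
    rw [← hs.2]; exact (mem_sideSet_iff.1 (topIndex_mem w Q β f)).2.symm
  rw [← hv] at hlt
  obtain ⟨a, haδ⟩ : ∃ a : ℝ, w (digit Q f δ) = a :=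
    ⟨_, (WithTop.coe_untop _ (hk.ne_top _ ha (degree_digit_lt hk.monic f δ))).symm⟩
  have hlt2 : ((a + δ * β : ℝ) : WithTop ℝ) <
      truncVal w (Q + z) β (f - digit Q f δ * (Q + z) ^ δ) := by
    refine lt_of_eq_of_lt ?_ hlt
    rw [hv, hfv, haδ]; rfl
  have hda : (digit Q f δ).degree < (Q + z).degree := by
    rw [hdQ]; exact degree_digit_lt hk.monic f δ
  have key : ∀ j : ℕ, ((a + δ * β - j * β : ℝ) : WithTop ℝ) <
      w (digit (Q + z) f j - if j = δ then digit Q f δ else 0) := fun j => by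
    have h := hk'.toIsKey.lt_digit hlt2 j
    have e : digit (Q + z) (f - digit Q f δ * (Q + z) ^ δ) j =
        digit (Q + z) f j - if j = δ then digit Q f δ else 0 := by
      rw [← digit_mul_pow hm hk'.degree_pos hda δ j, eq_sub_iff_add_eq, ← digit_add hm]
      simp
    rwa [e] at h
  have hδv : w (digit (Q + z) f δ) = w (digit Q f δ) := by
    have h := key δ
    rw [if_pos rfl] at h
    have hd1 := degree_digit_lt hm f δ
    rw [← hk'.val_of_degree_lt hd1, ← hk'.val_of_degree_lt hda]
    refine hk'.isVal.eq_of_lt_sub ?_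
    rw [hk'.val_of_degree_lt hda, hk'.val_of_degree_lt ((degree_sub_le _ _).trans_lt
      (max_lt hd1 hda)), haδ]
    convert h using 2; ring
  refine ⟨hδv, fun j hj => ?_⟩
  have h := key j
  rw [if_neg hj, sub_zero] at h
  rw [hδv, haδ]
  cases hx : w (digit (Q + z) f j) with
  | top => simp only [top_add]; exact_mod_cast WithTop.coe_lt_top _
  | coe r =>
    rw [hx] at h
    norm_cast at h ⊢
    linarith

/-- For `β` the point at height `δ` is the only minimal one; a side joining it to a lower point `j <
δ` must therefore belong to a larger number. -/
lemma IsLinearPower.lt_of_isCharSide (hs : IsCharSide w f Q β δ) {β' : ℝ}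
    (hs' : IsCharSide w f (Q + z) β' δ) : β < β' := by
  obtain ⟨j, hj, hne⟩ := (sideSet w (Q + z) β' f).exists_mem_ne hs'.1 δ
  have hle := sideSet_subset_range hj
  rw [hs'.2] at hle
  have e := (mem_sideSet_iff.1 hj).2.trans (mem_sideSet_iff.1 (topIndex_mem w (Q + z) β' f)).2.symm
  rw [hs'.2] at e
  have h := IsLinearPower.lt_digit hk hf hl hs
  have h1 := h.2 j hne
  have ha := hk.ne_top _ (hk.digit_topIndex_ne_zero hf hs.2) (degree_digit_lt hk.monic f δ)
  rw [← h.1] at ha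
  lift w (digit (Q + z) f δ) to ℝ using ha with a
  cases hx : w (digit (Q + z) f j) with
  | top => rw [hx, top_add] at e; exact absurd e.symm WithTop.coe_ne_top
  | coe r =>
    rw [hx] at e h1
    norm_cast at e h1
    have hlt : (j : ℝ) < δ := by exact_mod_cast lt_of_le_of_ne hle hne
    by_contra hb
    push Not at hb
    nlinarith

end LinearPower

end KeyPoly
end
noncomputable section
namespace KeyPoly

/-! ### Sequences of key polynomials of the same degree -/

variable {K : Type*} [Field K] {w : K[X] → WithTop ℝ} {Qs : ℕ → K[X]} {βs : ℕ → ℝ}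

/-- A sequence of key polynomials of the same degree with strictly increasing values, each term being
obtained from the preceding one by a correction of the same value. -/
structure KeySeq (w : K[X] → WithTop ℝ) (Qs : ℕ → K[X]) (βs : ℕ → ℝ) : Prop where
  key_zero : StrictKey w (Qs 0) (βs 0)
  degree_lt : ∀ t, (Qs (t + 1) - Qs t).degree < (Qs 0).degree
  val_sub_succ : ∀ t, w (Qs (t + 1) - Qs t) = βs t
  strictMono : StrictMono βs

/-- The valuation attached to the `t`-th term of the sequence. -/
abbrev seqVal (w : K[X] → WithTop ℝ) (Qs : ℕ → K[X]) (βs : ℕ → ℝ) (t : ℕ) : K[X] → WithTop ℝ :=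
  truncVal w (Qs t) (βs t)

namespace KeySeq

variable (hs : KeySeq w Qs βs)
include hs

lemma degree_sub_zero (t : ℕ) : (Qs t - Qs 0).degree < (Qs 0).degree := by
  induction t with
  | zero => rw [sub_self]; exact hs.key_zero.degree_zero_lt
  | succ t ih =>
    rw [show Qs (t + 1) - Qs 0 = (Qs (t + 1) - Qs t) + (Qs t - Qs 0) by ring]
    exact (degree_add_le _ _).trans_lt (max_lt (hs.degree_lt t) ih)

lemma degree_eq (t : ℕ) : (Qs t).degree = (Qs 0).degree := by
  have := degree_add_eq_left_of_degree_lt (hs.degree_sub_zero t)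
  rwa [add_sub_cancel] at this

lemma natDegree_eq (t : ℕ) : (Qs t).natDegree = (Qs 0).natDegree :=
  natDegree_eq_of_degree_eq (hs.degree_eq t)

lemma monic (t : ℕ) : (Qs t).Monic := by
  have := hs.key_zero.monic.add_of_right (hs.degree_sub_zero t)
  rwa [sub_add_cancel] at this

lemma degree_sub (s t : ℕ) : (Qs s - Qs t).degree < (Qs 0).degree := by
  rw [show Qs s - Qs t = (Qs s - Qs 0) - (Qs t - Qs 0) by ring]
  exact (degree_sub_le _ _).trans_lt (max_lt (hs.degree_sub_zero s) (hs.degree_sub_zero t))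

lemma val_of_lt (t : ℕ) {c : K[X]} (hc : c.degree < (Qs 0).degree) : seqVal w Qs βs t c = w c :=
  truncVal_of_degree_lt (hs.monic t) (by rw [hs.natDegree_eq]; exact hs.key_zero.natDegree_pos)
    hs.key_zero.map_zero (by rwa [hs.degree_eq])

lemma val_sub {s t : ℕ} (h : t < s) : w (Qs s - Qs t) = βs t := by
  induction s with
  | zero => omega
  | succ s ih =>
    rcases Nat.lt_succ_iff_lt_or_eq.1 h with h' | rfl
    · have hμ : IsVal (seqVal w Qs βs 0) := hs.key_zero.isVal
      have e1 := (hs.val_of_lt 0 (hs.degree_sub s t)).trans (ih h')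
      have e2 := (hs.val_of_lt 0 (hs.degree_sub (s + 1) s)).trans (hs.val_sub_succ s)
      have hlt : (βs t : WithTop ℝ) < βs s := WithTop.coe_lt_coe.2 (hs.strictMono h')
      have e3 := hμ.map_add_eq (e1.trans_lt (hlt.trans_eq e2.symm))
      rw [sub_add_sub_cancel', hs.val_of_lt 0 (hs.degree_sub _ _)] at e3
      exact e3.trans e1
    · exact hs.val_sub_succ _

lemma le_val_sub {s t : ℕ} (h : t ≤ s) : (βs t : WithTop ℝ) ≤ w (Qs s - Qs t) := by
  rcases h.lt_or_eq with h | rfl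
  · exact (hs.val_sub h).ge
  · rw [sub_self, hs.key_zero.map_zero]; exact le_top

lemma key (t : ℕ) : StrictKey w (Qs t) (βs t) := by
  induction t with
  | zero => exact hs.key_zero
  | succ t ih =>
    exact (ih.shift (hs.monic _) (by rw [hs.degree_eq t]; exact hs.degree_lt t)
      (hs.val_sub_succ t).ge).strictKey (hs.strictMono (Nat.lt_succ_self t))

lemma key_of_le {s t : ℕ} (h : t ≤ s) : StrictKey w (Qs s) (βs t) :=
  (hs.key t).shift (hs.monic s) (by rw [hs.degree_eq t]; exact hs.degree_sub s t) (hs.le_val_sub h)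

/-- An earlier valuation can be computed with a later key polynomial. Thus the valuations of index
`t ≤ s` are compared on a single expansion, in which only the slope changes. -/
lemma truncVal_eq {s t : ℕ} (h : t ≤ s) : truncVal w (Qs s) (βs t) = seqVal w Qs βs t :=
  (hs.key t).truncVal_shift_eq (hs.monic s) (by rw [hs.degree_eq t]; exact hs.degree_sub s t)
    (hs.le_val_sub h)

lemma isVal (t : ℕ) : IsVal (seqVal w Qs βs t) := (hs.key t).isVal

lemma natDegree_pos (t : ℕ) : 0 < (Qs t).natDegree := (hs.key t).natDegree_pos

lemma mono (h : K[X]) : Monotone fun t => seqVal w Qs βs t h := fun t s hts => by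
  change seqVal w Qs βs t h ≤ _
  rw [← hs.truncVal_eq hts]
  exact truncVal_mono (hs.monic s) (hs.natDegree_pos s) hs.key_zero.map_zero
    (hs.strictMono.monotone hts) h

/-- The values of `h` grow at most as fast as the values of the `(deg h / deg Q)`-th power of the
key polynomials. -/
lemma val_le_add {h : K[X]} {D : ℕ} (hD : h.natDegree ≤ D * (Qs 0).natDegree) {s t : ℕ}
    (hts : t ≤ s) :
    seqVal w Qs βs s h ≤ seqVal w Qs βs t h + ((D * (βs s - βs t) : ℝ) : WithTop ℝ) := by
  rw [← hs.truncVal_eq hts]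
  obtain ⟨j, -, e⟩ := exists_truncVal_eq w (Qs s) (βs t) h
  rw [e]
  have h1 := truncVal_le (β := βs s) (hs.monic s) (hs.natDegree_pos s) hs.key_zero.map_zero h j
  refine h1.trans ?_
  by_cases hj : D < j
  · rw [digit_eq_zero (hs.monic s), hs.key_zero.map_zero]
    · simp
    · rw [hs.natDegree_eq]
      exact hD.trans_lt ((Nat.mul_lt_mul_right hs.key_zero.natDegree_pos).2 hj)
  · rw [add_assoc, ← WithTop.coe_add]
    refine add_le_add_right (WithTop.coe_le_coe.2 ?_) _
    have hβ := hs.strictMono.monotone hts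
    have : (j : ℝ) ≤ D := by exact_mod_cast not_lt.1 hj
    nlinarith

/-- If the value of `h` does not grow then it is the value of the remainder of `h`. -/
lemma val_mod_of_eq {h : K[X]} {s t : ℕ} (hts : t < s)
    (he : seqVal w Qs βs s h = seqVal w Qs βs t h) : w (h %ₘ Qs s) = seqVal w Qs βs s h := by
  by_cases h0 : h = 0
  · rw [h0, zero_modByMonic, hs.key_zero.map_zero, (hs.isVal s).map_zero]
  obtain ⟨j, -, e⟩ := exists_truncVal_eq w (Qs s) (βs s) h
  rcases Nat.eq_zero_or_pos j with rfl | hj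
  · rw [seqVal, e, digit_zero]; simp
  -- A minimum attained at an index `j > 0` would force the value to rise by at least `j * (βs s -
  -- βs t)` from `t` to `s`.
  · exfalso
    have h1 := truncVal_le (β := βs t) (hs.monic s) (hs.natDegree_pos s) hs.key_zero.map_zero h j
    rw [hs.truncVal_eq hts.le, ← he, seqVal, e] at h1
    have hne := (hs.isVal s).ne_top h h0
    rw [seqVal, e] at hne
    have hw : w (digit (Qs s) h j) ≠ ⊤ := fun hw => hne (by rw [hw, top_add])
    lift w (digit (Qs s) h j) to ℝ using hw with r
    norm_cast at h1
    have := hs.strictMono hts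
    have hj' : (0 : ℝ) < j := by exact_mod_cast hj
    nlinarith

/-- Reduction modulo the key polynomials of a product of polynomials of small degree changes only
terms of larger value. -/
lemma gap_low {G : K[X]} {γ : ℝ} (hG : (γ : WithTop ℝ) ≤ seqVal w Qs βs 0 G) (t : ℕ) :
    ((γ + (βs t - βs 0) : ℝ) : WithTop ℝ) ≤ seqVal w Qs βs t (G - G %ₘ Qs t) := by
  have e : G - G %ₘ Qs t = Qs t * (G /ₘ Qs t) := by
    conv_lhs => rw [← modByMonic_add_div G (Qs t)]
    rw [add_modByMonic, (modByMonic_eq_self_iff (hs.monic t)).2 (degree_modByMonic_lt _ (hs.monic t)),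
      (modByMonic_eq_zero_iff_dvd (hs.monic t)).2 (dvd_mul_right _ _)]
    ring
  rw [e, seqVal, (hs.key t).val_key_mul]
  have h1 := (hs.key_of_le (Nat.zero_le t)).val_le_div G
  rw [hs.truncVal_eq (Nat.zero_le t)] at h1
  have h2 := hG.trans h1
  have h3 : seqVal w Qs βs 0 (G /ₘ Qs t) ≤ seqVal w Qs βs t (G /ₘ Qs t) :=
    hs.mono _ (Nat.zero_le t)
  rw [withTop_le_add_iff, ← WithTop.coe_add] at h2 ⊢
  refine le_trans (le_trans (WithTop.coe_le_coe.2 ?_) h2) h3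
  linarith

end KeySeq

/-- The values of `h` for the valuations attached to the sequence are eventually constant. -/
def Stable (w : K[X] → WithTop ℝ) (Qs : ℕ → K[X]) (βs : ℕ → ℝ) (h : K[X]) : Prop :=
  ∃ T, ∀ t ≥ T, seqVal w Qs βs t h = seqVal w Qs βs T h

lemma KeySeq.exists_lt_of_not_stable (hs : KeySeq w Qs βs) {h : K[X]} (hh : ¬ Stable w Qs βs h)
    (t : ℕ) : ∃ s > t, seqVal w Qs βs t h < seqVal w Qs βs s h := by
  by_contra! H
  refine hh ⟨t, fun s hts => ?_⟩
  rcases hts.lt_or_eq with h' | rfl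
  · exact le_antisymm (H s h') (hs.mono h hts)
  · rfl

end KeyPoly
end
noncomputable section
namespace KeyPoly

/-! ### Taylor expansions with respect to the key polynomials of a sequence -/

namespace IsVal

variable {R : Type*} [CommRing R] {μ : R → WithTop ℝ} (hμ : IsVal μ)
include hμ

lemma coe_le_mul {a b : ℝ} {x y : R} (hx : (a : WithTop ℝ) ≤ μ x) (hy : (b : WithTop ℝ) ≤ μ y) :
    ((a + b : ℝ) : WithTop ℝ) ≤ μ (x * y) := by
  rw [hμ.map_mul, WithTop.coe_add]; exact add_le_add hx hy

lemma coe_le_pow {b : ℝ} {y : R} (hy : (b : WithTop ℝ) ≤ μ y) (n : ℕ) :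
    ((n * b : ℝ) : WithTop ℝ) ≤ μ (y ^ n) :=
  (hom_pow hμ hy n).2

lemma natCast_nonneg (n : ℕ) : 0 ≤ μ (n : R) := by
  induction n with
  | zero => rw [Nat.cast_zero, hμ.map_zero]; exact le_top
  | succ n ih => rw [Nat.cast_succ]; exact hμ.le_add ih hμ.map_one.ge

lemma le_natCast_mul (n : ℕ) (x : R) : μ x ≤ μ (n * x) := by
  rw [hμ.map_mul]
  calc μ x = 0 + μ x := (zero_add _).symm
    _ ≤ _ := add_le_add_left (hμ.natCast_nonneg n) _

lemma eq_zero_of_pow_eq_one {x : R} {n : ℕ} (hn : n ≠ 0) (h : x ^ n = 1) : μ x = 0 := by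
  have h1 := hμ.map_pow x n
  rw [h, hμ.map_one] at h1
  cases hx : μ x with
  | top =>
    obtain ⟨m, rfl⟩ := Nat.exists_eq_succ_of_ne_zero hn
    rw [hx, succ_nsmul, add_top] at h1; exact absurd h1 WithTop.zero_ne_top
  | coe r =>
    rw [hx] at h1
    norm_cast at h1 ⊢
    simpa [hn] using h1.symm

end IsVal

/-- In characteristic `p` the polynomial `(1 + X) ^ (p ^ a * r)` is `(1 + X ^ p ^ a) ^ r`, whose
coefficient at `X ^ p ^ a` is `r`. -/
lemma choose_pow_ne_zero (K : Type*) [Field K] (p : ℕ) [Fact p.Prime] [CharP K p] (a : ℕ) {r : ℕ}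
    (hr : ¬ p ∣ r) : (((p ^ a * r).choose (p ^ a) : ℕ) : K) ≠ 0 := by
  have e : (1 + X : K[X]) ^ (p ^ a * r) = expand K (p ^ a) ((1 + X) ^ r) := by
    rw [pow_mul, add_pow_char_pow, one_pow, map_pow, map_add, map_one, expand_X]
  have h : ((1 + X : K[X]) ^ (p ^ a * r)).coeff (1 * p ^ a) = ((1 + X : K[X]) ^ r).coeff 1 := by
    rw [e, coeff_expand_mul (pow_pos (Fact.out (p := p.Prime)).pos a)]
  rw [one_mul] at h
  rw [coeff_one_add_X_pow, coeff_one_add_X_pow, Nat.choose_one_right] at h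
  rw [h]
  exact (CharP.cast_eq_zero_iff K p r).not.2 hr

variable {K : Type*} [Field K] {w : K[X] → WithTop ℝ} {Qs : ℕ → K[X]} {βs : ℕ → ℝ}

/-- Up to terms of larger value, the expansion of `F(Q_i)` with respect to a later key polynomial is
obtained by reducing the Taylor coefficients of `F`. -/
lemma KeySeq.taylor (hs : KeySeq w Qs βs) {i : ℕ} {F : K[X][X]} {σ : ℝ}
    (hF : ∀ j, (F.coeff j).degree < (Qs 0).degree)
    (hσ : ∀ j : ℕ, ((σ - j * βs i : ℝ) : WithTop ℝ) ≤ w (F.coeff j)) {t : ℕ} (hit : i < t) {N : ℕ}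
    (hN : F.natDegree < N) :
    ((σ + (βs t - βs 0) : ℝ) : WithTop ℝ) ≤ seqVal w Qs βs t (F.eval (Qs i) -
      ∑ m ∈ Finset.range N, ((hasseDeriv m F).eval (Qs i) %ₘ Qs t) * Qs t ^ m) := by
  have hμ := hs.isVal t
  set y := Qs i - Qs t with hy
  have e1 : F.eval (Qs i) = ∑ m ∈ Finset.range N, (hasseDeriv m F).eval y * Qs t ^ m := by
    have h := taylor_eval y F (Qs t)
    rw [eval_eq_sum_range' (n := N) (by rwa [natDegree_taylor])] at h
    simp only [taylor_coeff] at h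
    rw [h, hy, add_sub_cancel]
  rw [e1, ← Finset.sum_sub_distrib]
  refine hμ.le_sum fun m _ => ?_
  -- `Qs i` and `y` are congruent modulo `Qs t`. The polynomial `y` has low degree and value `βs i`,
  -- so `gap_low` applies to the value of the Hasse derivative at `y`, estimated term by term.
  have e2 : (hasseDeriv m F).eval (Qs i) %ₘ Qs t = (hasseDeriv m F).eval y %ₘ Qs t := by
    rw [← sub_eq_zero, ← sub_modByMonic, modByMonic_eq_zero_iff_dvd (hs.monic t)]
    have := sub_dvd_eval_sub (Qs i) y (hasseDeriv m F)
    rwa [hy, sub_sub_cancel] at this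
  rw [e2, ← sub_mul]
  have hμ0 := hs.isVal 0
  have hyv : (βs i : WithTop ℝ) ≤ seqVal w Qs βs 0 y := by
    rw [hμ0.map_sub_swap, hs.val_of_lt 0 (hs.degree_sub _ _), hs.val_sub hit]
  have h0 : ((σ - m * βs i : ℝ) : WithTop ℝ) ≤ seqVal w Qs βs 0 ((hasseDeriv m F).eval y) := by
    rw [eval_eq_sum_range]
    refine hμ0.le_sum fun k _ => ?_
    rw [hasseDeriv_coeff, mul_assoc]
    refine le_trans ?_ (hμ0.le_natCast_mul _ _)
    refine le_trans (WithTop.coe_le_coe.2 ?_) (hμ0.coe_le_mul (b := k * βs i)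
      ((hσ (k + m)).trans_eq (hs.val_of_lt 0 (hF _)).symm) (hμ0.coe_le_pow hyv k))
    push_cast; linarith
  refine le_trans (WithTop.coe_le_coe.2 ?_) (hμ.coe_le_mul (b := m * βs t) (hs.gap_low h0 t)
    (hμ.coe_le_pow (hs.key t).val_key.ge m))
  have := hs.strictMono hit
  have hm : (0 : ℝ) ≤ m := Nat.cast_nonneg m
  nlinarith

end KeyPoly
end
noncomputable section
namespace KeyPoly

/-! ### Unstable polynomials of least degree -/

variable {K : Type*} [Field K] {w : K[X] → WithTop ℝ} {Qs : ℕ → K[X]} {βs : ℕ → ℝ}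

/-- The polynomial in `Y` over `K[X]` whose coefficients are the coefficients of the `Q`-expansion
of `h`. -/
def expansion (Q h : K[X]) : K[X][X] :=
  ∑ j ∈ Finset.range (h.natDegree + 1), monomial j (digit Q h j)

lemma coeff_expansion {Q : K[X]} (hQ : Q.Monic) (hQ0 : 0 < Q.natDegree) (h : K[X]) (j : ℕ) :
    (expansion Q h).coeff j = digit Q h j := by
  rw [expansion, finsetSum_coeff]
  simp only [coeff_monomial]
  rw [Finset.sum_ite_eq']
  split_ifs with hj
  · rfl
  · exact (digit_eq_zero' hQ hQ0 (by simpa using hj)).symm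

lemma eval_expansion {Q : K[X]} (hQ : Q.Monic) (hQ0 : 0 < Q.natDegree) (h : K[X]) :
    (expansion Q h).eval Q = h := by
  rw [expansion, eval_finsetSum]
  simp only [eval_monomial]
  exact sum_digit hQ hQ0 (Nat.lt_succ_self _)

lemma natDegree_expansion_le {Q : K[X]} (hQ : Q.Monic) (hQ0 : 0 < Q.natDegree) (h : K[X]) :
    (expansion Q h).natDegree * Q.natDegree ≤ h.natDegree := by
  by_contra! hlt
  have hne : expansion Q h ≠ 0 := fun h0 => by simp [h0] at hlt
  apply leadingCoeff_ne_zero.2 hne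
  rw [leadingCoeff, coeff_expansion hQ hQ0, digit_eq_zero hQ hlt]

/-- The `m`-th Taylor coefficient of `h` as a polynomial in `Q`. -/
def taylorCoeff (Q h : K[X]) (m : ℕ) : K[X] := (hasseDeriv m (expansion Q h)).eval Q

lemma taylorCoeff_zero {Q : K[X]} (hQ : Q.Monic) (hQ0 : 0 < Q.natDegree) (h : K[X]) :
    taylorCoeff Q h 0 = h := by
  rw [taylorCoeff, hasseDeriv_zero', eval_expansion hQ hQ0]

lemma degree_taylorCoeff_lt {Q : K[X]} (hQ : Q.Monic) (hQ0 : 0 < Q.natDegree) {h : K[X]}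
    (h0 : h ≠ 0) {m : ℕ} (hm : 1 ≤ m) : (taylorCoeff Q h m).degree < h.degree := by
  have hQ0' := natDegree_pos_iff_degree_pos.1 hQ0
  rw [taylorCoeff, eval_eq_sum_range]
  refine (degree_sum_le _ _).trans_lt ((Finset.sup_lt_iff (bot_lt_iff_ne_bot.2
    (degree_ne_bot.2 h0))).2 fun k _ => ?_)
  rw [hasseDeriv_coeff, coeff_expansion hQ hQ0]
  by_cases hd : digit Q h (k + m) = 0
  · rw [hd]; simpa using bot_lt_iff_ne_bot.2 (degree_ne_bot.2 h0)
  have h1 : (k + m) * Q.natDegree ≤ h.natDegree := not_lt.1 fun hlt => hd (digit_eq_zero hQ hlt)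
  refine degree_lt_degree ?_
  have h2 : (digit Q h (k + m)).natDegree < Q.natDegree :=
    natDegree_lt_natDegree hd (degree_digit_lt hQ h _)
  calc _ ≤ 0 + (digit Q h (k + m)).natDegree + k * Q.natDegree := by
        refine natDegree_mul_le.trans (add_le_add (natDegree_mul_le.trans
          (add_le_add (natDegree_natCast _).le le_rfl)) (hQ.natDegree_pow k).le)
    _ < (k + 1) * Q.natDegree := by rw [add_mul]; omega
    _ ≤ (k + m) * Q.natDegree := Nat.mul_le_mul_right _ (by omega)
    _ ≤ _ := h1

/-- A polynomial `h` whose values do not become stable, with the Taylor coefficients of positive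
order having stable values from the index `T` on. -/
structure UnstableData (w : K[X] → WithTop ℝ) (Qs : ℕ → K[X]) (βs : ℕ → ℝ) (B : ℝ) (h : K[X])
    (i : ℕ) (σ : ℝ) (T : ℕ) : Prop where
  seq : KeySeq w Qs βs
  tendsto : Filter.Tendsto βs Filter.atTop (nhds B)
  ne_zero : h ≠ 0
  not_stable : ¬ Stable w Qs βs h
  val_eq : seqVal w Qs βs i h = σ
  -- From `i` on the value of `h` grows by less than `βs 1 - βs 0`, whereas the error of every
  -- Taylor expansion used exceeds `σ` by at least that amount. The errors therefore never affect
  -- the value of `h`.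
  lt_eps : h.natDegree * (B - βs i) < βs 1 - βs 0
  lt_T : i < T
  one_le_T : 1 ≤ T
  stable : ∀ m, 1 ≤ m → m ≤ h.natDegree → ∀ t ≥ T,
    seqVal w Qs βs t (taylorCoeff (Qs i) h m) = seqVal w Qs βs T (taylorCoeff (Qs i) h m)

lemma KeySeq.lt_of_tendsto (hs : KeySeq w Qs βs) {B : ℝ}
    (hB : Filter.Tendsto βs Filter.atTop (nhds B)) (t : ℕ) : βs t < B :=
  (hs.strictMono (Nat.lt_succ_self t)).trans_le (hs.strictMono.monotone.ge_of_tendsto hB _)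

/-- Every unstable polynomial of least degree gives rise to such data. -/
lemma KeySeq.exists_unstableData (hs : KeySeq w Qs βs) {B : ℝ}
    (hB : Filter.Tendsto βs Filter.atTop (nhds B)) {h : K[X]} (h0 : h ≠ 0)
    (hh : ¬ Stable w Qs βs h)
    (hmin : ∀ h' : K[X], h' ≠ 0 → h'.degree < h.degree → Stable w Qs βs h') :
    ∃ i σ T, UnstableData w Qs βs B h i σ T := by
  have h1 : Filter.Tendsto (fun t => h.natDegree * (B - βs t)) Filter.atTop (nhds 0) := by
    have := (hB.const_sub B).const_mul (h.natDegree : ℝ)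
    simpa using this
  have hε : 0 < βs 1 - βs 0 := sub_pos.2 (hs.strictMono Nat.zero_lt_one)
  obtain ⟨i, hi⟩ := (h1.eventually (gt_mem_nhds hε)).exists
  obtain ⟨σ, hσ⟩ := (hs.isVal i).exists_real h0
  have hst : ∀ m, ∃ T, 1 ≤ m → ∀ t ≥ T,
      seqVal w Qs βs t (taylorCoeff (Qs i) h m) = seqVal w Qs βs T (taylorCoeff (Qs i) h m) := by
    intro m
    by_cases hm : 1 ≤ m
    · by_cases hz : taylorCoeff (Qs i) h m = 0
      · exact ⟨0, fun _ t _ => by rw [hz, (hs.isVal t).map_zero, (hs.isVal 0).map_zero]⟩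
      · obtain ⟨T, hT⟩ := hmin _ hz (degree_taylorCoeff_lt (hs.monic i) (hs.natDegree_pos i) h0 hm)
        exact ⟨T, fun _ => hT⟩
    · exact ⟨0, fun h => absurd h hm⟩
  choose T hT using hst
  refine ⟨i, σ, (i + 1) + (Finset.range (h.natDegree + 1)).sup T,
    ⟨hs, hB, h0, hh, hσ, hi, by omega, by omega, fun m hm hmN t ht => ?_⟩⟩
  have hle : T m ≤ (Finset.range (h.natDegree + 1)).sup T :=
    Finset.le_sup (f := T) (by simpa [Nat.lt_succ_iff] using hmN)
  rw [hT m hm t (by omega), hT m hm ((i + 1) + (Finset.range (h.natDegree + 1)).sup T) (by omega)]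

namespace UnstableData

variable {B σ : ℝ} {h : K[X]} {i T : ℕ} (hd : UnstableData w Qs βs B h i σ T)
include hd

lemma lt_B (t : ℕ) : βs t < B := hd.seq.lt_of_tendsto hd.tendsto t

lemma val_le {t : ℕ} (ht : i ≤ t) :
    seqVal w Qs βs t h ≤ ((σ + h.natDegree * (B - βs i) : ℝ) : WithTop ℝ) := by
  have h1 := hd.seq.val_le_add (D := h.natDegree)
    (Nat.le_mul_of_pos_right _ hd.seq.key_zero.natDegree_pos) ht
  rw [hd.val_eq, ← WithTop.coe_add] at h1
  refine h1.trans (WithTop.coe_le_coe.2 ?_)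
  have := hd.lt_B t
  gcongr

lemma digit_degree_lt (j : ℕ) : (digit (Qs i) h j).degree < (Qs 0).degree := by
  rw [← hd.seq.degree_eq i]; exact degree_digit_lt (hd.seq.monic i) h j

lemma le_digit (j : ℕ) : ((σ - j * βs i : ℝ) : WithTop ℝ) ≤ w (digit (Qs i) h j) :=
  (hd.seq.key i).toIsKey.le_digit hd.val_eq.ge j

/-- The Taylor coefficients are expanded in the same manner, not only `h` itself. Hasse derivatives
compose up to a binomial coefficient, and this factor later excludes the orders that are not powers
of `p`. -/
lemma err_aux (m : ℕ) {t : ℕ} (ht : T ≤ t) :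
    ((σ - m * βs i + (βs 1 - βs 0) : ℝ) : WithTop ℝ) ≤ seqVal w Qs βs t (taylorCoeff (Qs i) h m -
      ∑ k ∈ Finset.range (h.natDegree + 1),
        ((((k + m).choose k : K[X]) * taylorCoeff (Qs i) h (k + m)) %ₘ Qs t) * Qs t ^ k) := by
  have hs := hd.seq
  have hQ := hs.monic i
  have hQ0 := hs.natDegree_pos i
  have hc : ∀ j, (hasseDeriv m (expansion (Qs i) h)).coeff j =
      ((j + m).choose m : K[X]) * digit (Qs i) h (j + m) := fun j => by
    rw [hasseDeriv_coeff, coeff_expansion hQ hQ0]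
  have h1 := hs.taylor (i := i) (F := hasseDeriv m (expansion (Qs i) h)) (σ := σ - m * βs i)
    (fun j => by
      rw [hc, ← nsmul_eq_mul]
      exact (degree_smul_le _ _).trans_lt (hd.digit_degree_lt _))
    (fun j => by
      rw [hc, ← hs.val_of_lt 0 (by
        rw [← nsmul_eq_mul]
        exact (degree_smul_le _ _).trans_lt (hd.digit_degree_lt _))]
      refine le_trans ?_ ((hs.isVal 0).le_natCast_mul _ _)
      rw [hs.val_of_lt 0 (hd.digit_degree_lt _)]
      refine le_trans (WithTop.coe_le_coe.2 ?_) (hd.le_digit (j + m))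
      push_cast; linarith) (hd.lt_T.trans_le ht) (N := h.natDegree + 1) (by
      refine Nat.lt_succ_of_le ((natDegree_hasseDeriv_le _ _).trans ((Nat.sub_le _ _).trans ?_))
      exact (Nat.le_mul_of_pos_right _ hQ0).trans (natDegree_expansion_le hQ hQ0 h))
  refine le_trans (WithTop.coe_le_coe.2 ?_) (h1.trans_eq ?_)
  · have := hs.strictMono.monotone (hd.one_le_T.trans ht)
    linarith
  · congr 2
    refine Finset.sum_congr rfl fun k _ => ?_
    have e : hasseDeriv k (hasseDeriv m (expansion (Qs i) h)) =
        ((k + m).choose k) • hasseDeriv (k + m) (expansion (Qs i) h) := by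
      rw [← LinearMap.comp_apply, hasseDeriv_comp]; rfl
    rw [e, taylorCoeff, nsmul_eq_mul, eval_mul, eval_natCast]

lemma err {t : ℕ} (ht : T ≤ t) :
    ((σ + (βs 1 - βs 0) : ℝ) : WithTop ℝ) ≤ seqVal w Qs βs t (h -
      ∑ k ∈ Finset.range (h.natDegree + 1), (taylorCoeff (Qs i) h k %ₘ Qs t) * Qs t ^ k) := by
  have h1 := hd.err_aux 0 ht
  simpa [taylorCoeff_zero (hd.seq.monic i) (hd.seq.natDegree_pos i)] using h1

lemma val_mod {m : ℕ} (hm : 1 ≤ m) (hmN : m ≤ h.natDegree) {t : ℕ} (ht : T < t) :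
    w (taylorCoeff (Qs i) h m %ₘ Qs t) = seqVal w Qs βs T (taylorCoeff (Qs i) h m) := by
  have e := hd.stable m hm hmN t ht.le
  rw [hd.seq.val_mod_of_eq ht e, e]

lemma degree_mod_lt (m t : ℕ) : (taylorCoeff (Qs i) h m %ₘ Qs t).degree < (Qs t).degree :=
  degree_modByMonic_lt _ (hd.seq.monic t)

lemma val_term (m : ℕ) (t : ℕ) :
    seqVal w Qs βs t ((taylorCoeff (Qs i) h m %ₘ Qs t) * Qs t ^ m) =
      w (taylorCoeff (Qs i) h m %ₘ Qs t) + ((m * βs t : ℝ) : WithTop ℝ) := by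
  rw [mul_comm, seqVal, (hd.seq.key t).val_key_pow_mul,
    (hd.seq.key t).toIsKey.val_of_degree_lt (hd.degree_mod_lt m t)]

lemma val_lt_err {t : ℕ} (ht : T ≤ t) : seqVal w Qs βs t h <
    ((σ + (βs 1 - βs 0) : ℝ) : WithTop ℝ) :=
  (hd.val_le (hd.lt_T.le.trans ht)).trans_lt (WithTop.coe_lt_coe.2 (by linarith [hd.lt_eps]))

lemma val_le_term {m : ℕ} (hm : m ≤ h.natDegree) {t : ℕ} (ht : T ≤ t) :
    seqVal w Qs βs t h ≤ w (taylorCoeff (Qs i) h m %ₘ Qs t) + ((m * βs t : ℝ) : WithTop ℝ) := by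
  have hs := hd.seq
  have hμ := hs.isVal t
  have h1 := (hd.val_lt_err ht).le.trans (hd.err ht)
  have h2 := hμ.le_sub (le_refl (seqVal w Qs βs t h)) h1
  rw [sub_sub_cancel] at h2
  have h3 := h2.trans (truncVal_le (hs.monic t) (hs.natDegree_pos t) hs.key_zero.map_zero _ m)
  rwa [digit_sum_mul_pow (hs.monic t) (hs.key t).degree_pos _ _
    (fun k _ => hd.degree_mod_lt k t), if_pos (by simpa [Nat.lt_succ_iff] using hm)] at h3

/-- Otherwise the remainder `u` alone has the value of `h` at `t`, and `h - u` has a larger one,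
also for all later indices. The value of the low polynomial `u` does not move, so neither would that
of `h`. -/
lemma exists_term_le {t : ℕ} (ht : T < t) : ∃ m, 1 ≤ m ∧ m ≤ h.natDegree ∧
    seqVal w Qs βs T (taylorCoeff (Qs i) h m) + ((m * βs t : ℝ) : WithTop ℝ) ≤
      seqVal w Qs βs t h := by
  by_contra! H
  have hs := hd.seq
  obtain ⟨s, hts, hlt⟩ := hs.exists_lt_of_not_stable hd.not_stable t
  set u := h %ₘ Qs t with hu
  have hlow : u.degree < (Qs 0).degree := by
    rw [← hs.degree_eq t]; exact degree_modByMonic_lt _ (hs.monic t)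
  have hr : seqVal w Qs βs t h < seqVal w Qs βs t (h - u) := by
    have e : h - u = (h - ∑ k ∈ Finset.range (h.natDegree + 1),
        (taylorCoeff (Qs i) h k %ₘ Qs t) * Qs t ^ k) +
        ∑ k ∈ Finset.range h.natDegree,
          (taylorCoeff (Qs i) h (k + 1) %ₘ Qs t) * Qs t ^ (k + 1) := by
      rw [Finset.sum_range_succ', taylorCoeff_zero (hs.monic i) (hs.natDegree_pos i), pow_zero,
        mul_one, hu]
      ring
    rw [e]
    refine (hs.isVal t).lt_add ((hd.val_lt_err ht.le).trans_le (hd.err ht.le)) ?_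
    obtain ⟨r, hr⟩ := (hs.isVal t).exists_real hd.ne_zero
    rw [hr]
    refine (hs.isVal t).lt_sum fun k hk => ?_
    have hk' : k + 1 ≤ h.natDegree := by simpa [Nat.succ_le_iff] using hk
    rw [hd.val_term, hd.val_mod (by omega) hk' ht, ← hr]
    exact H (k + 1) (by omega) hk'
  have e1 : seqVal w Qs βs t u = seqVal w Qs βs t h :=
    (hs.isVal t).eq_of_lt_sub (by rwa [(hs.isVal t).map_sub_swap])
  have e2 : seqVal w Qs βs s u = seqVal w Qs βs t h := by
    rw [hs.val_of_lt s hlow, ← hs.val_of_lt t hlow, e1]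
  have e3 : seqVal w Qs βs s h = seqVal w Qs βs s u :=
    (hs.isVal s).eq_of_lt_sub (by
      rw [e2]; exact hr.trans_le (hs.mono (h - u) (le_of_lt hts)))
  rw [e3, e2] at hlt
  exact lt_irrefl _ hlt

end UnstableData

end KeyPoly
end
noncomputable section
namespace KeyPoly

/-! ### From unstable to weakly affine polynomials -/

variable {K : Type*} [Field K] {w : K[X] → WithTop ℝ} {Qs : ℕ → K[X]} {βs : ℕ → ℝ}

/-- Fermat's theorem in the prime field. It shows that a binomial coefficient prime to the
characteristic has value 0. -/
lemma natCast_pow_card_sub_one_eq_one (R : Type*) [CommRing R] (p : ℕ) [Fact p.Prime] [CharP R p]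
    {c : ℕ} (hc : (c : R) ≠ 0) : (c : R) ^ (p - 1) = 1 := by
  have h : (c : ZMod p) ≠ 0 := fun h => hc ((CharP.cast_eq_zero_iff R p c).2
    ((CharP.cast_eq_zero_iff (ZMod p) p c).1 h))
  have := congrArg (ZMod.castHom dvd_rfl R) (ZMod.pow_card_sub_one_eq_one h)
  simpa using this

namespace UnstableData

variable {B σ : ℝ} {h : K[X]} {i T : ℕ} (hd : UnstableData w Qs βs B h i σ T)
include hd

/-- The supremum of the values of `h`, and where it is attained. -/
lemma exists_sup : ∃ M : ℝ,
    (∀ m, 1 ≤ m → m ≤ h.natDegree →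
      ((M - m * B : ℝ) : WithTop ℝ) ≤ seqVal w Qs βs T (taylorCoeff (Qs i) h m)) ∧
    (∃ m, 1 ≤ m ∧ m ≤ h.natDegree ∧
      seqVal w Qs βs T (taylorCoeff (Qs i) h m) = ((M - m * B : ℝ) : WithTop ℝ)) ∧
    (∀ t > T, ((M - h.natDegree * (B - βs t) : ℝ) : WithTop ℝ) ≤ seqVal w Qs βs t h) ∧
    M < σ + (βs 1 - βs 0) := by
  set γ : ℕ → WithTop ℝ := fun m => seqVal w Qs βs T (taylorCoeff (Qs i) h m) with hγ
  obtain ⟨r, hr⟩ := (hd.seq.isVal (T + 1)).exists_real hd.ne_zero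
  obtain ⟨m₁, hm₁, hm₁', h1⟩ := hd.exists_term_le (Nat.lt_succ_self T)
  -- The term of order `m` has a value tending to `γ m + m * B`; the least of these limits is the
  -- supremum `M` sought. The constant term plays no part, by `exists_term_le`.
  obtain ⟨m₀, hm₀, hmin⟩ := (Finset.Icc 1 h.natDegree).exists_min_image
    (fun m => γ m + ((m * B : ℝ) : WithTop ℝ)) ⟨m₁, by simp [hm₁, hm₁']⟩
  have hne : γ m₀ ≠ ⊤ := by
    intro htop
    have := hmin m₁ (by simp [hm₁, hm₁'])
    simp only [htop, top_add, top_le_iff, WithTop.add_eq_top, WithTop.coe_ne_top, or_false] at this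
    rw [hγ] at this
    simp only at this
    rw [this, top_add, hr] at h1
    exact absurd (top_le_iff.1 h1) WithTop.coe_ne_top
  obtain ⟨g, hg⟩ : ∃ g : ℝ, γ m₀ = g := ⟨_, (WithTop.coe_untop _ hne).symm⟩
  have hm₀' := Finset.mem_Icc.1 hm₀
  have hA : ∀ m, 1 ≤ m → m ≤ h.natDegree → ((g + m₀ * B - m * B : ℝ) : WithTop ℝ) ≤ γ m := by
    intro m hm hm'
    have := hmin m (by simp [hm, hm'])
    rw [hg, ← WithTop.coe_add, withTop_le_add_iff, ← WithTop.coe_add] at this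
    exact (WithTop.coe_le_coe.2 (sub_eq_add_neg _ _).le).trans this
  have hC : ∀ t > T, ((g + m₀ * B - h.natDegree * (B - βs t) : ℝ) : WithTop ℝ) ≤
      seqVal w Qs βs t h := by
    intro t ht
    obtain ⟨m, hm, hm', hle⟩ := hd.exists_term_le ht
    refine le_trans ?_ hle
    refine le_trans (WithTop.coe_le_coe.2 ?_) (add_le_add_left (hA m hm hm') _)
    have h2 := hd.lt_B t
    have h3 : (m : ℝ) ≤ h.natDegree := by exact_mod_cast hm'
    nlinarith
  refine ⟨g + m₀ * B, hA, ⟨m₀, hm₀'.1, hm₀'.2, ?_⟩, hC, ?_⟩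
  · rw [add_sub_cancel_right]; exact hg
  · have h1 : Filter.Tendsto (fun t => g + m₀ * B - h.natDegree * (B - βs t)) Filter.atTop
        (nhds (g + m₀ * B)) := by
      have := ((hd.tendsto.const_sub B).const_mul (h.natDegree : ℝ)).const_sub (g + m₀ * B)
      simpa using this
    have h2 : g + m₀ * B ≤ σ + h.natDegree * (B - βs i) := by
      refine le_of_tendsto h1 ?_
      filter_upwards [Filter.eventually_gt_atTop T] with t ht
      exact WithTop.coe_le_coe.1 ((hC t ht).trans (hd.val_le (hd.lt_T.trans ht).le))
    linarith [hd.lt_eps]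

/-- The supremum is only attained at powers of the characteristic. -/
lemma eq_pow_of_attained (p : ℕ) [Fact p.Prime] [CharP K p] {M : ℝ}
    (hM : ∀ m, 1 ≤ m → m ≤ h.natDegree →
      ((M - m * B : ℝ) : WithTop ℝ) ≤ seqVal w Qs βs T (taylorCoeff (Qs i) h m))
    (hlt : M < σ + (βs 1 - βs 0)) {m : ℕ} (hm : 1 ≤ m) (hmN : m ≤ h.natDegree)
    (he : seqVal w Qs βs T (taylorCoeff (Qs i) h m) = ((M - m * B : ℝ) : WithTop ℝ)) :
    ∃ a, m = p ^ a := by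
  have hp := (Fact.out : p.Prime)
  have hs := hd.seq
  obtain ⟨a, r, hr, rfl⟩ := Nat.exists_eq_pow_mul_and_not_dvd (n := m) (by omega) p hp.ne_one
  rcases Nat.lt_or_ge 1 r with h1 | h1
  swap
  · have : r = 1 := by
      rcases Nat.eq_zero_or_pos r with rfl | h0
      · simp at hm
      · omega
    exact ⟨a, by rw [this, mul_one]⟩
  -- Now `m = m' * r` with `m' = p ^ a` and `r > 1` prime to `p`. The Taylor coefficient of order
  -- `m'` has value at least `M - m' * B`. In its own expansion the digit of index `m - m'` is the
  -- coefficient of order `m` times a binomial coefficient of value 0, and this term has the value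
  -- `M - m * B + (m - m') * βs t`, which is too small because `βs t < B`.
  exfalso
  set m' := p ^ a with hm'
  have hpos : 0 < m' := pow_pos hp.pos a
  have hlt' : m' < m' * r := lt_mul_of_one_lt_right hpos h1
  set t := T + 1
  have ht : T < t := Nat.lt_succ_self T
  obtain ⟨k, hk⟩ := Nat.exists_eq_add_of_lt hlt'
  have hk' : m' * r = (k + 1) + m' := by omega
  have herr := hd.err_aux m' ht.le
  set E := ∑ k ∈ Finset.range (h.natDegree + 1),
        ((((k + m').choose k : K[X]) * taylorCoeff (Qs i) h (k + m')) %ₘ Qs t) * Qs t ^ k with hE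
  have hv : ((M - m' * B : ℝ) : WithTop ℝ) ≤ seqVal w Qs βs t E := by
    have h2 := hM m' hpos (by omega)
    rw [← hd.stable m' hpos (by omega) t ht.le] at h2
    have h3 : ((M - m' * B : ℝ) : WithTop ℝ) ≤
        seqVal w Qs βs t (taylorCoeff (Qs i) h m' - E) := by
      refine le_trans (WithTop.coe_le_coe.2 ?_) herr
      have h5 := hd.lt_B i
      have h6 : (0 : ℝ) ≤ m' := Nat.cast_nonneg _
      nlinarith
    have h4 := (hs.isVal t).le_sub h2 h3
    rwa [sub_sub_cancel] at h4
  have h2 := hv.trans (truncVal_le (hs.monic t) (hs.natDegree_pos t) hs.key_zero.map_zero _ (k + 1))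
  rw [hE, digit_sum_mul_pow (hs.monic t) (hs.key t).degree_pos _ _
    (fun k _ => degree_modByMonic_lt _ (hs.monic t)), if_pos (by
      rw [Finset.mem_range]; omega), ← hk'] at h2
  have hchoose : (((m' * r).choose (k + 1) : ℕ) : K) ≠ 0 := by
    rw [hk', Nat.choose_symm_add, ← hk']
    exact choose_pow_ne_zero K p a hr
  set c : ℕ := (m' * r).choose (k + 1)
  have hc0 : seqVal w Qs βs t (c : K[X]) = 0 := by
    refine (hs.isVal t).eq_zero_of_pow_eq_one (n := p - 1)
      (Nat.sub_ne_zero_of_lt hp.one_lt) ?_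
    rw [← natCast_pow_card_sub_one_eq_one K[X] p (c := c) (fun h0 => hchoose ?_)]
    exact (CharP.cast_eq_zero_iff K p c).2 ((CharP.cast_eq_zero_iff K[X] p c).1 h0)
  have e1 : (c : K[X]) * taylorCoeff (Qs i) h (m' * r) %ₘ Qs t =
      c * (taylorCoeff (Qs i) h (m' * r) %ₘ Qs t) := by
    rw [← nsmul_eq_mul, ← nsmul_eq_mul, ← Nat.cast_smul_eq_nsmul K, ← Nat.cast_smul_eq_nsmul K,
      smul_modByMonic]
  have hlow : ∀ {u : K[X]}, u.degree < (Qs t).degree → seqVal w Qs βs t u = w u := fun hu =>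
    (hs.key t).toIsKey.val_of_degree_lt hu
  rw [← hlow (degree_modByMonic_lt _ (hs.monic t)), e1, (hs.isVal t).map_mul, hc0, zero_add,
    hlow (degree_modByMonic_lt _ (hs.monic t)), hd.val_mod hm hmN ht, he, ← WithTop.coe_add,
    WithTop.coe_le_coe, hk'] at h2
  have h3 := hd.lt_B t
  have h4 : (0 : ℝ) ≤ k := Nat.cast_nonneg _
  push_cast at h2
  nlinarith

/-- An unstable polynomial of least degree gives rise to a weakly affine polynomial of at most the
same degree. -/
lemma exists_weaklyAffine (p : ℕ) [Fact p.Prime] [CharP K p] :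
    ∃ (e t : ℕ) (q : K[X]), q.Monic ∧ q.natDegree = p ^ e * (Qs 0).natDegree ∧
      q.natDegree ≤ h.natDegree ∧
      (∀ j, 0 < j → digit (Qs t) q j ≠ 0 → ∃ a : ℕ, j = p ^ a) ∧
      ∀ t', ∃ s, (((p : ℝ) ^ e * βs t' : ℝ) : WithTop ℝ) < seqVal w Qs βs s q := by
  classical
  have hs := hd.seq
  obtain ⟨M, hM, ⟨m₁, hm₁, hm₁N, he₁⟩, hlow, hlt⟩ := hd.exists_sup
  set D := h.natDegree with hD
  set γ : ℕ → WithTop ℝ := fun m => seqVal w Qs βs T (taylorCoeff (Qs i) h m) with hγ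
  -- `J` consists of the orders that determine the limit `M`. For late `t` all other terms of
  -- positive order have value greater than `M` and can be discarded. The remaining coefficients and
  -- the constant one are multiplied by an inverse `d` of the coefficient of the largest order `m₀ =
  -- p ^ e`, which makes the result monic.
  set J : Finset ℕ := (Finset.Icc 1 D).filter fun m => γ m = ((M - m * B : ℝ) : WithTop ℝ) with hJ
  have hJmem : ∀ m, m ∈ J ↔ (1 ≤ m ∧ m ≤ D) ∧ γ m = ((M - m * B : ℝ) : WithTop ℝ) := by
    intro m; rw [hJ, Finset.mem_filter, Finset.mem_Icc]
  have hJne : J.Nonempty := ⟨m₁, (hJmem m₁).2 ⟨⟨hm₁, hm₁N⟩, he₁⟩⟩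
  set m₀ := J.max' hJne with hm₀
  have hm₀J := J.max'_mem hJne
  rw [← hm₀] at hm₀J
  obtain ⟨⟨h1m₀, hm₀D⟩, hγm₀⟩ := (hJmem m₀).1 hm₀J
  have hpow : ∀ m ∈ J, ∃ a, m = p ^ a := fun m hm => by
    obtain ⟨⟨h1, h2⟩, h3⟩ := (hJmem m).1 hm
    exact hd.eq_pow_of_attained p hM hlt h1 h2 h3
  obtain ⟨e, hpe⟩ := hpow m₀ hm₀J
  have hε : 0 < βs 1 - βs 0 := sub_pos.2 (hs.strictMono Nat.zero_lt_one)
  have hlim : Filter.Tendsto (fun t => D * (B - βs t)) Filter.atTop (nhds 0) := by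
    have := (hd.tendsto.const_sub B).const_mul (D : ℝ)
    simpa using this
  have hev : ∀ᶠ t in Filter.atTop, ∀ m ∈ (Finset.Icc 1 D) \ J,
      (M : WithTop ℝ) < γ m + ((m * βs t : ℝ) : WithTop ℝ) := by
    rw [Filter.eventually_all_finset]
    intro m hm
    rw [Finset.mem_sdiff, Finset.mem_Icc] at hm
    cases hx : γ m with
    | top =>
      refine Filter.Eventually.of_forall fun t => ?_
      rw [top_add]; exact WithTop.coe_lt_top _
    | coe g =>
      have h2 : M < g + m * B := by
        have h3 := hM m hm.1.1 hm.1.2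
        change _ ≤ γ m at h3
        rw [hx, WithTop.coe_le_coe] at h3
        refine lt_of_le_of_ne (by linarith) fun h4 => hm.2 ((hJmem m).2 ⟨hm.1, ?_⟩)
        rw [hx, h4]; congr 1; ring
      have h3 : Filter.Tendsto (fun t => g + m * βs t) Filter.atTop (nhds (g + m * B)) :=
        (hd.tendsto.const_mul (m : ℝ)).const_add g
      filter_upwards [h3.eventually (lt_mem_nhds h2)] with t ht
      exact_mod_cast ht
  obtain ⟨t, ⟨htJ, htε⟩, htT⟩ := ((hev.and (hlim.eventually (gt_mem_nhds hε))).and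
    (Filter.eventually_gt_atTop T)).exists
  set U : ℕ → K[X] := fun m => taylorCoeff (Qs i) h m %ₘ Qs t with hU
  have hUdeg : ∀ m, (U m).degree < (Qs t).degree := fun m => hd.degree_mod_lt m t
  have hQm := hs.monic t
  have hk := hs.key t
  have hUm₀ : w (U m₀) = ((M - m₀ * B : ℝ) : WithTop ℝ) := by
    rw [hU]; simp only; rw [hd.val_mod h1m₀ hm₀D htT]; exact hγm₀
  have hUm₀0 : U m₀ ≠ 0 := fun h0 => by
    rw [h0, hs.key_zero.map_zero] at hUm₀; exact WithTop.coe_ne_top hUm₀.symm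
  obtain ⟨d, hddeg, hdinv⟩ := hk.toIsKey.exists_inv hUm₀0 (hUdeg m₀)
  have hwd : w d = ((m₀ * B - M : ℝ) : WithTop ℝ) := by
    have h1 := hk.mul_mod _ _ (hUdeg m₀) hddeg
    rw [hdinv, hk.toIsKey.map_one, hUm₀] at h1
    have hdne : d ≠ 0 := by
      rintro rfl
      rw [mul_zero, zero_modByMonic] at hdinv
      exact zero_ne_one hdinv
    have h2 := hk.ne_top d hdne hddeg
    lift w d to ℝ using h2 with r
    norm_cast at h1 ⊢
    linarith
  set V : ℕ → K[X] := fun m => (d * U m) %ₘ Qs t with hV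
  have hVdeg : ∀ m, (V m).degree < (Qs t).degree := fun m => degree_modByMonic_lt _ hQm
  have hVm₀ : V m₀ = 1 := by rw [hV]; simp only; rw [mul_comm, hdinv]
  set q : K[X] := ∑ m ∈ insert 0 J, V m * Qs t ^ m with hq
  have hqeq : q = Qs t ^ m₀ + ∑ m ∈ (insert 0 J).erase m₀, V m * Qs t ^ m := by
    rw [hq, ← Finset.add_sum_erase _ _ (Finset.mem_insert_of_mem hm₀J), hVm₀, one_mul]
  have hrest : (∑ m ∈ (insert 0 J).erase m₀, V m * Qs t ^ m).degree < (Qs t ^ m₀).degree := by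
    refine (degree_sum_le _ _).trans_lt ((Finset.sup_lt_iff (bot_lt_iff_ne_bot.2
      (degree_ne_bot.2 (hQm.pow _).ne_zero))).2 fun m hm => ?_)
    rw [Finset.mem_erase, Finset.mem_insert] at hm
    have hmlt : m < m₀ := by
      rcases hm.2 with rfl | hmJ
      · omega
      · exact lt_of_le_of_ne (J.le_max' m hmJ) hm.1
    rw [← Nat.succ_le_iff] at hmlt
    obtain ⟨k, hk'⟩ := Nat.exists_eq_add_of_le hmlt
    by_cases hV0 : V m = 0
    · rw [hV0, zero_mul, degree_zero]
      exact bot_lt_iff_ne_bot.2 (degree_ne_bot.2 (hQm.pow _).ne_zero)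
    refine degree_lt_degree ?_
    rw [natDegree_mul hV0 (hQm.pow _).ne_zero, hQm.natDegree_pow, hQm.natDegree_pow]
    have h2 := natDegree_lt_natDegree hV0 (hVdeg m)
    calc (V m).natDegree + m * (Qs t).natDegree < (m + 1) * (Qs t).natDegree := by
          rw [add_mul]; omega
      _ ≤ _ := Nat.mul_le_mul_right _ hmlt
  have hdegq : q.natDegree = p ^ e * (Qs 0).natDegree := by
    rw [hqeq, natDegree_eq_of_degree_eq (degree_add_eq_left_of_degree_lt hrest),
      hQm.natDegree_pow, hpe, hs.natDegree_eq]
  have hterm : ∀ m ≤ D, ((M - D * (B - βs t) : ℝ) : WithTop ℝ) ≤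
      w (U m) + ((m * βs t : ℝ) : WithTop ℝ) := fun m hm =>
    (hlow t htT).trans (hd.val_le_term hm htT.le)
  have hinsert : ∀ m ∈ insert 0 J, m ≤ D := fun m hm => by
    rcases Finset.mem_insert.1 hm with rfl | hm
    · exact Nat.zero_le _
    · exact ((hJmem m).1 hm).1.2
  refine ⟨e, t, q, ?_, hdegq, ?_, fun j hj hne => ?_, fun t' => ?_⟩
  · rw [hqeq]; exact (hQm.pow _).add_of_left hrest
  · rw [hdegq, ← hpe]
    have hle : m₀ ≤ (expansion (Qs i) h).natDegree := by
      by_contra! hlt'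
      rw [hγ] at hγm₀
      simp only [taylorCoeff] at hγm₀
      rw [hasseDeriv_eq_zero_of_lt_natDegree _ _ hlt', eval_zero, (hs.isVal T).map_zero] at hγm₀
      exact WithTop.coe_ne_top hγm₀.symm
    refine le_trans ?_ (natDegree_expansion_le (hs.monic i) (hs.natDegree_pos i) h)
    rw [hs.natDegree_eq i]
    exact Nat.mul_le_mul_right _ hle
  · rw [hq, digit_sum_mul_pow hQm hk.degree_pos _ _ (fun m _ => hVdeg m)] at hne
    by_cases hjm : j ∈ insert 0 J
    · rcases Finset.mem_insert.1 hjm with rfl | hjJ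
      · omega
      · exact hpow j hjJ
    · rw [if_neg hjm] at hne; exact absurd rfl hne
  -- The values of the truncated expansion `P` are at least `M` minus a quantity tending to 0, and
  -- `d` has value `m₀ * B - M`. So the values of `q` eventually exceed every number less than `m₀ *
  -- B`.
  · have h2 : 0 < m₀ * (B - βs t') := mul_pos (by exact_mod_cast h1m₀) (by linarith [hd.lt_B t'])
    obtain ⟨s, hst, hsD⟩ := ((Filter.eventually_ge_atTop t).and
      (hlim.eventually (gt_mem_nhds h2))).exists
    refine ⟨s, ?_⟩
    have hsD' : (((p : ℝ) ^ e * βs t' : ℝ) : WithTop ℝ) <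
        ((m₀ * B - D * (B - βs s) : ℝ) : WithTop ℝ) := by
      rw [WithTop.coe_lt_coe]
      have : (p : ℝ) ^ e = m₀ := by rw [hpe]; push_cast; rfl
      rw [this]; linarith
    refine hsD'.trans_le ?_
    have hμ := hs.isVal s
    have hDs : 0 ≤ D * (B - βs s) := mul_nonneg (Nat.cast_nonneg _) (by linarith [hd.lt_B s])
    set P := ∑ m ∈ insert 0 J, U m * Qs t ^ m with hP
    set R := ∑ m ∈ insert 0 J, (d * U m - V m) * Qs t ^ m with hR
    -- `R` is the error made by reducing the products `d * U m` modulo `Qs t`; `gap_low` gives it a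
    -- gain of `βs t - βs 0`, more than the loss `D * (B - βs t)`.
    have eq1 : q = d * P - R := by
      rw [hq, hP, hR, Finset.mul_sum, ← Finset.sum_sub_distrib]
      exact Finset.sum_congr rfl fun m _ => by ring
    have hsub : insert 0 J ⊆ Finset.range (D + 1) := fun m hm => by
      rw [Finset.mem_range, Nat.lt_succ_iff]; exact hinsert m hm
    have eq2 : P = (h - (h - ∑ k ∈ Finset.range (D + 1), U k * Qs t ^ k)) -
        ∑ m ∈ Finset.range (D + 1) \ insert 0 J, U m * Qs t ^ m := by
      rw [← Finset.sum_sdiff hsub, hP]; ring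
    have hPs : ((M - D * (B - βs s) : ℝ) : WithTop ℝ) ≤ seqVal w Qs βs s P := by
      rw [eq2]
      refine hμ.le_sub (hμ.le_sub (hlow s (htT.trans_le hst)) ?_) (hμ.le_sum fun m hm => ?_)
      · exact ((WithTop.coe_le_coe.2 (by linarith)).trans (hd.err htT.le)).trans (hs.mono _ hst)
      · rw [Finset.mem_sdiff, Finset.mem_range, Finset.mem_insert, not_or] at hm
        have hm1 : 1 ≤ m ∧ m ≤ D := ⟨Nat.one_le_iff_ne_zero.2 hm.2.1, by omega⟩
        refine le_trans ?_ (hs.mono _ hst)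
        simp only
        rw [hU]
        simp only
        rw [hd.val_term, hd.val_mod hm1.1 hm1.2 htT]
        refine le_trans (WithTop.coe_le_coe.2 ?_) (htJ m (by
          rw [Finset.mem_sdiff, Finset.mem_Icc]; exact ⟨hm1, hm.2.2⟩)).le
        linarith
    have hdlow : ∀ r, seqVal w Qs βs r d = ((m₀ * B - M : ℝ) : WithTop ℝ) := fun r => by
      rw [hs.val_of_lt r (by rwa [← hs.degree_eq t]), hwd]
    rw [eq1]
    refine hμ.le_sub ?_ ?_
    · refine le_trans (WithTop.coe_le_coe.2 ?_) (hμ.coe_le_mul (hdlow s).ge hPs)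
      linarith
    · refine le_trans ?_ (hs.mono R hst)
      have hμt := hs.isVal t
      refine hμt.le_sum fun m hm => ?_
      have hmt := hterm m (hinsert m hm)
      rw [withTop_le_add_iff, ← WithTop.coe_add] at hmt
      have h3 : ((M - D * (B - βs t) + -(m * βs t) : ℝ) : WithTop ℝ) ≤ seqVal w Qs βs 0 (U m) := by
        rwa [hs.val_of_lt 0 (by rw [← hs.degree_eq t]; exact hUdeg m)]
      have h4 := hs.gap_low ((hs.isVal 0).coe_le_mul (hdlow 0).ge h3) t
      refine le_trans (WithTop.coe_le_coe.2 ?_) (hμt.coe_le_mul h4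
        (hμt.coe_le_pow hk.val_key.ge m))
      have := hs.strictMono.monotone (hd.one_le_T.trans htT.le)
      linarith

end UnstableData

end KeyPoly
end
noncomputable section
namespace KeyPoly

/-! ### Limit key polynomials -/

variable {K : Type*} [Field K] {w : K[X] → WithTop ℝ}

lemma IsLimitSeq.inT {f Q : K[X]} {β : ℝ} {δ : ℕ} {Qs : ℕ → K[X]} {βs : ℕ → ℝ}
    (h : IsLimitSeq w f Q β δ Qs βs) (t : ℕ) : InT w f Q β δ (Qs t) (βs t) := by
  induction t with
  | zero => rw [h.1, h.2.1]; exact InT.base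
  | succ t ih =>
    have h' := h.2.2.1 t
    have := InT.step (Qs t) (βs t) _ (βs (t + 1)) ih h'.1 (by rw [add_sub_cancel]; exact h'.2)
    rwa [add_sub_cancel] at this

/-- A limit key polynomial `q` together with the sequence which determines it. -/
structure LimitData (w : K[X] → WithTop ℝ) (f Q : K[X]) (β : ℝ) (δ p : ℕ) (Qs : ℕ → K[X])
    (βs : ℕ → ℝ) (e₀ : ℕ) (q : K[X]) : Prop where
  key : StrictKey w Q β
  irreducible : Irreducible f
  isCharSide : IsCharSide w f Q β δ
  isLimitSeq : IsLimitSeq w f Q β δ Qs βs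
  bddAbove : BddAbove (Set.range βs)
  isWeaklyAffine : IsWeaklyAffineLimit w p Q δ Qs βs e₀ q
  le_of_isWeaklyAffine : ∀ e₁ q₁, IsWeaklyAffineLimit w p Q δ Qs βs e₁ q₁ → e₀ ≤ e₁

namespace LimitData

variable {f Q q : K[X]} {β : ℝ} {δ p e₀ : ℕ} {Qs : ℕ → K[X]} {βs : ℕ → ℝ}
  (hd : LimitData w f Q β δ p Qs βs e₀ q)
include hd

lemma charSide (t : ℕ) : IsCharSide w f (Qs t) (βs t) δ := by
  cases t with
  | zero => rw [hd.isLimitSeq.1, hd.isLimitSeq.2.1]; exact hd.isCharSide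
  | succ t => exact (hd.isLimitSeq.2.2.1 t).2

lemma ne_zero : f ≠ 0 := hd.irreducible.ne_zero

lemma strictKey (t : ℕ) : StrictKey w (Qs t) (βs t) := by
  induction t with
  | zero => rw [hd.isLimitSeq.1, hd.isLimitSeq.2.1]; exact hd.key
  | succ t ih =>
    have hl := (hd.isLimitSeq.2.2.1 t).1
    have hz := IsLinearPower.val_eq ih hd.ne_zero hl (hd.charSide t)
    have h1 := ih.shift (Q' := Qs (t + 1))
      (by simpa using IsLinearPower.monic ih hl) hl.1 hz.ge
    refine h1.strictKey (IsLinearPower.lt_of_isCharSide ih hd.ne_zero hl (hd.charSide t) ?_)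
    rw [add_sub_cancel]; exact hd.charSide (t + 1)

lemma seq : KeySeq w Qs βs where
  key_zero := hd.strictKey 0
  degree_lt t := by
    induction t with
    | zero => exact (hd.isLimitSeq.2.2.1 0).1.1
    | succ t ih =>
      refine (hd.isLimitSeq.2.2.1 (t + 1)).1.1.trans_eq ?_
      have : ∀ t, (Qs t).degree = (Qs 0).degree := fun t => by
        induction t with
        | zero => rfl
        | succ t ih =>
          have := degree_add_eq_left_of_degree_lt (hd.isLimitSeq.2.2.1 t).1.1
          rwa [add_sub_cancel, ih] at this
      exact this _
  val_sub_succ t :=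
    IsLinearPower.val_eq (hd.strictKey t) hd.ne_zero (hd.isLimitSeq.2.2.1 t).1 (hd.charSide t)
  strictMono := strictMono_nat_of_lt_succ fun t =>
    IsLinearPower.lt_of_isCharSide (hd.strictKey t) hd.ne_zero (hd.isLimitSeq.2.2.1 t).1
      (hd.charSide t) (by rw [add_sub_cancel]; exact hd.charSide (t + 1))

lemma tendsto : Filter.Tendsto βs Filter.atTop (nhds (⨆ t, βs t)) :=
  tendsto_atTop_ciSup hd.seq.strictMono.monotone hd.bddAbove

lemma lt_sup (t : ℕ) : βs t < ⨆ t, βs t := hd.seq.lt_of_tendsto hd.tendsto t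

/-- The values of `f` grow like those of `Q ^ δ`. -/
lemma exists_val_eq : ∃ A : ℝ, ∀ t, seqVal w Qs βs t f = ((A + δ * βs t : ℝ) : WithTop ℝ) := by
  have h1 : ∀ t, w (digit (Qs t) f δ) = w (digit (Qs 0) f δ) := fun t => by
    induction t with
    | zero => rfl
    | succ t ih =>
      have := (IsLinearPower.lt_digit (hd.strictKey t) hd.ne_zero (hd.isLimitSeq.2.2.1 t).1
        (hd.charSide t)).1
      rw [add_sub_cancel] at this
      rw [this, ih]
  have h2 := (hd.strictKey 0).ne_top _ ((hd.strictKey 0).digit_topIndex_ne_zero hd.ne_zero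
    (hd.charSide 0).2) (degree_digit_lt (hd.strictKey 0).monic f δ)
  refine ⟨(w (digit (Qs 0) f δ)).untop h2, fun t => ?_⟩
  · have h3 := (mem_sideSet_iff.1 (topIndex_mem w (Qs t) (βs t) f)).2
    rw [(hd.charSide t).2, h1] at h3
    rw [seqVal, ← h3, WithTop.coe_add, WithTop.coe_untop]

lemma two_le : 2 ≤ δ := by
  obtain ⟨h1, h2, -⟩ := hd.isWeaklyAffine
  have h3 : padicValNat p δ ≠ 0 := by omega
  have hδ : δ ≠ 0 := by rintro rfl; simp at h3
  have hne : δ ≠ 1 := by rintro rfl; simp at h3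
  omega

/-- There is no limit of the sequence of the degree of its terms. -/
lemma not_exists_limit {Q' : K[X]} (hQ' : Q'.Monic) (hdeg : Q'.natDegree = (Qs 0).natDegree)
    (hval : ∀ t, ∃ s, (βs t : WithTop ℝ) < seqVal w Qs βs s Q') : False := by
  have hs := hd.seq
  have hdeg' : ∀ t, (Q' - Qs t).degree < (Qs t).degree := fun t => by
    have e : Q'.degree = (Qs t).degree := by
      rw [degree_eq_natDegree hQ'.ne_zero, degree_eq_natDegree (hs.monic t).ne_zero, hdeg,
        hs.natDegree_eq t]
    rw [← e]
    exact degree_sub_lt_left e hQ'.ne_zero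
      (by rw [hQ'.leadingCoeff, (hs.monic t).leadingCoeff])
  have hdeg0 : ∀ t, (Q' - Qs t).degree < (Qs 0).degree := fun t => by
    rw [← hs.degree_eq t]; exact hdeg' t
  have hle : ∀ t, (βs t : WithTop ℝ) ≤ w (Q' - Qs t) := fun t => by
    obtain ⟨s, hlt⟩ := hval t
    have h1 : (βs t : WithTop ℝ) ≤ seqVal w Qs βs (max s t) Q' :=
      hlt.le.trans (hs.mono _ (le_max_left _ _))
    have h2 : (βs t : WithTop ℝ) ≤ seqVal w Qs βs (max s t) (Qs t) :=
      (hd.strictKey t).val_key.ge.trans (hs.mono _ (le_max_right _ _))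
    have := (hs.isVal _).le_sub h1 h2
    rwa [hs.val_of_lt _ (hdeg0 t)] at this
  -- `Q' - Qs t` has the same initial form as the correction `Qs (t + 1) - Qs t` of the sequence, so
  -- it is as good a correction.
  have hlin : ∀ t, IsLinearPower w f (Qs t) (βs t) δ (Q' - Qs t) := fun t => by
    obtain ⟨-, e⟩ := (hd.isLimitSeq.2.2.1 t).1
    refine ⟨hdeg' t, ?_⟩
    have h1 : inForm (seqVal w Qs βs t) (Q' - Qs t) =
        inForm (seqVal w Qs βs t) (Qs (t + 1) - Qs t) := by
      refine inForm_eq_of_lt (hs.isVal t) ?_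
      rw [hs.val_of_lt t (hs.degree_lt t), hs.val_sub_succ, sub_sub_sub_cancel_right,
        hs.val_of_lt t (hdeg0 _)]
      exact (WithTop.coe_lt_coe.2 (hs.strictMono (Nat.lt_succ_self t))).trans_le (hle (t + 1))
    rw [h1]; exact e
  have hQ'eq : ∀ t, Qs t + (Q' - Qs t) = Q' := fun t => add_sub_cancel _ _
  have hlt : ∀ t, ∀ j ≠ δ, w (digit Q' f δ) + ((δ * βs t : ℝ) : WithTop ℝ) <
      w (digit Q' f j) + ((j * βs t : ℝ) : WithTop ℝ) := fun t j hj => by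
    have := (IsLinearPower.lt_digit (hd.strictKey t) hd.ne_zero (hlin t) (hd.charSide t)).2 j hj
    rwa [hQ'eq] at this
  have hkt : ∀ t, StrictKey w Q' (βs t) := fun t =>
    (hd.strictKey t).shift hQ' (hdeg' t) (hle t)
  have hQ0 := (hkt 0).natDegree_pos
  have hsum := sum_digit hQ' hQ0 (Nat.lt_succ_self f.natDegree)
  have htop : w (digit Q' f δ) ≠ ⊤ := fun h => by
    have := hlt 0 (δ + 1) (by omega)
    rw [h, top_add] at this
    exact not_top_lt this
  obtain ⟨a, ha⟩ : ∃ a : ℝ, w (digit Q' f δ) = a := ⟨_, (WithTop.coe_untop _ htop).symm⟩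
  -- If some digit below `δ` is nonzero, the least slope `β''` to such a point determines a side
  -- ending at height `δ`. Then `Q'` is in `T` and `β''` exceeds every `βs t`, against the choice of
  -- the sequence. Otherwise `Q' ^ δ` divides `f`, which is impossible since `δ ≥ 2` and `f` is
  -- irreducible.
  by_cases hex : ∃ j < δ, w (digit Q' f j) ≠ ⊤
  · obtain ⟨j₁, hj₁, hj₁'⟩ := hex
    classical
    set J := (Finset.range δ).filter fun j => w (digit Q' f j) ≠ ⊤ with hJ
    set slope : ℕ → ℝ := fun j => ((w (digit Q' f j)).untopD 0 - a) / (δ - j) with hslope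
    obtain ⟨j₀, hj₀, hmin⟩ := J.exists_min_image slope
      ⟨j₁, by simp [hJ, hj₁, hj₁']⟩
    rw [hJ, Finset.mem_filter, Finset.mem_range] at hj₀
    obtain ⟨b, hb⟩ : ∃ b : ℝ, w (digit Q' f j₀) = b := ⟨_, (WithTop.coe_untop _ hj₀.2).symm⟩
    set β'' := slope j₀ with hβ''
    have hj₀δ : (0 : ℝ) < δ - j₀ := sub_pos.2 (by exact_mod_cast hj₀.1)
    have hbβ : b + j₀ * β'' = a + δ * β'' := by
      rw [hβ'', hslope]
      simp only [hb, WithTop.untopD_coe]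
      field_simp
      ring
    have hgt : ∀ t, βs t < β'' := fun t => by
      have h1 := hlt t j₀ hj₀.1.ne
      rw [ha, hb] at h1
      norm_cast at h1
      by_contra! h2
      nlinarith
    have hmin' : ∀ j, ((a + δ * β'' : ℝ) : WithTop ℝ) ≤
        w (digit Q' f j) + ((j * β'' : ℝ) : WithTop ℝ) ∧ (δ < j → ((a + δ * β'' : ℝ) : WithTop ℝ) <
        w (digit Q' f j) + ((j * β'' : ℝ) : WithTop ℝ)) := fun j => by
      rcases lt_trichotomy j δ with hj | rfl | hj
      · refine ⟨?_, fun h => absurd h hj.not_gt⟩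
        cases hx : w (digit Q' f j) with
        | top => simp
        | coe r =>
          have h1 := hmin j (by rw [hJ, Finset.mem_filter, Finset.mem_range, hx]; simp [hj])
          have hjδ : (0 : ℝ) < δ - j := sub_pos.2 (by exact_mod_cast hj)
          have h2 : β'' * (δ - j) ≤ r - a := by
            rw [← le_div_iff₀ hjδ]
            rw [hslope] at h1
            simp only [hx, WithTop.untopD_coe] at h1
            exact h1
          norm_cast
          linarith
      · refine ⟨by rw [ha]; rfl, fun h => absurd h (lt_irrefl _)⟩
      · have h3 : ((a + δ * β'' : ℝ) : WithTop ℝ) <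
            w (digit Q' f j) + ((j * β'' : ℝ) : WithTop ℝ) := by
          have h1 := hlt 0 j hj.ne'
          rw [ha] at h1
          cases hx : w (digit Q' f j) with
          | top => rw [top_add]; exact WithTop.coe_lt_top _
          | coe r =>
            rw [hx] at h1
            norm_cast at h1 ⊢
            have h4 := hgt 0
            have h5 : (δ : ℝ) < j := by exact_mod_cast hj
            nlinarith
        exact ⟨h3.le, fun _ => h3⟩
    have hval : truncVal w Q' β'' f = ((a + δ * β'' : ℝ) : WithTop ℝ) := by
      refine le_antisymm ?_ ((le_truncVal_iff hQ' hQ0 hs.key_zero.map_zero).2 fun j => (hmin' j).1)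
      refine (truncVal_le hQ' hQ0 hs.key_zero.map_zero f δ).trans_eq ?_
      rw [ha]; rfl
    have hdegle : ∀ j, w (digit Q' f j) ≠ ⊤ → j ≤ f.natDegree := fun j hj => by
      by_contra! h
      rw [digit_eq_zero' hQ' hQ0 h, hs.key_zero.map_zero] at hj
      exact hj rfl
    have hδmem : δ ∈ sideSet w Q' β'' f :=
      mem_sideSet_iff.2 ⟨hdegle δ htop, by rw [hval, ha]; rfl⟩
    have hj₀mem : j₀ ∈ sideSet w Q' β'' f :=
      mem_sideSet_iff.2 ⟨hdegle j₀ hj₀.2, by rw [hval, hb, ← hbβ]; rfl⟩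
    have hchar : IsCharSide w f Q' β'' δ := by
      refine ⟨Finset.one_lt_card.2 ⟨j₀, hj₀mem, δ, hδmem, hj₀.1.ne⟩, le_antisymm ?_ ?_⟩
      · refine Finset.sup_le fun j hj => ?_
        by_contra! h
        have := (hmin' j).2 h
        rw [(mem_sideSet_iff.1 hj).2, hval] at this
        exact lt_irrefl _ this
      · exact sideSet_subset_range hδmem
    have hT := InT.step (Qs 0) (βs 0) (Q' - Qs 0) β'' (hd.isLimitSeq.inT 0) (hlin 0)
      (by rw [hQ'eq]; exact hchar)
    obtain ⟨t, ht⟩ := hd.isLimitSeq.2.2.2 _ _ hT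
    exact absurd (hgt t) (not_lt.2 ht)
  · push Not at hex
    have hdvd : Q' ^ δ ∣ f := by
      rw [← hsum]
      refine Finset.dvd_sum fun j _ => ?_
      rcases Nat.lt_or_ge j δ with hj | hj
      · have : digit Q' f j = 0 := by
          by_contra h0
          exact (hkt 0).ne_top _ h0 (degree_digit_lt hQ' f j) (hex j hj)
        rw [this, zero_mul]; exact dvd_zero _
      · exact Dvd.dvd.mul_left (pow_dvd_pow _ hj) _
    have h2 : Q' * Q' ∣ f := by
      refine dvd_trans ?_ hdvd
      rw [← pow_two]; exact pow_dvd_pow _ hd.two_le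
    exact (hkt 0).toIsKey.irreducible.not_isUnit (hd.irreducible.squarefree _ h2)

/-- The values of the polynomials of degree less than `deg q` become stable. -/
lemma stable [Fact p.Prime] [CharP K p] {h : K[X]} (h0 : h ≠ 0) (hh : h.degree < q.degree) :
    Stable w Qs βs h := by
  induction hn : h.natDegree using Nat.strong_induction_on generalizing h with
  | _ n ih =>
    by_contra hst
    obtain ⟨i, σ, T, hu⟩ := hd.seq.exists_unstableData hd.tendsto h0 hst fun h' h0' hlt =>
      ih h'.natDegree (hn ▸ natDegree_lt_natDegree h0' hlt) h0' (hlt.trans hh) rfl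
    obtain ⟨e, t, q', hm, hdeg, hle, hdig, hval⟩ := hu.exists_weaklyAffine p
    obtain ⟨h1, h2, hqm, hqdeg, -⟩ := hd.isWeaklyAffine
    have hlt : q'.natDegree < q.natDegree := hle.trans_lt (natDegree_lt_natDegree h0 hh)
    rw [hdeg, hqdeg, hd.isLimitSeq.1] at hlt
    -- The new polynomial has a smaller exponent than `q`. Exponent 0 would give a limit of the
    -- degree of `Q`, which does not exist; a positive one contradicts the minimality of `e₀`.
    have he : e < e₀ := (Nat.pow_lt_pow_iff_right (Fact.out : p.Prime).one_lt).1
      (Nat.lt_of_mul_lt_mul_right hlt)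
    rcases Nat.eq_zero_or_pos e with rfl | he0
    · refine hd.not_exists_limit hm (by simpa using hdeg) fun t' => ?_
      simpa using hval t'
    · have := hd.le_of_isWeaklyAffine e q' ⟨he0, by omega, hm, by rw [hdeg, hd.isLimitSeq.1],
        ⟨t, hdig⟩, hval⟩
      omega

end LimitData

end KeyPoly
end
noncomputable section
namespace KeyPoly

/-! ### Stable values and the valuation of a limit key polynomial -/

variable {K : Type*} [Field K] {w : K[X] → WithTop ℝ}

lemma stableValue_eq {s : ℕ → WithTop ℝ} {a : WithTop ℝ}
    (h : ∀ᶠ t in Filter.atTop, s t = a) : stableValue s = a := by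
  have hex : ∃ a, ∀ᶠ t in Filter.atTop, s t = a := ⟨a, h⟩
  rw [stableValue, dif_pos hex]
  obtain ⟨t, h1, h2⟩ := (hex.choose_spec.and h).exists
  rw [← h1, h2]

/-- The stable values of the polynomials. -/
abbrev limVal (w : K[X] → WithTop ℝ) (Qs : ℕ → K[X]) (βs : ℕ → ℝ) (c : K[X]) : WithTop ℝ :=
  stableValue fun t => truncVal w (Qs t) (βs t) c

namespace LimitData

variable {f Q q : K[X]} {β : ℝ} {δ p e₀ : ℕ} {Qs : ℕ → K[X]} {βs : ℕ → ℝ}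
  (hd : LimitData w f Q β δ p Qs βs e₀ q)
include hd

lemma monic : q.Monic := hd.isWeaklyAffine.2.2.1

lemma natDegree_eq : q.natDegree = p ^ e₀ * (Qs 0).natDegree := by
  rw [hd.isLimitSeq.1]; exact hd.isWeaklyAffine.2.2.2.1

lemma natDegree_pos [Fact p.Prime] : 0 < q.natDegree := by
  rw [hd.natDegree_eq]
  exact Nat.mul_pos (pow_pos (Fact.out : p.Prime).pos _) (hd.seq.natDegree_pos 0)

lemma degree_lt [Fact p.Prime] (t : ℕ) : (Qs t).degree < q.degree := by
  refine degree_lt_degree ?_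
  rw [hd.natDegree_eq, hd.seq.natDegree_eq]
  refine lt_mul_of_one_lt_left (hd.seq.natDegree_pos 0) ?_
  exact Nat.one_lt_pow (by have := hd.isWeaklyAffine.1; omega) (Fact.out : p.Prime).one_lt

lemma degree_pow (t : ℕ) : (Qs t ^ p ^ e₀).degree = q.degree := by
  rw [degree_eq_natDegree hd.monic.ne_zero, degree_eq_natDegree ((hd.seq.monic t).pow _).ne_zero,
    (hd.seq.monic t).natDegree_pow, hd.seq.natDegree_eq t, hd.natDegree_eq]

lemma degree_sub_pow_lt (t : ℕ) : (q - Qs t ^ p ^ e₀).degree < (Qs t ^ p ^ e₀).degree := by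
  have h := (hd.degree_pow t).symm
  refine (degree_sub_lt_left h hd.monic.ne_zero ?_).trans_eq h
  rw [hd.monic.leadingCoeff, ((hd.seq.monic t).pow _).leadingCoeff]

/-- The upper bound comes from the digit 1 of index `p ^ e₀`. For the lower one, the value of `q`
eventually exceeds `p ^ e₀ * βs t'` for every `t'`, while after `t` it can grow by less than `p ^ e₀
* (sup βs - βs t)`; then `t'` tends to infinity. -/
lemma val_key (t : ℕ) : seqVal w Qs βs t q = ((p ^ e₀ * βs t : ℝ) : WithTop ℝ) := by
  have hs := hd.seq
  refine le_antisymm ?_ ?_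
  · have h1 : digit (Qs t) q (p ^ e₀) = 1 := by
      have e : digit (Qs t) q (p ^ e₀) = digit (Qs t) (q - Qs t ^ p ^ e₀) (p ^ e₀) +
          digit (Qs t) (1 * Qs t ^ p ^ e₀) (p ^ e₀) := by
        rw [← digit_add (hs.monic t)]; congr 1; ring
      rw [e, digit_mul_pow (hs.monic t) (hs.key t).degree_pos (hs.key t).degree_one_lt, if_pos rfl,
        digit, (divByMonic_eq_zero_iff ((hs.monic t).pow _)).2 (hd.degree_sub_pow_lt t),
        zero_modByMonic, zero_add]
    have h2 := truncVal_le (β := βs t) (hs.monic t) (hs.natDegree_pos t) hs.key_zero.map_zero q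
      (p ^ e₀)
    rw [h1, (hs.key t).toIsKey.map_one, zero_add] at h2
    exact_mod_cast h2
  · obtain ⟨r, hr⟩ := (hs.isVal t).exists_real hd.monic.ne_zero
    rw [hr, WithTop.coe_le_coe]
    have h1 : Filter.Tendsto (fun t' => (p : ℝ) ^ e₀ * (βs t + βs t' - ⨆ t, βs t)) Filter.atTop
        (nhds ((p : ℝ) ^ e₀ * βs t)) := by
      have := ((hd.tendsto.const_add (βs t)).sub_const (⨆ t, βs t)).const_mul ((p : ℝ) ^ e₀)
      simpa using this
    refine le_of_tendsto h1 (Filter.Eventually.of_forall fun t' => ?_)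
    obtain ⟨s, hlt⟩ := hd.isWeaklyAffine.2.2.2.2.2 t'
    have h2 := (hlt.le.trans (hs.mono q (le_max_left s t))).trans
      (hs.val_le_add (D := p ^ e₀) hd.natDegree_eq.le (le_max_right s t))
    rw [hr, ← WithTop.coe_add, WithTop.coe_le_coe] at h2
    have h3 := hd.lt_sup (max s t)
    have h4 : (0 : ℝ) ≤ (p : ℝ) ^ e₀ := by positivity
    push_cast at h2
    nlinarith

/-- The valuations of the sequence in terms of the limit key polynomial. -/
lemma truncVal_eq [Fact p.Prime] (t : ℕ) :
    truncVal (seqVal w Qs βs t) q (p ^ e₀ * βs t) = seqVal w Qs βs t := by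
  have h := (hd.seq.key t).toIsKey.truncVal_shift (α := p ^ e₀) hd.monic hd.natDegree_pos
    (hd.degree_sub_pow_lt t) ?_
  · push_cast at h; exact h
  · refine (hd.seq.isVal t).le_sub ?_ ?_
    · rw [hd.val_key]; push_cast; exact le_rfl
    · exact (hd.seq.isVal t).coe_le_pow (hd.seq.key t).val_key.ge _

lemma eventually_val [Fact p.Prime] [CharP K p] {c : K[X]} (hc : c.degree < q.degree) :
    ∀ᶠ t in Filter.atTop, seqVal w Qs βs t c = limVal w Qs βs c := by
  have h : ∃ a, ∀ᶠ t in Filter.atTop, seqVal w Qs βs t c = a := by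
    by_cases h0 : c = 0
    · exact ⟨⊤, Filter.Eventually.of_forall fun t => by rw [h0, (hd.seq.isVal t).map_zero]⟩
    · obtain ⟨T, hT⟩ := hd.stable h0 hc
      exact ⟨_, (Filter.eventually_ge_atTop T).mono hT⟩
  obtain ⟨a, ha⟩ := h
  have : limVal w Qs βs c = a := stableValue_eq ha
  rwa [this]

lemma limVal_zero : limVal w Qs βs 0 = ⊤ :=
  stableValue_eq (Filter.Eventually.of_forall fun t => (hd.seq.isVal t).map_zero)

lemma val_le_limVal [Fact p.Prime] [CharP K p] {c : K[X]} (hc : c.degree < q.degree) (t : ℕ) :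
    seqVal w Qs βs t c ≤ limVal w Qs βs c := by
  obtain ⟨s, hs, hts⟩ := ((hd.eventually_val hc).and (Filter.eventually_ge_atTop t)).exists
  rw [← hs]; exact hd.seq.mono c hts

lemma limVal_of_degree_lt {c : K[X]} (hc : c.degree < Q.degree) : limVal w Qs βs c = w c :=
  stableValue_eq (Filter.Eventually.of_forall fun t =>
    hd.seq.val_of_lt t (by rwa [hd.isLimitSeq.1]))

/-- Together with the stable values, the limit key polynomial determines a valuation. -/
lemma limit_strictKey [Fact p.Prime] [CharP K p] :
    StrictKey (limVal w Qs βs) q (p ^ e₀ * ⨆ t, βs t) := by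
  have hs := hd.seq
  have hp : (0 : ℝ) < (p : ℝ) ^ e₀ := pow_pos (by exact_mod_cast (Fact.out : p.Prime).pos) _
  have hne : ∀ c : K[X], c ≠ 0 → c.degree < q.degree → limVal w Qs βs c ≠ ⊤ := fun c h0 hc => by
    obtain ⟨t, ht⟩ := (hd.eventually_val hc).exists
    rw [← ht]; exact (hs.isVal t).ne_top c h0
  have hmul : ∀ c d : K[X], c ≠ 0 → d ≠ 0 → c.degree < q.degree → d.degree < q.degree →
      limVal w Qs βs (c * d %ₘ q) = limVal w Qs βs c + limVal w Qs βs d ∧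
      limVal w Qs βs c + limVal w Qs βs d <
        limVal w Qs βs (c * d /ₘ q) + ((p ^ e₀ * ⨆ t, βs t : ℝ) : WithTop ℝ) := by
    intro c d hc0 hd0 hc hd'
    obtain ⟨a, ha⟩ : ∃ a : ℝ, limVal w Qs βs c = a :=
      ⟨_, (WithTop.coe_untop _ (hne c hc0 hc)).symm⟩
    obtain ⟨b, hb⟩ : ∃ b : ℝ, limVal w Qs βs d = b :=
      ⟨_, (WithTop.coe_untop _ (hne d hd0 hd')).symm⟩
    have hdiv := degree_mul_div_lt hd.monic hc hd'
    have hmod := degree_modByMonic_lt (c * d) hd.monic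
    obtain ⟨T, hT⟩ := Filter.eventually_atTop.1 (((hd.eventually_val hc).and
      (hd.eventually_val hd')).and ((hd.eventually_val hdiv).and (hd.eventually_val hmod)))
    -- The left side does not depend on `t`, and a finite second entry of the minimum increases
    -- strictly with `t`. Hence at `T + 1` the minimum is the first entry, and the second one, at
    -- the supremum, is strictly larger.
    have key : ∀ t ≥ T, ((a + b : ℝ) : WithTop ℝ) = min (limVal w Qs βs (c * d %ₘ q))
        (limVal w Qs βs (c * d /ₘ q) + ((p ^ e₀ * βs t : ℝ) : WithTop ℝ)) := by
      intro t ht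
      obtain ⟨⟨h1, h2⟩, h3, h4⟩ := hT t ht
      rw [← h3, ← h4]
      have h5 := truncVal_add_mul (β := p ^ e₀ * βs t) hd.monic hd.natDegree_pos
        (hs.isVal t).map_zero (c * d /ₘ q) hmod
      rw [modByMonic_add_div, hd.truncVal_eq t, (hs.isVal t).map_mul, h1, h2, ha, hb] at h5
      exact h5
    rw [ha, hb, ← WithTop.coe_add]
    have h1 := (key T le_rfl).le.trans (min_le_right _ _)
    cases hx : limVal w Qs βs (c * d /ₘ q) with
    | top =>
      refine ⟨?_, by rw [top_add]; exact WithTop.coe_lt_top _⟩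
      have := key T le_rfl
      rwa [hx, top_add, min_top_right, eq_comm] at this
    | coe u =>
      rw [hx] at h1
      norm_cast at h1
      push_cast at h1
      have h2 := hs.strictMono (Nat.lt_succ_self T)
      have h3 := hd.lt_sup T
      refine ⟨?_, ?_⟩
      · have h4 := key (T + 1) (by omega)
        rw [hx] at h4
        rcases min_choice (limVal w Qs βs (c * d %ₘ q))
          ((u : WithTop ℝ) + ((p ^ e₀ * βs (T + 1) : ℝ) : WithTop ℝ)) with h5 | h5
        · rw [← h5, h4]
        · rw [h5] at h4
          norm_cast at h4
          push_cast at h4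
          nlinarith
      · norm_cast
        push_cast
        nlinarith
  refine ⟨⟨hd.monic, hd.natDegree_pos, hd.limVal_zero, hne, fun c d hc hd' => ?_,
    fun c d hc hd' => ?_, fun c d hc hd' => ?_⟩, fun c d hc0 hd0 hc hd' =>
      (hmul c d hc0 hd0 hc hd').2⟩
  · obtain ⟨t, ⟨h1, h2⟩, h3⟩ := (((hd.eventually_val hc).and (hd.eventually_val hd')).and
      (hd.eventually_val ((degree_add_le c d).trans_lt (max_lt hc hd')))).exists
    rw [← h1, ← h2, ← h3]; exact (hs.isVal t).map_add c d
  · by_cases hc0 : c = 0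
    · rw [hc0, zero_mul, zero_modByMonic, hd.limVal_zero, top_add]
    by_cases hd0 : d = 0
    · rw [hd0, mul_zero, zero_modByMonic, hd.limVal_zero, add_top]
    exact (hmul c d hc0 hd0 hc hd').1
  · by_cases hc0 : c = 0
    · rw [hc0, zero_mul, zero_divByMonic, hd.limVal_zero, top_add, top_add]
    by_cases hd0 : d = 0
    · rw [hd0, mul_zero, zero_divByMonic, hd.limVal_zero, add_top, top_add]
    exact (hmul c d hc0 hd0 hc hd').2.le

/-- The limit valuation dominates the valuations of the sequence. -/
lemma val_le_limit [Fact p.Prime] [CharP K p] (t : ℕ) {β' : ℝ} (hβ' : p ^ e₀ * ⨆ t, βs t ≤ β')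
    (h : K[X]) : seqVal w Qs βs t h ≤ truncVal (limVal w Qs βs) q β' h := by
  rw [le_truncVal_iff hd.monic hd.natDegree_pos hd.limVal_zero]
  intro j
  rw [← hd.truncVal_eq t]
  refine (truncVal_le hd.monic hd.natDegree_pos (hd.seq.isVal t).map_zero h j).trans
    (add_le_add (hd.val_le_limVal (degree_digit_lt hd.monic h j) t) (WithTop.coe_le_coe.2 ?_))
  have h1 := hd.lt_sup t
  have h2 : (p : ℝ) ^ e₀ * βs t ≤ (p : ℝ) ^ e₀ * ⨆ t, βs t := by gcongr
  exact mul_le_mul_of_nonneg_left (h2.trans hβ') (Nat.cast_nonneg j)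

/-- The height of the characteristic vertex after passing to the limit. -/
lemma topIndex_mul [Fact p.Prime] [CharP K p] :
    p ^ e₀ * topIndex (limVal w Qs βs) q (p ^ e₀ * ⨆ t, βs t) f = δ := by
  have hs := hd.seq
  have hk := hd.limit_strictKey
  have hp : (0 : ℝ) < (p : ℝ) ^ e₀ := pow_pos (by exact_mod_cast (Fact.out : p.Prime).pos) _
  set B := ⨆ t, βs t with hB
  set J := topIndex (limVal w Qs βs) q (p ^ e₀ * B) f with hJ
  have hJmem : J ∈ sideSet (limVal w Qs βs) q (p ^ e₀ * B) f := topIndex_mem _ _ _ _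
  have hJ0 := hk.digit_topIndex_ne_zero hd.ne_zero hJ.symm
  obtain ⟨a, ha⟩ : ∃ a : ℝ, limVal w Qs βs (digit q f J) = a :=
    ⟨_, (WithTop.coe_untop _ (hk.ne_top _ hJ0 (degree_digit_lt hd.monic f J))).symm⟩
  have hJv := (mem_sideSet_iff.1 hJmem).2
  -- Let the slope approach `p ^ e₀ * B` from below. Among the points on the side at `B` the
  -- uppermost, `J`, becomes the least, and points off this side stay above near `B`. So the term of
  -- index `J` gives the value of `f` for late `t`.
  have hev : ∀ᶠ t in Filter.atTop, seqVal w Qs βs t f =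
      ((a + J * (p ^ e₀ * βs t) : ℝ) : WithTop ℝ) := by
    have h1 : ∀ᶠ t in Filter.atTop, ∀ j ∈ Finset.range (f.natDegree + 1),
        seqVal w Qs βs t (digit q f j) = limVal w Qs βs (digit q f j) ∧
        ((a + J * (p ^ e₀ * βs t) : ℝ) : WithTop ℝ) ≤
          limVal w Qs βs (digit q f j) + ((j * (p ^ e₀ * βs t) : ℝ) : WithTop ℝ) := by
      rw [Filter.eventually_all_finset]
      intro j hj
      refine (hd.eventually_val (degree_digit_lt hd.monic f j)).and ?_
      have h2 := truncVal_le (β := p ^ e₀ * B) hd.monic hd.natDegree_pos hk.map_zero f j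
      rw [← hJv, ha] at h2
      cases hx : limVal w Qs βs (digit q f j) with
      | top => simp
      | coe r =>
        rw [hx] at h2
        norm_cast at h2
        push_cast at h2
        rcases h2.eq_or_lt with h3 | h3
        · refine Filter.Eventually.of_forall fun t => ?_
          have hjm : j ∈ sideSet (limVal w Qs βs) q (p ^ e₀ * B) f := by
            refine mem_sideSet_iff.2 ⟨by simpa [Nat.lt_succ_iff] using hj, ?_⟩
            rw [← hJv, ha, hx, ← WithTop.coe_add, ← WithTop.coe_add, h3]
          have h4 : (j : ℝ) ≤ J := Nat.cast_le.2 (sideSet_subset_range hjm)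
          have h5 := hd.lt_sup t
          rw [← hB] at h5
          norm_cast
          push_cast
          have h6 : 0 ≤ (J - j : ℝ) * (p ^ e₀ * (B - βs t)) :=
            mul_nonneg (by linarith) (mul_nonneg hp.le (by linarith))
          linarith
        · have hl : ∀ (x : ℝ) (n : ℕ), Filter.Tendsto (fun t => x + n * (p ^ e₀ * βs t))
              Filter.atTop (nhds (x + n * (p ^ e₀ * B))) := fun x n =>
            ((hd.tendsto.const_mul _).const_mul _).const_add _
          filter_upwards [(hl a J).eventually_lt (hl r j) h3] with t ht
          exact_mod_cast ht.le
    filter_upwards [h1] with t ht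
    rw [← hd.truncVal_eq t]
    refine le_antisymm ?_ (Finset.le_inf fun j hj => ?_)
    · refine (truncVal_le hd.monic hd.natDegree_pos (hs.isVal t).map_zero f J).trans_eq ?_
      rw [(ht J (by simpa [Nat.lt_succ_iff] using (mem_sideSet_iff.1 hJmem).1)).1, ha]; rfl
    · rw [(ht j hj).1]; exact (ht j hj).2
  -- Two affine formulas in `βs t` for the same value; two different `t` suffice to equate the
  -- slopes `δ` and `p ^ e₀ * J`.
  obtain ⟨A, hA⟩ := hd.exists_val_eq
  obtain ⟨T, hT⟩ := Filter.eventually_atTop.1 hev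
  have h1 := hT T le_rfl
  have h2 := hT (T + 1) (by omega)
  rw [hA, WithTop.coe_inj] at h1 h2
  have h3 := hs.strictMono (Nat.lt_succ_self T)
  have h4 : (δ : ℝ) * (βs (T + 1) - βs T) = (p ^ e₀ * J) * (βs (T + 1) - βs T) := by linarith
  have h5 := mul_right_cancel₀ (sub_pos.2 h3).ne' h4
  exact_mod_cast h5.symm

end LimitData

end KeyPoly
end
noncomputable section
namespace KeyPoly

/-! ### The sides of the Newton polygon -/

variable {K : Type*} [Field K] {w : K[X] → WithTop ℝ} {Q f : K[X]} {β β' B : ℝ}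

/-- The height of the lower endpoint of the side determined by `β`. -/
def botIndex (w : K[X] → WithTop ℝ) (Q : K[X]) (β : ℝ) (h : K[X]) : ℕ :=
  sInf {j | j ∈ sideSet w Q β h}

lemma botIndex_mem (w : K[X] → WithTop ℝ) (Q : K[X]) (β : ℝ) (h : K[X]) :
    botIndex w Q β h ∈ sideSet w Q β h :=
  exists_min_sideSet w Q β h

lemma botIndex_le {j : ℕ} (hj : j ∈ sideSet w Q β f) : botIndex w Q β f ≤ j := Nat.sInf_le hj

lemma botIndex_le_topIndex : botIndex w Q β f ≤ topIndex w Q β f :=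
  sideSet_subset_range (botIndex_mem w Q β f)

lemma botIndex_eq_topIndex (h : ¬ DeterminesSide w Q β f) :
    botIndex w Q β f = topIndex w Q β f := by
  rw [DeterminesSide, not_le, Nat.lt_succ_iff, Finset.card_le_one] at h
  exact h _ (botIndex_mem w Q β f) _ (topIndex_mem w Q β f)

lemma determinesSide_of_lt {j : ℕ} (hj : j ∈ sideSet w Q β f) (hlt : j < topIndex w Q β f) :
    DeterminesSide w Q β f :=
  Finset.one_lt_card.2 ⟨j, hj, _, topIndex_mem w Q β f, hlt.ne⟩

namespace IsKey

lemma exists_real_of_mem (hk : IsKey w Q β) (hf : f ≠ 0) {j : ℕ} (hj : j ∈ sideSet w Q β f) :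
    ∃ r : ℝ, w (digit Q f j) = r := by
  refine ⟨_, (WithTop.coe_untop _ fun h => ?_).symm⟩
  have h1 := (mem_sideSet_iff.1 hj).2
  rw [h, top_add] at h1
  exact hk.val_ne_top f hf h1.symm

/-- Convexity: a larger slope belongs to a lower part of the polygon. -/
lemma le_of_mem_sideSet (hk : IsKey w Q β) (hk' : IsKey w Q β') (hf : f ≠ 0) (hβ : β < β') {i j : ℕ}
    (hi : i ∈ sideSet w Q β f) (hj : j ∈ sideSet w Q β' f) : j ≤ i := by
  obtain ⟨a, ha⟩ := hk.exists_real_of_mem hf hi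
  obtain ⟨b, hb⟩ := hk'.exists_real_of_mem hf hj
  have h1 := truncVal_le (β := β) hk.monic hk.natDegree_pos hk.map_zero f j
  have h2 := truncVal_le (β := β') hk.monic hk.natDegree_pos hk.map_zero f i
  rw [← (mem_sideSet_iff.1 hi).2, ha, hb] at h1
  rw [← (mem_sideSet_iff.1 hj).2, ha, hb] at h2
  norm_cast at h1 h2
  by_contra! h
  have h3 : (i : ℝ) < j := by exact_mod_cast h
  nlinarith

/-- The next side of the Newton polygon. -/
lemma exists_next_side (hk : IsKey w Q B) (hf : f ≠ 0) (h0 : digit Q f 0 ≠ 0)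
    (hB : botIndex w Q B f ≠ 0) : ∃ β > B, botIndex w Q β f < botIndex w Q B f ∧
      topIndex w Q β f = botIndex w Q B f := by
  classical
  set θ := botIndex w Q B f with hθ
  have hθmem := botIndex_mem w Q B f
  rw [← hθ] at hθmem
  obtain ⟨a, ha⟩ := hk.exists_real_of_mem hf hθmem
  set J := (Finset.range θ).filter fun j => w (digit Q f j) ≠ ⊤ with hJ
  -- `slope j` belongs to the line joining the point at height `j` to the lower endpoint at height
  -- `θ`. The least of them gives the next side; height 0 is a candidate because the zeroth digit is
  -- nonzero.
  set slope : ℕ → ℝ := fun j => ((w (digit Q f j)).untopD 0 - a) / (θ - j) with hslope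
  obtain ⟨j₀, hj₀, hmin⟩ := J.exists_min_image slope ⟨0, by
    rw [hJ, Finset.mem_filter, Finset.mem_range]
    exact ⟨Nat.pos_of_ne_zero hB, hk.ne_top _ h0 (degree_digit_lt hk.monic f 0)⟩⟩
  rw [hJ, Finset.mem_filter, Finset.mem_range] at hj₀
  obtain ⟨b, hb⟩ : ∃ b : ℝ, w (digit Q f j₀) = b := ⟨_, (WithTop.coe_untop _ hj₀.2).symm⟩
  set β := slope j₀ with hβ
  have hj₀θ : (0 : ℝ) < θ - j₀ := sub_pos.2 (by exact_mod_cast hj₀.1)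
  have hbβ : b + j₀ * β = a + θ * β := by
    rw [hβ, hslope]
    simp only [hb, WithTop.untopD_coe]
    field_simp
    ring
  have hle : ∀ j, ((a + θ * B : ℝ) : WithTop ℝ) ≤
      w (digit Q f j) + ((j * B : ℝ) : WithTop ℝ) := fun j => by
    have := truncVal_le (β := B) hk.monic hk.natDegree_pos hk.map_zero f j
    rw [← (mem_sideSet_iff.1 hθmem).2, ha] at this
    exact this
  have hj₀S : j₀ ∉ sideSet w Q B f := fun h => absurd (botIndex_le h) (not_le.2 hj₀.1)
  have hgt : B < β := by
    have h1 := hle j₀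
    have h2 : a + θ * B ≠ b + j₀ * B := fun h => hj₀S (mem_sideSet_iff.2
      ⟨hj₀.1.le.trans (mem_sideSet_iff.1 hθmem).1, by
        rw [← (mem_sideSet_iff.1 hθmem).2, ha, hb, ← WithTop.coe_add, ← h]; rfl⟩)
    rw [hb] at h1
    norm_cast at h1
    have h3 := lt_of_le_of_ne h1 h2
    by_contra! h4
    nlinarith
  have hmin' : ∀ j, ((a + θ * β : ℝ) : WithTop ℝ) ≤
      w (digit Q f j) + ((j * β : ℝ) : WithTop ℝ) := fun j => by
    cases hx : w (digit Q f j) with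
    | top => simp
    | coe r =>
      rcases Nat.lt_or_ge j θ with hj | hj
      · have h1 := hmin j (by rw [hJ, Finset.mem_filter, Finset.mem_range, hx]; simp [hj])
        have hjδ : (0 : ℝ) < θ - j := sub_pos.2 (by exact_mod_cast hj)
        have h2 : β * (θ - j) ≤ r - a := by
          rw [← le_div_iff₀ hjδ]
          rw [hslope] at h1
          simp only [hx, WithTop.untopD_coe] at h1
          exact h1
        norm_cast
        linarith
      · have h1 := hle j
        rw [hx] at h1
        norm_cast at h1 ⊢
        have h2 : (θ : ℝ) ≤ j := by exact_mod_cast hj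
        nlinarith
  have hk' : IsKey w Q β := (hk.strictKey hgt).toIsKey
  have hval : truncVal w Q β f = ((a + θ * β : ℝ) : WithTop ℝ) := by
    refine le_antisymm ?_
      ((le_truncVal_iff hk.monic hk.natDegree_pos hk.map_zero).2 fun j => hmin' j)
    refine (truncVal_le hk.monic hk.natDegree_pos hk.map_zero f θ).trans_eq ?_
    rw [ha]; rfl
  have hθ' : θ ∈ sideSet w Q β f :=
    mem_sideSet_iff.2 ⟨(mem_sideSet_iff.1 hθmem).1, by rw [hval, ha]; rfl⟩
  have hj₀' : j₀ ∈ sideSet w Q β f :=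
    mem_sideSet_iff.2 ⟨hj₀.1.le.trans (mem_sideSet_iff.1 hθmem).1, by rw [hval, hb, ← hbβ]; rfl⟩
  exact ⟨β, hgt, (botIndex_le hj₀').trans_lt hj₀.1, le_antisymm
    (hk.le_of_mem_sideSet hk' hf hgt hθmem (topIndex_mem w Q β f)) (sideSet_subset_range hθ')⟩

/-- The heights of the sides of slope greater than `B` add up to the height of the lower endpoint
of the side determined by `B`. -/
lemma exists_sides (hk : IsKey w Q B) (hf : f ≠ 0) (h0 : digit Q f 0 ≠ 0) :
    ∃ s : Finset ℝ, (∀ β, β ∈ s ↔ B < β ∧ DeterminesSide w Q β f) ∧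
      ∑ β ∈ s, (topIndex w Q β f - botIndex w Q β f) = botIndex w Q B f := by
  classical
  induction hn : botIndex w Q B f using Nat.strong_induction_on generalizing B with
  | _ n ih =>
    have hk' : ∀ {β}, B < β → IsKey w Q β := fun h => (hk.strictKey h).toIsKey
    by_cases hB : botIndex w Q B f = 0
    · refine ⟨∅, fun β => ⟨fun h => absurd h (Finset.notMem_empty _), fun ⟨h1, h2⟩ => ?_⟩, by
        rw [Finset.sum_empty, ← hn, hB]⟩
      obtain ⟨i, hi, j, hj, hne⟩ := Finset.one_lt_card.1 h2
      have h3 : ∀ {j}, j ∈ sideSet w Q β f → j = 0 := fun hj => Nat.le_zero.1 (hB ▸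
        hk.le_of_mem_sideSet (hk' h1) hf h1 (botIndex_mem w Q B f) hj)
      exact absurd ((h3 hi).trans (h3 hj).symm) hne
    · obtain ⟨β₁, hβ₁, hlt, htop⟩ := hk.exists_next_side hf h0 hB
      obtain ⟨s, hs, hsum⟩ := ih _ (hn ▸ hlt) (hk' hβ₁) rfl
      have hside : DeterminesSide w Q β₁ f :=
        determinesSide_of_lt (botIndex_mem w Q β₁ f) (htop ▸ hlt)
      have hnot : β₁ ∉ s := fun h => lt_irrefl _ ((hs _).1 h).1
      refine ⟨insert β₁ s, fun β => ?_, ?_⟩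
      · rw [Finset.mem_insert, hs]
        constructor
        · rintro (rfl | ⟨h1, h2⟩)
          · exact ⟨hβ₁, hside⟩
          · exact ⟨hβ₁.trans h1, h2⟩
        · rintro ⟨h1, h2⟩
          rcases lt_trichotomy β β₁ with h3 | rfl | h3
          · exfalso
            obtain ⟨i, hi, j, hj, hne⟩ := Finset.one_lt_card.1 h2
            have h4 : ∀ {j}, j ∈ sideSet w Q β f → j = botIndex w Q B f := fun hj => le_antisymm
              (hk.le_of_mem_sideSet (hk' h1) hf h1 (botIndex_mem w Q B f) hj)
              (htop ▸ (hk' h1).le_of_mem_sideSet (hk' hβ₁) hf h3 hj (topIndex_mem w Q β₁ f))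
            exact hne ((h4 hi).trans (h4 hj).symm)
          · exact Or.inl rfl
          · exact Or.inr ⟨h3, h2⟩
      · rw [Finset.sum_insert hnot, hsum, htop, hn]
        rw [hn] at hlt; omega

/-- The heights of the sides of slope at least `B` add up to the height of the upper endpoint
of the side determined by `B`. -/
lemma exists_sides_of_le (hk : IsKey w Q B) (hf : f ≠ 0) (h0 : digit Q f 0 ≠ 0) :
    ∃ s : Finset ℝ, (∀ β, β ∈ s ↔ B ≤ β ∧ DeterminesSide w Q β f) ∧
      ∑ β ∈ s, (topIndex w Q β f - botIndex w Q β f) = topIndex w Q B f := by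
  classical
  obtain ⟨s, hs, hsum⟩ := hk.exists_sides hf h0
  by_cases hB : DeterminesSide w Q B f
  · have hnot : B ∉ s := fun h => lt_irrefl _ ((hs _).1 h).1
    refine ⟨insert B s, fun β => ?_, ?_⟩
    · rw [Finset.mem_insert, hs]
      constructor
      · rintro (rfl | ⟨h1, h2⟩)
        · exact ⟨le_rfl, hB⟩
        · exact ⟨h1.le, h2⟩
      · rintro ⟨h1, h2⟩
        rcases h1.eq_or_lt with rfl | h3
        · exact Or.inl rfl
        · exact Or.inr ⟨h3, h2⟩
    · rw [Finset.sum_insert hnot, hsum, Nat.sub_add_cancel botIndex_le_topIndex]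
  · refine ⟨s, fun β => ?_, by rw [hsum, botIndex_eq_topIndex hB]⟩
    rw [hs]
    refine ⟨fun h => ⟨h.1.le, h.2⟩, fun h => ⟨lt_of_le_of_ne h.1 ?_, h.2⟩⟩
    rintro rfl; exact hB h.2

end IsKey

end KeyPoly
end
noncomputable section
namespace KeyPoly

/-! ### The vertices of the tree -/

variable {K : Type*} [Field K] {w : K[X] → WithTop ℝ}

/-- The initial form of `c` for a valuation `μ` is obtained from the initial forms of the terms
of the expansion of `c`, provided that `μ` does not decrease the values of the terms. -/
lemma IsKey.inForm_mem {P : K[X]} {β : ℝ} (hk : IsKey w P β) {μ : K[X] → WithTop ℝ} (hμ : IsVal μ)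
    {α : ℕ} {c : K[X]} (hc : c.natDegree < α * P.natDegree) (hce : μ c = truncVal w P β c)
    (hle : ∀ x : K[X], x.degree < (P ^ α).degree → truncVal w P β x ≤ μ x) (R : Subring (Gr μ))
    (hlow : ∀ d : K[X], d.degree < P.degree → inForm μ d ∈ R) (hP : 2 ≤ α → inForm μ P ∈ R) :
    inForm μ c ∈ R := by
  by_cases h0 : c = 0
  · rw [h0, (inForm_eq_zero_iff hμ).2 rfl]; exact R.zero_mem
  obtain ⟨σ, hσ⟩ := hμ.exists_real h0
  have hsum : ∑ j ∈ Finset.range α, digit P c j * P ^ j = c := by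
    conv_rhs => rw [← sum_digit_add hk.monic c α]
    rw [(divByMonic_eq_zero_iff (hk.monic.pow α)).2, mul_zero, add_zero]
    apply degree_lt_degree
    rwa [hk.monic.natDegree_pow]
  have hterm : ∀ j ∈ Finset.range α, (σ : WithTop ℝ) ≤ μ (digit P c j * P ^ j) := fun j hj => by
    refine le_trans ?_ (hle _ ?_)
    · rw [mul_comm, hk.val_key_pow_mul, hk.val_of_degree_lt (degree_digit_lt hk.monic c j), ← hσ, hce]
      exact truncVal_le hk.monic hk.natDegree_pos hk.map_zero c j
    · by_cases hd : digit P c j = 0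
      · rw [hd, zero_mul, degree_zero]
        exact bot_lt_iff_ne_bot.2 (degree_ne_bot.2 (hk.monic.pow _).ne_zero)
      refine degree_lt_degree ?_
      rw [natDegree_mul hd (hk.monic.pow _).ne_zero, hk.monic.natDegree_pow, hk.monic.natDegree_pow]
      have h1 := natDegree_lt_natDegree hd (degree_digit_lt hk.monic c j)
      have h2 : j + 1 ≤ α := by simpa [Nat.succ_le_iff] using hj
      calc _ < (j + 1) * P.natDegree := by rw [add_mul]; omega
        _ ≤ _ := Nat.mul_le_mul_right _ h2
  rw [inForm_eq_hom hσ, ← hsum, hom_sum hμ _ hterm]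
  refine R.sum_mem fun j hj => ?_
  rcases (hterm j hj).lt_or_eq with h1 | h1
  · rw [(hom_eq_zero_iff hμ h1.le).2 h1]; exact R.zero_mem
  · rw [← inForm_eq_hom h1.symm, inForm_mul hμ, inForm_pow hμ]
    refine R.mul_mem (hlow _ (degree_digit_lt hk.monic c j)) ?_
    rcases Nat.eq_zero_or_pos j with rfl | hj0
    · rw [pow_zero]; exact R.one_mem
    · exact R.pow_mem (hP (by have := Finset.mem_range.1 hj; omega)) _

/-- The liftings of linear factors. -/
lemma Lifts.val_sub_of_natDegree_eq_one {Q Q' : K[X]} {β τ : ℝ}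
    {A : Subring (Gr (truncVal w Q β))} {g : A[X]} (hk : StrictKey w Q β) (hA : IsLowRing w Q β A)
    (hL : Lifts g Q') (hg : g.Monic) (hgh : IsHP (lowHom w Q β A) β τ g) (hgX : g ≠ X)
    (h1 : g.natDegree = 1) : (Q' - Q).degree < Q.degree ∧ w (Q' - Q) = β := by
  have hz : (Q' - Q).degree < Q.degree := by
    have := hL.degree_sub_lt hk; rwa [h1, pow_one] at this
  refine ⟨hz, ?_⟩
  have hv := hL.val_eq hk hA hg hgh
  have hmem : 0 ∈ sideSet w Q β Q' := by
    rw [← (hL.rep hk hA hg hgh).coeff_ne_zero_iff hk hv]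
    intro h0
    refine hgX ?_
    have h2 := hg.as_sum
    rw [h1] at h2
    simpa [h0] using h2
  have h3 := (mem_sideSet_iff.1 hmem).2
  have h4 : digit Q Q' 0 = Q' - Q := by
    have h5 : Q' = (Q' - Q) + Q * 1 := by ring
    conv_lhs => rw [h5]
    exact digit_add_mul_zero hk.monic _ hz
  rw [h4, hv, h1] at h3
  simpa using h3

namespace Branch

variable {v : AddValuation K (WithTop ℝ)} {f : K[X]} {b : Branch K}

/-- The properties of a vertex which are proved by induction. -/
structure Good (v : AddValuation K (WithTop ℝ)) (f : K[X]) (b : Branch K) : Prop where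
  key : ∀ β, 0 ≤ β → b.CondStar β → StrictKey (b.coeffVal v) b.key β
  -- A preceding key polynomial may have the same degree as the present one, namely when `α = 1`.
  -- This field provides a polynomial of smaller degree with the same initial form, so that the
  -- coefficient ring contains only sums of low initial forms.
  approx : ∀ P ∈ b.preceding, ∃ c : K[X], c.degree < b.key.degree ∧
    ∀ β, 0 ≤ β → b.CondStar β → b.coeffVal v c < b.val v β (P - c)
  -- The valuation is left free above the degree of the key polynomial, because the value of the key
  -- polynomial is not fixed yet and later vertices replace the valuation.
  gen : ∀ μ : K[X] → WithTop ℝ, IsVal μ →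
    (∀ c : K[X], c.degree < b.key.degree → μ c = b.coeffVal v c) →
    ∀ c : K[X], c.degree < b.key.degree → inForm μ c ∈
      Subring.closure (Set.range (fun a : K => inForm μ (C a)) ∪ inForm μ '' b.preceding)
  sides : digit b.key f 0 ≠ 0 → ∃ s : Finset ℝ, (∀ β, β ∈ s ↔ b.Admissible v f β) ∧
    ∑ β ∈ s, (topIndex (b.coeffVal v) b.key β f - botIndex (b.coeffVal v) b.key β f) = b.theta v f

/-- The initial forms of low degree lie in the coefficient ring by `gen`. Conversely `approx` turns
its generators into such forms, and their additive span is closed under products. -/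
lemma Good.isLowRing (hb : b.Good v f) {β : ℝ} (h0 : 0 ≤ β) (hβ : b.CondStar β) :
    IsLowRing (b.coeffVal v) b.key β (b.coeffRing v β) where
  inForm_mem c hc := hb.gen _ (hb.key β h0 hβ).isVal
    (fun c hc => (hb.key β h0 hβ).toIsKey.val_of_degree_lt hc) c hc
  mem_closure y hy := by
    have hk := hb.key β h0 hβ
    have hlow : ∀ c : K[X], c.degree < b.key.degree → inForm (b.val v β) c ∈ AddSubgroup.closure
        {y | ∃ c : K[X], c.degree < b.key.degree ∧
          y = inForm (truncVal (b.coeffVal v) b.key β) c} :=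
      fun c hc => AddSubgroup.subset_closure ⟨c, hc, rfl⟩
    induction hy using Subring.closure_induction with
    | mem y hy =>
      rcases hy with ⟨a, rfl⟩ | ⟨P, hP, rfl⟩
      · exact hlow _ (degree_C_le.trans_lt hk.degree_pos)
      · obtain ⟨c, hc, hlt⟩ := hb.approx P hP
        have h1 := hlt β h0 hβ
        rw [← hk.toIsKey.val_of_degree_lt hc] at h1
        have h2 : inForm (b.val v β) P = inForm (b.val v β) c := inForm_eq_of_lt hk.isVal h1
        rw [h2]; exact hlow c hc
    | zero => exact AddSubgroup.zero_mem _
    | one =>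
      have := hlow 1 hk.degree_one_lt
      rwa [show inForm (b.val v β) 1 = 1 from inForm_one hk.isVal] at this
    | add y z _ _ hy hz => exact AddSubgroup.add_mem _ hy hz
    | neg y _ hy => exact AddSubgroup.neg_mem _ hy
    | mul y z _ _ hy hz => exact hk.mul_mem_closure hy hz

lemma IsLift.lifts {β : ℝ} {g : (b.coeffRing v β)[X]} {Q' : K[X]} (h : b.IsLift v β g Q') :
    Lifts (w := b.coeffVal v) (Q := b.key) (β := β) g Q' :=
  ⟨h.1, h.2.1, h.2.2⟩

lemma closure_mono {μ : K[X] → WithTop ℝ} {S T : Set K[X]} (h : S ⊆ T) :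
    Subring.closure (Set.range (fun a : K => inForm μ (C a)) ∪ inForm μ '' S) ≤
      Subring.closure (Set.range (fun a : K => inForm μ (C a)) ∪ inForm μ '' T) :=
  Subring.closure_mono (Set.union_subset_union_right _ (Set.image_mono h))

lemma inForm_mem_closure {μ : K[X] → WithTop ℝ} {S : Set K[X]} {P : K[X]} (h : P ∈ S) :
    inForm μ P ∈ Subring.closure (Set.range (fun a : K => inForm μ (C a)) ∪ inForm μ '' S) :=
  Subring.subset_closure (Or.inr ⟨P, h, rfl⟩)

lemma digit_X (h : K[X]) (j : ℕ) : digit X h j = C (h.coeff j) := by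
  conv_lhs => rw [h.as_sum_range_C_mul_X_pow]
  rw [digit_sum_mul_pow monic_X (by rw [degree_X]; exact zero_lt_one) _ (fun i => C (h.coeff i))
    (fun i _ => degree_C_le.trans_lt (by rw [degree_X]; exact zero_lt_one))]
  split_ifs with hj
  · rfl
  · rw [coeff_eq_zero_of_natDegree_lt (by simpa [Nat.lt_succ_iff] using hj), C_0]

lemma strictKey_root (β : ℝ) : StrictKey ((root : Branch K).coeffVal v) X β := by
  have hC : ∀ c : K[X], c.degree < (X : K[X]).degree → c = C (c.coeff 0) := fun c hc =>
    eq_C_of_degree_le_zero (by rw [degree_X] at hc; exact Nat.WithBot.lt_one_iff_le_zero.1 hc)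
  have hmul : ∀ a b : K, (C a * C b : K[X]).degree < (X : K[X]).degree := fun a b => by
    rw [← C_mul, degree_X]; exact degree_C_le.trans_lt zero_lt_one
  refine ⟨⟨monic_X, by rw [natDegree_X]; exact Nat.one_pos, ?_, fun c h0 hc => ?_,
    fun c d _ _ => ?_, fun c d hc hd => ?_, fun c d hc hd => ?_⟩, fun c d hc0 hd0 hc hd => ?_⟩
  · simp [coeffVal]
  · simp only [coeffVal]
    rw [ne_eq, AddValuation.top_iff]
    intro h
    rw [hC c hc, h, C_0] at h0
    exact h0 rfl
  · simp only [coeffVal, coeff_add]; exact v.map_add _ _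
  · rw [hC c hc, hC d hd, (modByMonic_eq_self_iff monic_X).2 (hmul _ _)]
    simp [coeffVal]
  · rw [hC c hc, hC d hd, (divByMonic_eq_zero_iff monic_X).2 (hmul _ _)]
    simp [coeffVal]
  · have hne : ∀ c : K[X], c ≠ 0 → c.degree < (X : K[X]).degree → v (c.coeff 0) ≠ ⊤ :=
      fun c h0 hc => by
        rw [ne_eq, AddValuation.top_iff]
        intro h
        rw [hC c hc, h, C_0] at h0
        exact h0 rfl
    have h1 := hne c hc0 hc
    have h2 := hne d hd0 hd
    have h3 : c * d /ₘ X = 0 := by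
      rw [hC c hc, hC d hd]; exact (divByMonic_eq_zero_iff monic_X).2 (hmul _ _)
    rw [h3]
    simp only [coeffVal, coeff_zero, AddValuation.map_zero, top_add]
    exact WithTop.add_lt_top.2 ⟨lt_top_iff_ne_top.2 h1, lt_top_iff_ne_top.2 h2⟩

lemma good_root (hf : f.Monic) (hpos : ∀ i < f.natDegree, 0 < v (f.coeff i)) :
    (root : Branch K).Good v f where
  key β _ _ := strictKey_root β
  approx P hP := absurd hP (Set.notMem_empty P)
  gen μ _ _ c hc := by
    have e : c = C (c.coeff 0) := eq_C_of_degree_le_zero (by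
      rw [key, degree_X] at hc; exact Nat.WithBot.lt_one_iff_le_zero.1 hc)
    rw [e]
    exact Subring.subset_closure (Or.inl ⟨_, rfl⟩)
  sides h0 := by
    have hk := (strictKey_root (v := v) (K := K) 0).toIsKey
    obtain ⟨s, hs, hsum⟩ := hk.exists_sides_of_le hf.ne_zero h0
    refine ⟨s, fun β => ?_, hsum.trans ?_⟩
    · rw [hs, Admissible, CondStar, and_true]; rfl
    · have hterm : ∀ j, (root : Branch K).coeffVal v (digit X f j) + ((j * (0 : ℝ) : ℝ) : WithTop ℝ)
          = v (f.coeff j) := fun j => by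
        rw [digit_X]; simp [coeffVal]
      -- No coefficient has negative value and the leading one has value 0, so for slope 0 the upper
      -- endpoint is at height `deg f`; the sides with `β ≥ 0` then have total height `deg f`.
      have hval : truncVal ((root : Branch K).coeffVal v) X 0 f = 0 := by
        refine le_antisymm ?_ ((le_truncVal_iff monic_X (by simp) hk.map_zero).2 fun j => ?_)
        · have := truncVal_le (β := 0) monic_X (by simp) hk.map_zero f f.natDegree
          rwa [hterm, coeff_natDegree, hf.leadingCoeff, v.map_one] at this
        · rw [hterm]
          rcases lt_trichotomy j f.natDegree with h | rfl | h
          · exact (hpos j h).le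
          · rw [coeff_natDegree, hf.leadingCoeff, v.map_one]
          · rw [coeff_eq_zero_of_natDegree_lt h, v.map_zero]; exact le_top
      refine le_antisymm (mem_sideSet_iff.1 (topIndex_mem _ _ _ _)).1 (sideSet_subset_range ?_)
      refine mem_sideSet_iff.2 ⟨le_rfl, ?_⟩
      refine (hterm f.natDegree).trans ?_
      rw [coeff_natDegree, hf.leadingCoeff, v.map_one, hval]

section Step

variable {β : ℝ} {g : (b.coeffRing v β)[X]} {Q' : K[X]}

lemma alpha_step (hb0 : 0 < b.key.natDegree) (hl : b.IsLift v β g Q') :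
    (step b β Q').alpha = g.natDegree := by
  rw [alpha, hl.2.1, Nat.mul_div_cancel _ hb0]

lemma good_step (hb : b.Good v f) (hf : f ≠ 0) (hβ : b.Admissible v f β)
    (hg : b.IsFactor v f β g) (hl : b.IsLift v β g Q') : (step b β Q').Good v f := by
  have hk := hb.key β hβ.1 hβ.2.2
  have hA := hb.isLowRing hβ.1 hβ.2.2
  obtain ⟨T, m, hT, hThom, -, -⟩ := hk.exists_factors hA hf
  obtain ⟨τ, hgh⟩ := hThom g ((hT g).2 hg)
  have hL := hl.lifts
  have hα := alpha_step hk.natDegree_pos hl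
  have hgi := hg.2.1
  have hk' := hL.isKey hk hA hg.1 hgi hgh
  have hμ : IsVal (b.val v β) := hk.isVal
  have hα0 := natDegree_pos_of_monic_of_irreducible hg.1 hgi
  -- At slope αβ the expansion in `Q'` computes the old valuation; Condition (*) allows only larger
  -- slopes, which can only increase values.
  have hle : ∀ β', (step b β Q').CondStar β' → ∀ h,
      b.val v β h ≤ (step b β Q').val v β' h := fun β' hβ' h => by
    have h1 : b.val v β h = truncVal (b.val v β) Q' (g.natDegree * β) h :=
      (congrFun (hL.truncVal_eq hk hA hg.1 hgi hgh) h).symm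
    rw [h1]
    refine truncVal_mono hL.monic hk'.natDegree_pos hk'.map_zero ?_ h
    rw [CondStar, hα] at hβ'
    exact hβ'.le
  have hdeg : b.key.natDegree ≤ Q'.natDegree := by
    rw [hl.2.1]; exact Nat.le_mul_of_pos_left _ hα0
  have hdeg' : b.key.degree ≤ Q'.degree := by
    rw [degree_eq_natDegree hk.monic.ne_zero, degree_eq_natDegree hL.monic.ne_zero]
    exact_mod_cast hdeg
  refine ⟨fun β' h0 hβ' => ?_, fun P hP => ?_, fun μ hμ' hag c hc => ?_, fun h0 => ?_⟩
  · rw [CondStar, hα] at hβ'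
    exact hk'.strictKey hβ'
  · rcases Set.mem_insert_iff.1 hP with rfl | hP
    · rcases Nat.lt_or_ge 1 g.natDegree with h1 | h1
      · have hlt : b.key.degree < Q'.degree := by
          refine degree_lt_degree ?_
          rw [hl.2.1]; exact lt_mul_of_one_lt_left hk.natDegree_pos h1
        refine ⟨b.key, hlt, fun β' _ _ => ?_⟩
        have e : (step b β Q').val v β' 0 = ⊤ := truncVal_zero hk'.map_zero
        rw [sub_self, e]
        exact lt_top_iff_ne_top.2 (hk'.ne_top _ hk.monic.ne_zero hlt)
      -- Here `b.key` has the degree of `Q'`. Its initial form is that of `-(Q' - b.key)`, of value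
      -- `β`, since their difference `Q'` has the value `β' > β`.
      · have hα1 : g.natDegree = 1 := le_antisymm h1 hα0
        obtain ⟨hz, h3⟩ := hL.val_sub_of_natDegree_eq_one hk hA hg.1 hgh hg.2.2.1 hα1
        refine ⟨-(Q' - b.key), ?_, fun β' _ hβ' => ?_⟩
        · rw [degree_neg]; exact hz.trans_le hdeg'
        · rw [CondStar, hα] at hβ'
          have hβ'' := hβ'
          rw [hα1] at hβ'
          have e1 : (step b β Q').coeffVal v (-(Q' - b.key)) = β := by
            change b.val v β _ = _
            rw [hμ.map_neg, val, hk.toIsKey.val_of_degree_lt hz, h3]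
          have e2 : (step b β Q').val v β' (b.key - -(Q' - b.key)) = β' := by
            rw [show b.key - -(Q' - b.key) = Q' by ring]
            exact (hk'.strictKey (β' := β') hβ'').toIsKey.val_key
          rw [e1, e2, WithTop.coe_lt_coe]
          simpa using hβ'
    · obtain ⟨c, hc, hlt⟩ := hb.approx P hP
      refine ⟨c, hc.trans_le hdeg', fun β' _ hβ' => ?_⟩
      have h1 := hlt β hβ.1 hβ.2.2
      rw [← hk.toIsKey.val_of_degree_lt hc] at h1
      exact h1.trans_le (hle β' hβ' _)
  · have hlow : ∀ d : K[X], d.degree < b.key.degree → inForm μ d ∈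
        Subring.closure (Set.range (fun a : K => inForm μ (C a)) ∪
          inForm μ '' (step b β Q').preceding) := fun d hd =>
      closure_mono (Set.subset_insert _ _) (hb.gen μ hμ' (fun c hc => by
        rw [hag c (hc.trans_le hdeg')]
        exact hk.toIsKey.val_of_degree_lt hc) d hd)
    have hpow : (b.key ^ g.natDegree).degree = Q'.degree := by
      rw [degree_eq_natDegree (hk.monic.pow _).ne_zero, degree_eq_natDegree hL.monic.ne_zero,
        hk.monic.natDegree_pow, hl.2.1]
    refine hk.toIsKey.inForm_mem hμ' (α := g.natDegree) ?_ (hag c hc) (fun x hx => ?_) _ hlow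
      (fun _ => inForm_mem_closure (Set.mem_insert _ _))
    · rw [← hl.2.1]
      by_cases hc0 : c = 0
      · rw [hc0, natDegree_zero]; exact hk'.natDegree_pos
      · exact natDegree_lt_natDegree hc0 hc
    · rw [hpow] at hx
      rw [hag x hx]
      exact le_rfl
  -- By the strict Condition (*) the admissible sides lie below the lower endpoint for slope αβ.
  -- That endpoint has height `θ`, because for this slope the expansion in `Q'` computes the
  -- valuation used in the definition of `theta`.
  · obtain ⟨s, hs, hsum⟩ := hk'.exists_sides hf h0
    refine ⟨s, fun β' => ?_, hsum.trans ?_⟩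
    · rw [hs, Admissible, CondStar, hα]
      have h1 : 0 ≤ (g.natDegree : ℝ) * β := mul_nonneg (Nat.cast_nonneg _) hβ.1
      exact ⟨fun h => ⟨h1.trans h.1.le, h.2, h.1⟩, fun h => ⟨h.2.2, h.2.1⟩⟩
    · rw [theta, botIndex]
      congr 1
      ext j
      rw [Set.mem_ofPred_eq, Set.mem_ofPred_eq, mem_sideSet_iff]
      have h1 : b.val v β (digit Q' f j * Q' ^ j) =
          truncVal (b.coeffVal v) b.key β (digit Q' f j) +
            ((j * (g.natDegree * β) : ℝ) : WithTop ℝ) := by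
        have h2 : b.val v β Q' = ((g.natDegree * β : ℝ) : WithTop ℝ) :=
          hL.val_eq hk hA hg.1 hgh
        rw [hμ.map_mul, hμ.map_pow, h2, ← WithTop.coe_nsmul, nsmul_eq_mul]
        rfl
      rw [h1, hL.truncVal_eq hk hA hg.1 hgi hgh]
      exact Iff.rfl

end Step

end Branch

end KeyPoly
end
noncomputable section
namespace KeyPoly

/-! ### Limit vertices, and the vertices that follow a given one -/

lemma Lifts.eq_of_lifts {K : Type*} [Field K] {w : K[X] → WithTop ℝ} {Q Q' : K[X]} {β : ℝ}
    {A : Subring (Gr (truncVal w Q β))} {g g' : A[X]} (hQ : 0 < Q.natDegree) (hg : g.Monic)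
    (hg' : g'.Monic) (hL : Lifts g Q') (hL' : Lifts g' Q') : g = g' := by
  have hdeg : g.natDegree = g'.natDegree :=
    Nat.eq_of_mul_eq_mul_right hQ (hL.natDegree_eq.symm.trans hL'.natDegree_eq)
  ext j
  rcases lt_trichotomy j g.natDegree with h | rfl | h
  · rw [← hL.inForm_digit j h, ← hL'.inForm_digit j (hdeg ▸ h)]
  · rw [hg.coeff_natDegree, hdeg, hg'.coeff_natDegree]
  · rw [coeff_eq_zero_of_natDegree_lt h, coeff_eq_zero_of_natDegree_lt (hdeg ▸ h)]

namespace Branch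

variable {K : Type*} [Field K] {v : AddValuation K (WithTop ℝ)} {f : K[X]} {b : Branch K}

section Limit

variable {β : ℝ} {Qs : ℕ → K[X]} {βs : ℕ → ℝ} {q : K[X]} {p e₀ : ℕ}

lemma CaseA.exists_limitData (hA : b.CaseA v f) (hb : b.Good v f) (hf : Irreducible f)
    (hβ : b.Admissible v f β)
    (hs : IsLimitSeq (b.coeffVal v) f b.key β (topIndex (b.coeffVal v) b.key β f) Qs βs)
    (hq : IsLimitKey (b.coeffVal v) p b.key (topIndex (b.coeffVal v) b.key β f) Qs βs q) :
    ∃ e₀, LimitData (b.coeffVal v) f b.key β (topIndex (b.coeffVal v) b.key β f) p Qs βs e₀ q := by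
  obtain ⟨-, β', hu, -, B, hB⟩ := hA
  obtain rfl := (hu β).1 hβ
  obtain ⟨e₀, h1, h2⟩ := hq
  refine ⟨e₀, hb.key β hβ.1 hβ.2.2, hf, ⟨hβ.2.1, rfl⟩, hs, ⟨B, ?_⟩, h1, h2⟩
  rintro _ ⟨t, rfl⟩
  exact hB _ _ (hs.inT t)

variable (hd : LimitData (b.coeffVal v) f b.key β (topIndex (b.coeffVal v) b.key β f) p Qs βs e₀ q)
include hd

lemma alpha_limit : (limit b Qs βs q).alpha = p ^ e₀ := by
  rw [alpha, hd.natDegree_eq, hd.isLimitSeq.1, Nat.mul_div_cancel _ hd.key.natDegree_pos]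

variable [Fact p.Prime] [CharP K p]

lemma theta_limit : (limit b Qs βs q).theta v f =
    topIndex (limVal (b.coeffVal v) Qs βs) q (p ^ e₀ * ⨆ t, βs t) f := by
  rw [theta, alpha_limit hd, hd.isLimitSeq.2.1]
  exact Nat.div_eq_of_eq_mul_right (pow_pos (Fact.out : p.Prime).pos _) hd.topIndex_mul.symm

lemma good_limit (hb : b.Good v f) (hβ : b.Admissible v f β) :
    (limit b Qs βs q).Good v f := by
  have hk := hd.limit_strictKey
  have hα := alpha_limit hd
  have hdeg : b.key.degree < q.degree := by
    have := hd.degree_lt 0; rwa [hd.isLimitSeq.1] at this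
  have hle : ∀ β', (limit b Qs βs q).CondStar β' → (p : ℝ) ^ e₀ * (⨆ t, βs t) ≤ β' :=
    fun β' hβ' => by
      rw [CondStar, hα] at hβ'; exact_mod_cast hβ'
  have hkey : ∀ β', (p : ℝ) ^ e₀ * (⨆ t, βs t) ≤ β' →
      StrictKey (limVal (b.coeffVal v) Qs βs) q β' := fun β' h => by
    rcases h.eq_or_lt with rfl | h
    · exact hk
    · exact hk.toIsKey.strictKey h
  refine ⟨fun β' _ hβ' => hkey β' (hle β' hβ'), fun P hP => ?_, fun μ hμ hag c hc => ?_,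
    fun h0 => ?_⟩
  · rcases hP with hP | ⟨t, rfl⟩
    · obtain ⟨c, hc, hlt⟩ := hb.approx P hP
      refine ⟨c, hc.trans hdeg, fun β' _ hβ' => ?_⟩
      have h1 := hlt β hβ.1 hβ.2.2
      have h2 := hd.val_le_limit 0 (hle β' hβ') (P - c)
      rw [seqVal, hd.isLimitSeq.1, hd.isLimitSeq.2.1] at h2
      refine lt_of_eq_of_lt ?_ (h1.trans_le h2)
      exact hd.limVal_of_degree_lt hc
    · refine ⟨Qs t, hd.degree_lt t, fun β' _ hβ' => ?_⟩
      have e : (limit b Qs βs q).val v β' 0 = ⊤ := truncVal_zero hk.map_zero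
      rw [sub_self, e]
      exact lt_top_iff_ne_top.2 (hk.ne_top _ (hd.seq.monic t).ne_zero (hd.degree_lt t))
  · have hlow : ∀ d : K[X], d.degree < b.key.degree → inForm μ d ∈
        Subring.closure (Set.range (fun a : K => inForm μ (C a)) ∪
          inForm μ '' (limit b Qs βs q).preceding) := fun d hd' =>
      closure_mono Set.subset_union_left (hb.gen μ hμ (fun c hc => by
        rw [hag c (hc.trans hdeg)]
        exact hd.limVal_of_degree_lt hc) d hd')
    obtain ⟨t, ht⟩ := (hd.eventually_val hc).exists
    refine (hd.seq.key t).toIsKey.inForm_mem hμ (α := p ^ e₀) ?_ ((hag c hc).trans ht.symm)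
      (fun x hx => ?_) _ (fun d hd' => hlow d ?_)
      (fun _ => inForm_mem_closure (Or.inr ⟨t, rfl⟩))
    · rw [hd.seq.natDegree_eq t, ← hd.natDegree_eq]
      by_cases hc0 : c = 0
      · rw [hc0, natDegree_zero]; exact hd.natDegree_pos
      · exact natDegree_lt_natDegree hc0 hc
    · rw [hd.degree_pow] at hx
      rw [hag x hx]
      exact hd.val_le_limVal hx t
    · rwa [hd.seq.degree_eq t, hd.isLimitSeq.1] at hd'
  -- After a limit, Condition (*) allows equality. The side at the limiting slope itself is
  -- admissible, and the heights add up to its upper endpoint instead of its lower one.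
  · obtain ⟨s, hs, hsum⟩ := hk.toIsKey.exists_sides_of_le hd.ne_zero h0
    refine ⟨s, fun β' => ?_, hsum.trans (theta_limit hd).symm⟩
    rw [hs, Admissible, CondStar, hα, Nat.cast_pow]
    have h1 : 0 ≤ ⨆ t, βs t := by
      have := hd.lt_sup 0
      rw [hd.isLimitSeq.2.1] at this
      exact hβ.1.trans this.le
    have h2 : 0 ≤ (p : ℝ) ^ e₀ * ⨆ t, βs t := mul_nonneg (by positivity) h1
    exact ⟨fun h => ⟨h2.trans h.1, h.2, h.1⟩, fun h => ⟨h.2.2, h.2.1⟩⟩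

end Limit

lemma Good.exists_factors (hb : b.Good v f) (hf : f ≠ 0) {β : ℝ} (hβ : b.Admissible v f β) :
    ∃ (T : Finset (b.coeffRing v β)[X]) (m : (b.coeffRing v β)[X] → ℕ),
      (∀ g, g ∈ T ↔ b.IsFactor v f β g) ∧
      (∀ g ∈ T, ∀ Q', b.IsLift v β g Q' → (step b β Q').alpha * (step b β Q').theta v f =
        g.natDegree * m g) ∧
      (∀ g ∈ T, ∀ g' ∈ T, ∀ Q', b.IsLift v β g Q' → b.IsLift v β g' Q' → g = g') ∧
      ∑ g ∈ T, g.natDegree * m g =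
        topIndex (b.coeffVal v) b.key β f - botIndex (b.coeffVal v) b.key β f := by
  have hk := hb.key β hβ.1 hβ.2.2
  obtain ⟨T, m, hT, -, hm, hsum⟩ := hk.exists_factors (hb.isLowRing hβ.1 hβ.2.2) hf
  refine ⟨T, m, hT, fun g hg Q' hl => ?_, fun g hg g' hg' Q' hl hl' =>
    Lifts.eq_of_lifts hk.natDegree_pos ((hT g).1 hg).1 ((hT g').1 hg').1 hl.lifts hl'.lifts,
    Nat.eq_sub_of_add_eq hsum⟩
  rw [alpha_step hk.natDegree_pos hl]
  exact congrArg _ (hm g hg _ hl.lifts)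

lemma CaseA.fact_prime (hA : b.CaseA v f) : Fact (ringChar K).Prime :=
  ⟨(CharP.char_is_prime_or_zero K (ringChar K)).resolve_right hA.1.ne'⟩

variable {U : Set (Branch K)} (hU : IsAlgorithmTree v f U) (hf : f.Monic) (hfi : Irreducible f)
  (hpos : ∀ i < f.natDegree, 0 < v (f.coeff i))
include hU hf hfi hpos

/-- Induction along the branch. The tree axioms also exclude a `step` after a vertex in Case (a) and
a `limit` after one in Case (b). -/
lemma good_of_mem (hb : b ∈ U) : b.Good v f := by
  induction b with
  | root => exact good_root hf hpos
  | step b β Q ih =>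
    have hfol : Follows b (step b β Q) := rfl
    have hbU := hU.mem_of_follows b _ hfol hb
    by_cases hA : b.CaseA v f
    · obtain ⟨_, _, _, _, -, -, -, e⟩ := hU.eq_limit b hbU hA _ hb hfol
      cases e
    · obtain ⟨β', g, Q', h1, h2, h3, e⟩ := hU.eq_step b hbU hA _ hb hfol
      rw [e]
      exact good_step (ih hbU) hfi.ne_zero h1 h2 h3
  | limit b Qs βs q ih =>
    have hfol : Follows b (limit b Qs βs q) := rfl
    have hbU := hU.mem_of_follows b _ hfol hb
    by_cases hA : b.CaseA v f
    · obtain ⟨β, Qs', βs', q', h1, h2, h3, e⟩ := hU.eq_limit b hbU hA _ hb hfol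
      rw [e]
      have := hA.fact_prime
      obtain ⟨e₀, hd⟩ := hA.exists_limitData (ih hbU) hfi h1 h2 h3
      exact good_limit hd (ih hbU) h1
    · obtain ⟨_, _, _, -, -, -, e⟩ := hU.eq_step b hbU hA _ hb hfol
      cases e

/-- The vertex following a vertex in Case (a). -/
lemma followers_of_caseA (hb : b ∈ U) (hA : b.CaseA v f) :
    ∃ c, followers U b = {c} ∧ c.alpha * c.theta v f = b.theta v f := by
  have hgood := good_of_mem hU hf hfi hpos hb
  obtain ⟨c, ⟨hcU, hfol⟩, huniq⟩ := hU.existsUnique_limit b hb hA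
  refine ⟨c, ?_, ?_⟩
  · ext c'
    exact ⟨fun h => huniq c' h, fun h => by rw [Set.mem_singleton_iff.1 h]; exact ⟨hcU, hfol⟩⟩
  obtain ⟨β, Qs, βs, q, h1, h2, h3, rfl⟩ := hU.eq_limit b hb hA c hcU hfol
  have := hA.fact_prime
  obtain ⟨e₀, hd⟩ := hA.exists_limitData hgood hfi h1 h2 h3
  rw [alpha_limit hd, theta_limit hd, hd.topIndex_mul]
  -- The initial form of `f` is a constant times a power of a linear form with nonzero constant
  -- term, so the side extends from height `δ` down to 0. It belongs to the only possible value, and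
  -- therefore `θ = δ` at this vertex.
  have hl := (hd.isLimitSeq.2.2.1 0).1
  have hmem := (IsLinearPower.val_eq_and_mem (hd.strictKey 0) hd.ne_zero hl (hd.charSide 0)).2
  rw [hd.isLimitSeq.1, hd.isLimitSeq.2.1] at hmem
  have h0 : digit b.key f 0 ≠ 0 := fun h => by
    obtain ⟨r, hr⟩ := hd.key.toIsKey.exists_real_of_mem hd.ne_zero hmem
    rw [h, hd.key.map_zero] at hr
    exact WithTop.coe_ne_top hr.symm
  obtain ⟨s, hs, hsum⟩ := hgood.sides h0
  obtain ⟨-, β', hu, -⟩ := hA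
  have hs' : s = {β} := by
    ext γ
    rw [hs, hu, Finset.mem_singleton, (hu β).1 h1]
  rw [hs', Finset.sum_singleton, Nat.le_zero.1 (botIndex_le hmem), Nat.sub_zero] at hsum
  exact hsum

/-- The vertices following a vertex in Case (b) that belong to one value of the key polynomial. -/
lemma exists_followers_of_value (hb : b ∈ U) (hA : ¬ b.CaseA v f) {β : ℝ}
    (hβ : b.Admissible v f β) : ∃ F : Finset (Branch K),
      (∀ c, c ∈ F ↔ c ∈ U ∧ ∃ Q, c = step b β Q) ∧
      ∑ c ∈ F, c.alpha * c.theta v f =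
        topIndex (b.coeffVal v) b.key β f - botIndex (b.coeffVal v) b.key β f := by
  classical
  have hgood := good_of_mem hU hf hfi hpos hb
  obtain ⟨T, m, hT, hm, hinj, hsum⟩ := hgood.exists_factors hfi.ne_zero hβ
  have hex : ∀ g, ∃ Q, g ∈ T → b.IsLift v β g Q ∧ step b β Q ∈ U := fun g => by
    by_cases hg : g ∈ T
    · obtain ⟨Q, hQ, -⟩ := hU.existsUnique_step b hb hA β hβ g ((hT g).1 hg)
      exact ⟨Q, fun _ => hQ⟩
    · exact ⟨0, fun h => absurd h hg⟩
  choose Q hQ using hex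
  refine ⟨T.image fun g => step b β (Q g), fun c => ?_, ?_⟩
  · rw [Finset.mem_image]
    constructor
    · rintro ⟨g, hg, rfl⟩
      exact ⟨(hQ g hg).2, Q g, rfl⟩
    · rintro ⟨hc, Q', rfl⟩
      obtain ⟨β₂, g, Q₂, h1, h2, h3, e⟩ := hU.eq_step b hb hA _ hc rfl
      obtain ⟨-, rfl, rfl⟩ := step.inj e
      have hg := (hT g).2 h2
      refine ⟨g, hg, ?_⟩
      have := (hU.existsUnique_step b hb hA β hβ g h2).unique (hQ g hg) ⟨h3, hc⟩
      rw [this]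
  · rw [Finset.sum_image]
    · rw [← hsum]
      exact Finset.sum_congr rfl fun g hg => hm g hg _ (hQ g hg).1
    -- A polynomial is a lifting of at most one `g`, so distinct factors yield distinct vertices and
    -- no vertex is counted twice.
    · intro g hg g' hg' e
      have e1 : Q g = Q g' := (step.inj e).2.2
      exact hinj g hg g' hg' _ (hQ g hg).1 (e1 ▸ (hQ g' hg').1)

lemma followers_of_not_caseA (hb : b ∈ U) (hA : ¬ b.CaseA v f) (h0 : digit b.key f 0 ≠ 0) :
    ∃ hfin : (followers U b).Finite,
      ∑ c ∈ hfin.toFinset, c.alpha * c.theta v f = b.theta v f := by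
  classical
  obtain ⟨s, hs, hsum⟩ := (good_of_mem hU hf hfi hpos hb).sides h0
  have hex : ∀ β, ∃ F : Finset (Branch K), β ∈ s →
      (∀ c, c ∈ F ↔ c ∈ U ∧ ∃ Q, c = step b β Q) ∧
      ∑ c ∈ F, c.alpha * c.theta v f =
        topIndex (b.coeffVal v) b.key β f - botIndex (b.coeffVal v) b.key β f := fun β => by
    by_cases hβ : β ∈ s
    · obtain ⟨F, hF⟩ := exists_followers_of_value hU hf hfi hpos hb hA ((hs β).1 hβ)
      exact ⟨F, fun _ => hF⟩
    · exact ⟨∅, fun h => absurd h hβ⟩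
  choose F hF using hex
  have hset : followers U b = ↑(s.biUnion F) := by
    ext c
    rw [Finset.mem_coe, Finset.mem_biUnion]
    constructor
    · rintro ⟨hc, hfol⟩
      obtain ⟨β, g, Q, h1, h2, h3, rfl⟩ := hU.eq_step b hb hA _ hc hfol
      have hβ := (hs β).2 h1
      exact ⟨β, hβ, ((hF β hβ).1 _).2 ⟨hc, Q, rfl⟩⟩
    · rintro ⟨β, hβ, hc⟩
      obtain ⟨hcU, Q, rfl⟩ := ((hF β hβ).1 c).1 hc
      exact ⟨hcU, rfl⟩
  have hfin : (followers U b).Finite := hset ▸ Finset.finite_toSet _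
  refine ⟨hfin, ?_⟩
  have e : hfin.toFinset = s.biUnion F := by
    ext c; rw [Set.Finite.mem_toFinset, hset, Finset.mem_coe]
  rw [e, Finset.sum_biUnion, ← hsum]
  · exact Finset.sum_congr rfl fun β hβ => (hF β hβ).2
  · intro β hβ β' hβ' hne
    rw [Function.onFun, Finset.disjoint_left]
    intro c hc hc'
    obtain ⟨-, Q, rfl⟩ := ((hF β hβ).1 c).1 hc
    obtain ⟨-, Q', e⟩ := ((hF β' hβ').1 _).1 hc'
    exact hne (step.inj e).2.1

/-- `Good.key` applies only to nonnegative values satisfying Condition (*). Any sufficiently large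
number is such a value, even if it determines no side. -/
lemma key_monic_natDegree_pos (hb : b ∈ U) : b.key.Monic ∧ 0 < b.key.natDegree := by
  have hgood := good_of_mem hU hf hfi hpos hb
  obtain ⟨β, h0, hβ⟩ : ∃ β, 0 ≤ β ∧ b.CondStar β := by
    cases b with
    | root => exact ⟨0, le_rfl, trivial⟩
    | step b β Q =>
      refine ⟨max 0 ((step b β Q).alpha * β + 1), le_max_left _ _, ?_⟩
      exact (lt_add_one _).trans_le (le_max_right _ _)
    | limit b Qs βs q => exact ⟨max 0 _, le_max_left _ _, le_max_right _ _⟩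
  have hk := hgood.key β h0 hβ
  exact ⟨hk.monic, hk.natDegree_pos⟩

end Branch

end KeyPoly
end
noncomputable section
namespace KeyPoly

namespace Branch

/-! ### Finite subtrees -/

variable {K : Type*} [Field K]

/-- The number of vertices below a vertex. -/
def depth : Branch K → ℕ
  | root => 0
  | step b _ _ => b.depth + 1
  | limit b _ _ _ => b.depth + 1

lemma Follows.depth_eq {b c : Branch K} (h : Follows b c) : c.depth = b.depth + 1 := by
  cases c with
  | root => exact h.elim
  | step b' β Q => have h' : b = b' := h; rw [h', depth]
  | limit b' Qs βs q => have h' : b = b' := h; rw [h', depth]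

lemma Follows.unique {b b' c : Branch K} (h : Follows b c) (h' : Follows b' c) : b = b' := by
  cases c with
  | root => exact h.elim
  | step b₁ β Q => exact Eq.trans (b := b₁) h (Eq.symm h')
  | limit b₁ Qs βs q => exact Eq.trans (b := b₁) h (Eq.symm h')

lemma Le.depth_le {b c : Branch K} (h : Le b c) : b.depth ≤ c.depth := by
  induction h with
  | refl => exact le_rfl
  | tail _ h ih => rw [h.depth_eq]; omega

lemma Le.eq_of_depth_le {b c : Branch K} (h : Le b c) (hd : c.depth ≤ b.depth) : b = c := by
  rcases Relation.ReflTransGen.cases_tail h with h | ⟨c', h1, h2⟩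
  · exact h.symm
  · have h3 := Le.depth_le h1
    rw [h2.depth_eq] at hd
    omega

lemma Le.exists_follows {b c : Branch K} (h : Le b c) (hne : b ≠ c) :
    ∃ b', Follows b b' ∧ Le b' c := by
  rcases Relation.ReflTransGen.cases_head h with h | h
  · exact absurd h hne
  · exact h

/-- Predecessors are unique, so the vertices below `m` form a chain with at most one vertex of each
depth. -/
lemma Le.eq_of_depth_eq {a a' m : Branch K} (h : Le a m) (h' : Le a' m)
    (hd : a.depth = a'.depth) : a = a' := by
  induction h with
  | refl => exact (Le.eq_of_depth_le h' hd.le).symm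
  | tail h1 h2 ih =>
    rcases Relation.ReflTransGen.cases_tail h' with h3 | ⟨c', h3, h4⟩
    · subst h3; exact Le.eq_of_depth_le (h1.tail h2) hd.ge
    · exact ih (h2.unique h4 ▸ h3)

end Branch

open Branch

variable {K : Type*} [Field K] {U : Set (Branch K)} {b₀ b m : Branch K} {U' : Finset (Branch K)}

lemma mem_of_mem_leaves (hm : m ∈ leaves U') : m ∈ U' := by
  classical
  rw [leaves, Finset.mem_filter] at hm
  exact hm.1

lemma IsFullSubtree.mem_of_le (hU' : IsFullSubtree U b₀ U') {c : Branch K} (hc : Le b₀ c)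
    (hcm : Le c m) (hm : m ∈ U') : c ∈ U' := by
  induction hcm with
  | refl => exact hm
  | tail h1 h2 ih =>
    refine ih ?_
    obtain ⟨b', hb', hf⟩ := hU'.exists_mem _ hm (by
      rintro rfl
      have h3 := Le.depth_le (hc.trans h1)
      have h4 := h2.depth_eq
      omega)
    rwa [h2.unique hf]

open Classical in
/-- A function on the vertices that is additive with respect to the immediately following vertices,
with weights, is the sum of its values at the maximal vertices, with the products of the weights. -/
lemma IsFullSubtree.eq_sum_leaves (hU' : IsFullSubtree U b₀ U') {θ α : Branch K → ℕ}
    (hθ : ∀ b ∈ U, (∃ c ∈ U, Follows b c) → ∃ hfin : (followers U b).Finite,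
      ∑ c ∈ hfin.toFinset, α c * θ c = θ b) (hb : b ∈ U') :
    θ b = ∑ m ∈ (leaves U').filter (Le b ·),
      (∏ c ∈ U'.filter (fun c => c ≠ b ∧ Le b c ∧ Le c m), α c) * θ m := by
  induction hn : (U'.filter (Le b ·)).card using Nat.strong_induction_on generalizing b with
  | _ n ih =>
    by_cases hleaf : b ∈ leaves U'
    · have hmax : ∀ c ∈ U', Le b c → c = b := by
        rw [leaves, Finset.mem_filter] at hleaf; exact hleaf.2
      have h1 : (leaves U').filter (Le b ·) = {b} := by
        ext m
        rw [Finset.mem_filter, Finset.mem_singleton]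
        constructor
        · rintro ⟨h1, h2⟩
          exact hmax m (Finset.mem_filter.1 h1).1 h2
        · rintro rfl
          exact ⟨hleaf, Relation.ReflTransGen.refl⟩
      have h2 : U'.filter (fun c => c ≠ b ∧ Le b c ∧ Le c b) = ∅ := by
        refine Finset.filter_eq_empty_iff.2 fun c hc h => h.1 (hmax c hc h.2.1)
      rw [h1, Finset.sum_singleton, h2, Finset.prod_empty, one_mul]
    · have hex : ∃ c ∈ U', Follows b c := by
        rw [leaves, Finset.mem_filter, not_and] at hleaf
        have := hleaf hb
        push Not at this
        obtain ⟨m, hm, hle, hne⟩ := this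
        obtain ⟨c, hc, hcm⟩ := Le.exists_follows hle hne.symm
        exact ⟨c, hU'.mem_of_le ((hU'.base_le b hb).tail hc) hcm hm, hc⟩
      obtain ⟨c₀, hc₀, hbc₀⟩ := hex
      obtain ⟨hfin, hsum⟩ := hθ b (hU'.subset b hb) ⟨c₀, hU'.subset _ hc₀, hbc₀⟩
      have hmem : ∀ c, c ∈ hfin.toFinset ↔ c ∈ U' ∧ Follows b c := fun c => by
        rw [Set.Finite.mem_toFinset]
        exact ⟨fun h => ⟨hU'.full b hb ⟨c₀, hc₀, hbc₀⟩ c h, h.2⟩,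
          fun h => ⟨hU'.subset c h.1, h.2⟩⟩
      have hnb : ¬ b ∈ leaves U' := hleaf
      -- Each maximal vertex above the nonmaximal `b` lies above exactly one follower of `b`, and
      -- the path to it from `b` has that follower as its one additional vertex.
      have hunion : (leaves U').filter (Le b ·) =
          hfin.toFinset.biUnion fun c => (leaves U').filter (Le c ·) := by
        ext m
        rw [Finset.mem_biUnion, Finset.mem_filter]
        constructor
        · rintro ⟨h1, h2⟩
          obtain ⟨c, hc, hcm⟩ := Le.exists_follows h2 (by rintro rfl; exact hnb h1)
          have hcU' := hU'.mem_of_le ((hU'.base_le b hb).tail hc) hcm (Finset.mem_filter.1 h1).1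
          exact ⟨c, (hmem c).2 ⟨hcU', hc⟩, Finset.mem_filter.2 ⟨h1, hcm⟩⟩
        · rintro ⟨c, hc, hm⟩
          rw [Finset.mem_filter] at hm
          exact ⟨hm.1, Relation.ReflTransGen.head ((hmem c).1 hc).2 hm.2⟩
      have hchild : ∀ {c c' m : Branch K}, Follows b c → Follows b c' → Le c m → Le c' m →
          c = c' := fun h h' h1 h2 =>
        Le.eq_of_depth_eq h1 h2 (h.depth_eq.trans h'.depth_eq.symm)
      rw [hunion, Finset.sum_biUnion, ← hsum]
      · refine Finset.sum_congr rfl fun c hc => ?_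
        obtain ⟨hcU', hbc⟩ := (hmem c).1 hc
        have hlt : (U'.filter (Le c ·)).card < n := by
          rw [← hn]
          refine Finset.card_lt_card (Finset.ssubset_iff_of_subset (fun x hx => ?_) |>.2
            ⟨b, Finset.mem_filter.2 ⟨hb, Relation.ReflTransGen.refl⟩, fun h => ?_⟩)
          · rw [Finset.mem_filter] at hx ⊢
            exact ⟨hx.1, Relation.ReflTransGen.head hbc hx.2⟩
          · have h1 := Le.depth_le (Finset.mem_filter.1 h).2
            rw [hbc.depth_eq] at h1
            omega
        rw [ih _ hlt hcU' rfl, Finset.mul_sum]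
        refine Finset.sum_congr rfl fun m hm => ?_
        have hcm := (Finset.mem_filter.1 hm).2
        rw [← mul_assoc]
        congr 1
        have e : U'.filter (fun x => x ≠ b ∧ Le b x ∧ Le x m) =
            insert c (U'.filter fun x => x ≠ c ∧ Le c x ∧ Le x m) := by
          ext x
          rw [Finset.mem_insert, Finset.mem_filter, Finset.mem_filter]
          constructor
          · rintro ⟨hx, hne, hbx, hxm⟩
            obtain ⟨c', hc', hcx⟩ := Le.exists_follows hbx hne.symm
            have := hchild hc' hbc (hcx.trans hxm) hcm
            subst this
            by_cases h : x = c'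
            · exact Or.inl h
            · exact Or.inr ⟨hx, h, hcx, hxm⟩
          · rintro (rfl | ⟨hx, hne, hcx, hxm⟩)
            · refine ⟨hcU', ?_, Relation.ReflTransGen.single hbc, hcm⟩
              rintro rfl
              have := hbc.depth_eq; omega
            · refine ⟨hx, ?_, Relation.ReflTransGen.head hbc hcx, hxm⟩
              rintro rfl
              have h1 := Le.depth_le hcx
              have h2 := hbc.depth_eq
              omega
        rw [e, Finset.prod_insert fun h => (Finset.mem_filter.1 h).2.1 rfl]
      · intro c hc c' hc' hne
        rw [Function.onFun, Finset.disjoint_left]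
        intro m hm hm'
        exact hne (hchild ((hmem c).1 hc).2 ((hmem c').1 hc').2 (Finset.mem_filter.1 hm).2
          (Finset.mem_filter.1 hm').2)

lemma IsFullSubtree.eq_sum_pathTo (hU' : IsFullSubtree U b₀ U') {θ α : Branch K → ℕ}
    (hθ : ∀ b ∈ U, (∃ c ∈ U, Follows b c) → ∃ hfin : (followers U b).Finite,
      ∑ c ∈ hfin.toFinset, α c * θ c = θ b) :
    θ b₀ = ∑ m ∈ leaves U', (∏ c ∈ pathTo U' b₀ m, α c) * θ m := by
  classical
  have h : (leaves U').filter (Le b₀ ·) = leaves U' :=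
    Finset.filter_true_of_mem fun m hm => hU'.base_le m (mem_of_mem_leaves hm)
  rw [hU'.eq_sum_leaves hθ hU'.base_mem, h]
  refine Finset.sum_congr rfl fun m _ => ?_
  congr 1
  refine Finset.prod_congr ?_ fun _ _ => rfl
  ext c
  rw [pathTo, Finset.mem_filter, Finset.mem_filter]
  exact ⟨fun h => ⟨h.1, h.2.1, h.2.2.2⟩, fun h => ⟨h.1, h.2.1, hU'.base_le c h.1, h.2.2⟩⟩

/-- Unlike `pathTo`, the two sets together contain the root, which contributes the factor `α_1 = 1`.
-/
lemma IsFullSubtree.prod_setD_mul_prod_setE {v : AddValuation K (WithTop ℝ)} {f : K[X]}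
    (hU' : IsFullSubtree U root U') (hm : m ∈ U') :
    (∏ c ∈ setD v f U' m, c.alpha) * (∏ c ∈ setE v f U' m, c.alpha) =
      ∏ c ∈ pathTo U' root m, c.alpha := by
  classical
  have h1 : setD v f U' m = (U'.filter (Le · m)).filter (AfterCaseA v f ·) := by
    rw [setD, Finset.filter_filter]
  have h2 : setE v f U' m = (U'.filter (Le · m)).filter (¬ AfterCaseA v f ·) := by
    rw [setE, Finset.filter_filter]
  have h3 : U'.filter (Le · m) = insert root (pathTo U' root m) := by
    ext c
    rw [Finset.mem_insert, pathTo, Finset.mem_filter, Finset.mem_filter]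
    constructor
    · rintro ⟨h, h'⟩
      by_cases hc : c = root
      · exact Or.inl hc
      · exact Or.inr ⟨h, hc, h'⟩
    · rintro (rfl | h)
      · exact ⟨hU'.base_mem, hU'.base_le m hm⟩
      · exact ⟨h.1, h.2.2⟩
  rw [h1, h2, Finset.prod_filter_mul_prod_filter_not, h3,
    Finset.prod_insert fun h => (Finset.mem_filter.1 h).2.1 rfl]
  simp [alpha]

/-! ### Additivity at nonmaximal vertices -/

section Main

variable {v : AddValuation K (WithTop ℝ)} {f : K[X]} (hU : IsAlgorithmTree v f U) (hf : f.Monic)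
  (hfi : Irreducible f) (hpos : ∀ i < f.natDegree, 0 < v (f.coeff i))
include hU hf hfi hpos

/-- If a vertex in Case (b) is not maximal then its key polynomial does not divide `f`. -/
lemma digit_zero_ne_zero_of_follows (hb : b ∈ U) (hA : ¬ b.CaseA v f)
    (hex : ∃ c ∈ U, Follows b c) : digit b.key f 0 ≠ 0 := by
  intro h0
  obtain ⟨c, hc, hbc⟩ := hex
  obtain ⟨β, g, Q, hβ, -⟩ := hU.eq_step b hb hA c hc hbc
  have hk := ((good_of_mem hU hf hfi hpos hb).key β hβ.1 hβ.2.2).toIsKey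
  have hdvd : b.key ∣ f := by
    rwa [← modByMonic_eq_zero_iff_dvd hk.monic, ← digit_zero]
  -- A key polynomial dividing `f` equals `f`. Then the expansion of `f` is the single term of index
  -- 1, no side exists, and nothing can follow the vertex.
  have e : b.key = f := eq_of_monic_of_associated hk.monic hf
    (hk.irreducible.associated_of_dvd hfi hdvd)
  obtain ⟨i, hi, j, hj, hne⟩ := Finset.one_lt_card.1 hβ.2.1
  have hone : ∀ {j}, j ∈ sideSet (b.coeffVal v) b.key β f → j = 1 := fun {j} hj => by
    obtain ⟨r, hr⟩ := hk.exists_real_of_mem hfi.ne_zero hj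
    by_contra hj1
    have h1 := digit_mul_pow hk.monic hk.degree_pos hk.degree_one_lt 1 j
    rw [if_neg hj1, one_mul, pow_one] at h1
    rw [← e, h1, hk.map_zero] at hr
    exact WithTop.coe_ne_top hr.symm
  exact hne ((hone hi).trans (hone hj).symm)

lemma sum_followers (hb : b ∈ U) (hex : ∃ c ∈ U, Follows b c) :
    ∃ hfin : (followers U b).Finite,
      ∑ c ∈ hfin.toFinset, c.alpha * c.theta v f = b.theta v f := by
  by_cases hA : b.CaseA v f
  · obtain ⟨c, hc, he⟩ := followers_of_caseA hU hf hfi hpos hb hA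
    refine ⟨hc ▸ Set.finite_singleton c, ?_⟩
    simp only [hc, Set.Finite.toFinset_singleton, Finset.sum_singleton, he]
  · exact followers_of_not_caseA hU hf hfi hpos hb hA
      (digit_zero_ne_zero_of_follows hU hf hfi hpos hb hA hex)

end Main

/-- If `Q` divided the minimal polynomial, the cofactor would vanish at `x`, so it could not be a
unit; nor is `Q` one, as it has positive degree. -/
lemma digit_zero_ne_zero_of_aeval_ne_zero {L : Type*} [Field L] [Algebra K L] {x : L} {Q : K[X]}
    (hQ : Q.Monic) (hQ0 : 0 < Q.natDegree) (hx : IsIntegral K x) (h : aeval x Q ≠ 0) :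
    digit Q (minpoly K x) 0 ≠ 0 := by
  intro h0
  rw [digit_zero, modByMonic_eq_zero_iff_dvd hQ] at h0
  obtain ⟨u, hu⟩ := h0
  have h1 := minpoly.aeval K x
  rw [hu, map_mul, mul_eq_zero, or_iff_right h] at h1
  rcases (minpoly.irreducible hx).isUnit_or_isUnit hu with h2 | h2
  · exact hQ0.ne' (natDegree_eq_zero_of_isUnit h2)
  · exact (h2.map (aeval x)).ne_zero h1

end KeyPoly
end

theorem mainTheorem8 {K L : Type*} [Field K] [Field L] [Algebra K L] [FiniteDimensional K L]
    [Algebra.IsSeparable K L]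
    (v : AddValuation K (WithTop ℝ)) (hv : ∃ a : K, a ≠ 0 ∧ v a ≠ 0)
    (x : L) (hx : IntermediateField.adjoin K {x} = ⊤)
    (hpos : ∀ i < (minpoly K x).natDegree, 0 < v ((minpoly K x).coeff i))
    (U : Set (KeyPoly.Branch K)) (hU : KeyPoly.IsAlgorithmTree v (minpoly K x) U) :
    (∀ b ∈ U, ¬ b.CaseA v (minpoly K x) → Polynomial.aeval x b.key ≠ 0 →
      ∃ hfin : (KeyPoly.followers U b).Finite,
        ∑ c ∈ hfin.toFinset, c.alpha * c.theta v (minpoly K x) = b.theta v (minpoly K x)) ∧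
    (∀ b ∈ U, b.CaseA v (minpoly K x) →
      ∃ c, KeyPoly.followers U b = {c} ∧
        c.alpha * c.theta v (minpoly K x) = b.theta v (minpoly K x)) ∧
    (∀ b₀ ∈ U, ∀ U' : Finset (KeyPoly.Branch K), KeyPoly.IsFullSubtree U b₀ U' →
      b₀.theta v (minpoly K x) =
        ∑ m ∈ KeyPoly.leaves U',
          (∏ c ∈ KeyPoly.pathTo U' b₀ m, c.alpha) * m.theta v (minpoly K x)) ∧
    (KeyPoly.Branch.root : KeyPoly.Branch K).theta v (minpoly K x) = Module.finrank K L ∧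
    (∀ U' : Finset (KeyPoly.Branch K), KeyPoly.IsFullSubtree U KeyPoly.Branch.root U' →
      Module.finrank K L =
        ∑ m ∈ KeyPoly.leaves U',
          (∏ c ∈ KeyPoly.setD v (minpoly K x) U' m, c.alpha) *
          (∏ c ∈ KeyPoly.setE v (minpoly K x) U' m, c.alpha) * m.theta v (minpoly K x)) := by
  have hint : IsIntegral K x := IsIntegral.of_finite K x
  have hf := minpoly.monic hint
  have hfi := minpoly.irreducible hint
  have hdeg : (minpoly K x).natDegree = Module.finrank K L := by
    rw [← IntermediateField.adjoin.finrank hint, hx, IntermediateField.finrank_top']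
  have hsum := fun b (hb : b ∈ U) (hex : ∃ c ∈ U, KeyPoly.Branch.Follows b c) =>
    KeyPoly.sum_followers hU hf hfi hpos hb hex
  refine ⟨fun b hb hA hne => ?_, fun b hb hA => ?_, fun b₀ _ U' hU' => hU'.eq_sum_pathTo hsum,
    hdeg, fun U' hU' => ?_⟩
  · obtain ⟨hm, h0⟩ := KeyPoly.Branch.key_monic_natDegree_pos hU hf hfi hpos hb
    exact KeyPoly.Branch.followers_of_not_caseA hU hf hfi hpos hb hA
      (KeyPoly.digit_zero_ne_zero_of_aeval_ne_zero hm h0 hint hne)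
  · exact KeyPoly.Branch.followers_of_caseA hU hf hfi hpos hb hA
  · rw [← hdeg]
    refine (hU'.eq_sum_pathTo hsum).trans (Finset.sum_congr rfl fun m hm => ?_)
    rw [hU'.prod_setD_mul_prod_setE (KeyPoly.mem_of_mem_leaves hm)]
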